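/- **Setting.** Consider $N$ bosons in the cube $\Lambda=(0,L)^3$ with Hamiltonian $$H_N=-\mu\sum_{i=1}^N\Delta_i+\sum_{1\le i<j\le N}v(|x_i-x_j|),\qquad \mu>0,$$ where $v:[0,\infty)\to[0,\infty]$ is measurable (the value $\infty$, i.e. a hard core, is allowed, and the range may be infinite) and has a finite scattering length $$a=\lim_{r\to\infty}\Bigl(r-\frac{u_0(r)}{u_0'(r)}\Bigr),$$ $u_0\not\equiv0$ being the solution of $-2\mu u_0''+vu_0=0$, $u_0(0)=0$ (with $u_0=0$ on $[0,r_0]$, where $r_0\ge 0$ is the smallest number such that $v$ is locally integrable on $(r_0,\infty)$). For a given boundary condition (Dirichlet, Neumann or periodic) $E_0(N,L)$ denotes the infimum of the quadratic form $\langle\Psi,H_N\Psi\rangle$ over the normalized, permutation-symmetric $\Psi\in L^2(\Lambda^N)$ in the corresponding first-order Sobolev space. In the periodic case the pair interaction may be $v(|x_i-x_j|)$, or $v$ of the distance on the torus, or the periodized potential $\sum_{n\in\mathbb Z^3}v(|x_i-x_j+Ln|)$; the bounds hold for each choice. For $\rho>0$ let $$e_0(\rho)=\limsup_{N\to\infty}\frac{E_0(N,L)}N,\qquad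 L=(N/\rho)^{1/3},$$ which is the thermodynamic limit of the energy per particle whenever that limit exists. **Theorem (Upper bound).** For $N\ge2$ and $L>0$ put $\rho_1=(N-1)/L^3$ and $b=(4\pi\rho_1/3)^{-1/3}$. 1. If $b>a$, then the ground state energy with periodic boundary conditions satisfies $$\frac{E_0(N,L)}N\le B:=4\pi\mu\rho_1a\,\frac{1-\frac ab+\left(\frac ab\right)^2+\frac12\left(\frac ab\right)^3}{\left(1-\frac ab\right)^8}.$$ 2. If $b>a$, then the ground state energy with Dirichlet boundary conditions satisfies $$\frac{E_0(N,L)}N\le B+\frac{\mu\,C(a/b)}{L^2},$$ where $C$ is a function of the ratio $a/b$ alone. (So at fixed $\rho_1$ the coefficient of $1/L^2$ is a constant, independent of $N$ and $L$.) 3. In the thermodynamic limit, for each of the boundary conditions (Dirichlet, Neumann, periodic), with $Y=4\pi\rho a^3/3$ and provided $Y<1$, $$e_0(\rho)\le4\pi\mu\rho a\,\frac{1-Y^{1/3}+Y^{2/3}-\frac12Y}{(1-Y^{1/3})^8}.$$ -/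

import Mathlib

open MeasureTheory Filter Topology Set
open scoped ENNReal

noncomputable section

namespace DiluteBose

/-- One-particle space `ℝ³` with its Euclidean norm. -/
abbrev Space : Type := EuclideanSpace ℝ (Fin 3)

/-- Configurations of `N` particles in `ℝ³` (with Lebesgue measure on `ℝ^(3N)`). -/
abbrev Config (N : ℕ) : Type := Fin N → Space

/-- `Λ^N`, where `Λ = (0, L)³`. -/
def box (N : ℕ) (L : ℝ) : Set (Config N) :=
  {x | ∀ i k, x i k ∈ Ioo 0 L}

/-- The unit vector of `ℝ^(3N)` in the direction of the `k`-th coordinate of particle `i`. -/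
def unitVec {N : ℕ} (i : Fin N) (k : Fin 3) : Config N :=
  Pi.single i (EuclideanSpace.single k 1)

/-- The vector `L n` of the lattice `L ℤ³`. -/
def latticeVec (L : ℝ) (n : Fin 3 → ℤ) : Space :=
  WithLp.toLp 2 fun k => L * (n k : ℝ)

/-! ### Scattering length

A radial potential is a function `v : ℝ → [0, ∞]` of the distance `r` (only `r ≥ 0` matters).
The value `∞` (hard cores) is allowed. -/

/-- `u` (with derivative `u'`) is a zero-energy scattering solution:
`- 2 μ u'' + v u = 0`, `u (0) = 0`, `u ≢ 0`.

The number `r₀` is the radius of the core of `v`: the smallest `r₀ ≥ 0` such that `v` is locally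
integrable on `(r₀, ∞)`. For a `v` that is locally integrable on `(0, ∞)` it is `0`; for the hard
core potential it is the radius of the core. On the core `u` vanishes, outside of it `u` solves
the equation in integrated form (`u'` is locally absolutely continuous), and `u` is continuous
at `r₀`. A nontrivial solution has a constant sign on `(r₀, ∞)`, here normalised to be `+`. -/
structure IsScatteringSolution (μ : ℝ) (v : ℝ → ℝ≥0∞) (r₀ : ℝ) (u u' : ℝ → ℝ) : Prop where
  core_nonneg : 0 ≤ r₀
  lintegral_lt_top : ∀ s t, r₀ < s → ∫⁻ r in Ioo s t, v r < ∞
  core_minimal : ∀ s t, 0 ≤ s → s < r₀ → r₀ < t → ∫⁻ r in Ioo s t, v r = ∞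
  eq_zero : ∀ r ∈ Icc 0 r₀, u r = 0
  tendsto_zero : Tendsto u (𝓝[>] r₀) (𝓝 0)
  pos : ∀ r, r₀ < r → 0 < u r
  hasDerivAt : ∀ r, r₀ < r → HasDerivAt u (u' r) r
  equation : ∀ s t, r₀ < s → s ≤ t → 2 * μ * (u' t - u' s) = ∫ r in s..t, (v r).toReal * u r

/-- `a` is the (finite) scattering length of `v`: `a = lim_{r → ∞} (r - u₀ (r) / u₀' (r))`. -/
def IsScatteringLength (μ : ℝ) (v : ℝ → ℝ≥0∞) (a : ℝ) : Prop :=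
  ∃ (r₀ : ℝ) (u u' : ℝ → ℝ), IsScatteringSolution μ v r₀ u u' ∧
    Tendsto (fun r => r - u r / u' r) atTop (𝓝 a)

/-! ### Boundary conditions and the quadratic form -/

/-- How two particles interact in a periodic box: through their distance in the box, through
their distance on the torus, or with all periodic images. -/
inductive ImageConvention
  | direct
  | nearest
  | sum

/-- Boundary conditions on the box. -/
inductive BoundaryCondition
  | dirichlet
  | neumann
  | periodic (c : ImageConvention)

/-- Distance on the torus `ℝ³ / L ℤ³`. -/
def torusDist (L : ℝ) (x y : Space) : ℝ :=
  ⨅ n : Fin 3 → ℤ, ‖x - y + latticeVec L n‖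

/-- The interaction of two particles at `x` and `y`. -/
def pairPotential (bc : BoundaryCondition) (v : ℝ → ℝ≥0∞) (L : ℝ) (x y : Space) : ℝ≥0∞ :=
  match bc with
  | .dirichlet => v ‖x - y‖
  | .neumann => v ‖x - y‖
  | .periodic .direct => v ‖x - y‖
  | .periodic .nearest => v (torusDist L x y)
  | .periodic .sum => ∑' n : Fin 3 → ℤ, v ‖x - y + latticeVec L n‖

/-- The smooth functions against which weak derivatives are tested. The wave functions with a
square integrable weak gradient are then
* Neumann: `H¹(Λ^N)`;
* periodic: `H¹` of the torus `(ℝ³ / L ℤ³)^N`;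
* Dirichlet: the functions whose extension by zero is in `H¹(ℝ^(3N))`, that is, `H¹₀(Λ^N)`. -/
def IsTestFunction (bc : BoundaryCondition) {N : ℕ} (L : ℝ) (φ : Config N → ℝ) : Prop :=
  ContDiff ℝ (⊤ : ℕ∞) φ ∧
  match bc with
  | .dirichlet => True
  | .neumann => HasCompactSupport φ ∧ tsupport φ ⊆ box N L
  | .periodic _ => ∀ i k x, φ (x + L • unitVec i k) = φ x

/-- `G i k` is the weak derivative of `Ψ` with respect to the `k`-th coordinate of particle `i`,
in the sense that goes with the boundary condition. -/
def IsWeakGradient (bc : BoundaryCondition) {N : ℕ} (L : ℝ) (Ψ : Config N → ℂ)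
    (G : Fin N → Fin 3 → Config N → ℂ) : Prop :=
  ∀ φ : Config N → ℝ, IsTestFunction bc L φ → ∀ i k,
    ∫ x in box N L, Ψ x * (fderiv ℝ φ x (unitVec i k) : ℂ) =
      - ∫ x in box N L, G i k x * (φ x : ℂ)

/-- `Ψ` is a normalised symmetric wave function with weak gradient `G` in `L²`. -/
structure IsBosonicState (bc : BoundaryCondition) {N : ℕ} (L : ℝ) (Ψ : Config N → ℂ)
    (G : Fin N → Fin 3 → Config N → ℂ) : Prop where
  memLp : MemLp Ψ 2 (volume.restrict (box N L))
  memLp_gradient : ∀ i k, MemLp (G i k) 2 (volume.restrict (box N L))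
  isWeakGradient : IsWeakGradient bc L Ψ G
  symmetric : ∀ σ : Equiv.Perm (Fin N), ∀ᵐ x ∂volume.restrict (box N L), Ψ (x ∘ σ) = Ψ x
  normalised : ∫⁻ x in box N L, ‖Ψ x‖ₑ ^ 2 = 1

/-- The quadratic form `⟨Ψ, H_N Ψ⟩` of `H_N = - μ ∑ Δ_i + ∑_{i < j} v (|x_i - x_j|)`. -/
def energy (bc : BoundaryCondition) (μ : ℝ) (v : ℝ → ℝ≥0∞) {N : ℕ} (L : ℝ) (Ψ : Config N → ℂ)
    (G : Fin N → Fin 3 → Config N → ℂ) : ℝ≥0∞ :=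
  (ENNReal.ofReal μ * ∑ i, ∑ k, ∫⁻ x in box N L, ‖G i k x‖ₑ ^ 2) +
    ∫⁻ x in box N L, (∑ i, ∑ j ∈ Finset.Ioi i, pairPotential bc v L (x i) (x j)) * ‖Ψ x‖ₑ ^ 2

/-- The bosonic ground state energy `E₀ (N, L)`. -/
def groundStateEnergy (bc : BoundaryCondition) (μ : ℝ) (v : ℝ → ℝ≥0∞) (N : ℕ) (L : ℝ) : ℝ≥0∞ :=
  ⨅ (Ψ : Config N → ℂ) (G : Fin N → Fin 3 → Config N → ℂ) (_ : IsBosonicState bc L Ψ G),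
    energy bc μ v L Ψ G

/-- The ground state energy per particle in the thermodynamic limit, `N → ∞` with `N = ρ L³`.
The upper limit makes sense in all cases, and is the limit whenever that exists. -/
def energyPerParticle (bc : BoundaryCondition) (μ : ℝ) (v : ℝ → ℝ≥0∞) (ρ : ℝ) : ℝ≥0∞ :=
  limsup (fun N : ℕ => groundStateEnergy bc μ v N ((N / ρ) ^ (1 / 3 : ℝ)) / N) atTop

theorem energyPerParticle_eq_of_tendsto {bc : BoundaryCondition} {μ : ℝ} {v : ℝ → ℝ≥0∞} {ρ : ℝ}
    {e : ℝ≥0∞}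
    (h : Tendsto (fun N : ℕ => groundStateEnergy bc μ v N ((N / ρ) ^ (1 / 3 : ℝ)) / N)
      atTop (𝓝 e)) :
    energyPerParticle bc μ v ρ = e :=
  h.limsup_eq

/-! ### The quantities in the bounds -/

/-- `ρ₁ = (N - 1) / L³`. -/
def rhoOne (N : ℕ) (L : ℝ) : ℝ := ((N : ℝ) - 1) / L ^ 3

/-- `b = (4 π ρ₁ / 3)^(-1/3)`. -/
def bLength (N : ℕ) (L : ℝ) : ℝ := (4 * Real.pi * rhoOne N L / 3) ^ (-(1 / 3) : ℝ)

/-- `4 π μ ρ₁ a (1 - a/b + (a/b)² + ½ (a/b)³) / (1 - a/b)⁸`. -/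
def dysonBound (μ a : ℝ) (N : ℕ) (L : ℝ) : ℝ :=
  4 * Real.pi * μ * rhoOne N L * a *
    ((1 - a / bLength N L + (a / bLength N L) ^ 2 + 1 / 2 * (a / bLength N L) ^ 3) /
      (1 - a / bLength N L) ^ 8)

end DiluteBose

end

open DiluteBose

namespace DiluteBose

open scoped NNReal

/-! ### Zero-energy scattering solutions -/

namespace IsScatteringSolution

variable {μ : ℝ} {v : ℝ → ℝ≥0∞} {r₀ : ℝ} {u u' : ℝ → ℝ}

/-! The bound is variational. The trial function is the Jastrow product of `f(|x_i - x_j|)` over all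
pairs, where `f(r)` is essentially `u(r)/r`, scaled to reach 1 at `r = b` and constant beyond. The
length `b` is chosen so that `N - 1` balls of radius `b` have total volume `L³`. With Dirichlet
conditions each particle also carries a cutoff vanishing at the walls.

One pair: `u` is convex, and `r - u/u'` is the zero of its tangent at `r`, which increases to `a`.
Hence `u' ≤ u(b)/(b - a)` everywhere, and left of `b` the graph of `u` lies above the chord from
`(a, 0)` to `(b, u(b))`. Integration by parts turns the pair energy inside `b` into a boundary term
at `b`; the bound for the tail of `v` beyond `b` contains the same term with the opposite sign. The
total is at most `4πμ a/(1 - a/b)`, and the chord gives `∫ (1 - f²) ≤ (4π/3) b³ (a/b)`, both up to a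
small regularisation error (`exists_profile`, `lintegral_one_sub_sq_le`).

Many particles: as `0 ≤ f ≤ 1`, removing a particle from the weight only increases it, while
reinserting it costs at most a factor `L³/A`, where `A = L³ - (N - 1) ∫ (1 - f²)`, about `L³ (1 -
a/b)`. Thus the expectation of a pair function is at most its integral over `A`. A product of two
gradients on one particle, involving three particles, costs `K² L³/A³` with `K = ∫ f |∇f|`. With `x
= a/b` the energy per particle is, up to errors, at most `4πμρ₁a (1/(1 - x)² + 3x/(1 - x)⁵)`.

For `0 < x < 1` this is strictly below the stated bound, even with `-x³/2` in its numerator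
(`exists_mul_jastrowFactor_le`). The gap pays for one small parameter `t`, used both to regularise
`f` and to set the wall layer width `tL`. Since `t` depends only on `x`, the wall costs `μ C(x)/L²`,
which disappears in the thermodynamic limit. On the torus `f` is evaluated at the torus distance,
and its pair integrals are dominated by those over `ℝ³`. -/

theorem integrableOn_toReal (h : IsScatteringSolution μ v r₀ u u') (hv : Measurable v) {s t : ℝ}
    (hs : r₀ < s) : IntegrableOn (fun r => (v r).toReal) (Ioo s t) :=
  integrable_toReal_of_lintegral_ne_top hv.aemeasurable (h.lintegral_lt_top s t hs).ne

theorem ae_lt_top (h : IsScatteringSolution μ v r₀ u u') (hv : Measurable v) {s t : ℝ}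
    (hs : r₀ < s) : ∀ᵐ r ∂volume.restrict (Ioo s t), v r < ∞ :=
  MeasureTheory.ae_lt_top hv (h.lintegral_lt_top s t hs).ne

theorem continuousAt (h : IsScatteringSolution μ v r₀ u u') {r : ℝ} (hr : r₀ < r) :
    ContinuousAt u r := (h.hasDerivAt r hr).continuousAt

theorem continuousOn (h : IsScatteringSolution μ v r₀ u u') : ContinuousOn u (Ioi r₀) :=
  fun _ hr => (h.continuousAt hr).continuousWithinAt

theorem intervalIntegrable (h : IsScatteringSolution μ v r₀ u u') (hv : Measurable v) {s t : ℝ}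
    (hs : r₀ < s) (hst : s ≤ t) :
    IntervalIntegrable (fun r => (v r).toReal * u r) volume s t := by
  have h1 : IntervalIntegrable (fun r => (v r).toReal) volume s t :=
    (intervalIntegrable_iff_integrableOn_Ioo_of_le hst).2 (h.integrableOn_toReal hv hs)
  refine h1.mul_continuousOn (h.continuousOn.mono fun r hr => ?_)
  rw [uIcc_of_le hst] at hr
  exact hs.trans_le hr.1

theorem deriv_mono (h : IsScatteringSolution μ v r₀ u u') (hμ : 0 < μ) {s t : ℝ}
    (hs : r₀ < s) (hst : s ≤ t) : u' s ≤ u' t := by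
  have h1 := h.equation s t hs hst
  have h2 : 0 ≤ ∫ r in s..t, (v r).toReal * u r :=
    intervalIntegral.integral_nonneg hst fun r hr =>
      mul_nonneg ENNReal.toReal_nonneg (h.pos r (hs.trans_le hr.1)).le
  rw [← h1] at h2
  have := nonneg_of_mul_nonneg_right h2 (by positivity)
  linarith

/-- The derivative is monotone because `v u ≥ 0`, so `u` is convex and lies above its tangents; the
mean value theorem suffices. -/
theorem tangent_le (h : IsScatteringSolution μ v r₀ u u') (hμ : 0 < μ) {r y : ℝ}
    (hr : r₀ < r) (hy : r₀ < y) : u r + u' r * (y - r) ≤ u y := by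
  rcases lt_trichotomy r y with hlt | rfl | hlt
  · obtain ⟨c, hc, hc'⟩ := exists_hasDerivAt_eq_slope u u' hlt
      (h.continuousOn.mono fun z hz => hr.trans_le hz.1) fun z hz => h.hasDerivAt z (hr.trans hz.1)
    have h1 := h.deriv_mono hμ hr hc.1.le
    rw [hc', le_div_iff₀ (by linarith)] at h1
    linarith
  · simp
  · obtain ⟨c, hc, hc'⟩ := exists_hasDerivAt_eq_slope u u' hlt
      (h.continuousOn.mono fun z hz => hy.trans_le hz.1) fun z hz => h.hasDerivAt z (hy.trans hz.1)
    have h1 := h.deriv_mono hμ (hy.trans hc.1) hc.2.le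
    rw [hc', div_le_iff₀ (by linarith)] at h1
    linarith

/-- The tangent at `r` is followed down to the core, where `u` tends to 0. -/
theorem le_sub_mul_deriv (h : IsScatteringSolution μ v r₀ u u') (hμ : 0 < μ) {r : ℝ}
    (hr : r₀ < r) : u r ≤ (r - r₀) * u' r := by
  have h1 : Tendsto (fun y => u r + u' r * (y - r)) (𝓝[>] r₀) (𝓝 (u r + u' r * (r₀ - r))) := by
    refine Tendsto.mono_left (Continuous.tendsto ?_ _) nhdsWithin_le_nhds
    fun_prop
  have h2 := le_of_tendsto_of_tendsto h1 h.tendsto_zero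
    (by filter_upwards [self_mem_nhdsWithin] with y hy using h.tangent_le hμ hr hy)
  linarith

theorem deriv_pos (h : IsScatteringSolution μ v r₀ u u') (hμ : 0 < μ) {r : ℝ} (hr : r₀ < r) :
    0 < u' r := by
  have h1 := h.le_sub_mul_deriv hμ hr
  exact pos_of_mul_pos_right (lt_of_lt_of_le (h.pos r hr) h1) (by linarith)

/-- `r - u/u'` is the zero of the tangent at `r`, and for a convex function it moves to the right
with `r`. The scattering length is therefore an upper bound for all these zeros. -/
theorem sub_div_mono (h : IsScatteringSolution μ v r₀ u u') (hμ : 0 < μ) {s t : ℝ}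
    (hs : r₀ < s) (hst : s ≤ t) : s - u s / u' s ≤ t - u t / u' t := by
  have hs' := h.deriv_pos hμ hs
  have ht' := h.deriv_pos hμ (hs.trans_le hst)
  have hus := h.pos s hs
  set zs := s - u s / u' s with hzs
  set zt := t - u t / u' t with hzt
  have e1 : u s = u' s * (s - zs) := by rw [hzs]; field_simp; ring
  have e2 : u t = u' t * (t - zt) := by rw [hzt]; field_simp; ring
  have h1 := h.tangent_le hμ (hs.trans_le hst) hs
  -- If the zero had moved left, the steeper tangent at `t` would lie above `u` at the point `s`.
  by_contra! hlt
  have h3 : zs < s := by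
    rw [hzs]; have := div_pos hus hs'; linarith
  have h4 : u' t * (s - zt) ≤ u' s * (s - zs) := by rw [e2, e1] at h1; linarith
  have h5 := mul_le_mul_of_nonneg_right (h.deriv_mono hμ hs hst) (by linarith : 0 ≤ s - zt)
  have h6 := mul_lt_mul_of_pos_left (by linarith : s - zs < s - zt) hs'
  linarith

/-! ### Bounds in terms of the scattering length. -/

section ScatteringLength

variable {a : ℝ} (ha : Tendsto (fun r => r - u r / u' r) atTop (𝓝 a))
include ha

theorem sub_div_le (h : IsScatteringSolution μ v r₀ u u') (hμ : 0 < μ) {r : ℝ} (hr : r₀ < r) :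
    r - u r / u' r ≤ a :=
  ge_of_tendsto ha (by
    filter_upwards [eventually_ge_atTop r] with t ht using h.sub_div_mono hμ hr ht)

theorem core_le (h : IsScatteringSolution μ v r₀ u u') (hμ : 0 < μ) : r₀ ≤ a := by
  have hr : r₀ < r₀ + 1 := by linarith
  have h1 := h.sub_div_le ha hμ hr
  have h2 := h.le_sub_mul_deriv hμ hr
  rw [← div_le_iff₀ (h.deriv_pos hμ hr)] at h2
  linarith

theorem scatteringLength_nonneg (h : IsScatteringSolution μ v r₀ u u') (hμ : 0 < μ) : 0 ≤ a :=
  h.core_nonneg.trans (h.core_le ha hμ)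

theorem deriv_mul_sub_le (h : IsScatteringSolution μ v r₀ u u') (hμ : 0 < μ) {r : ℝ}
    (hr : r₀ < r) : u' r * (r - a) ≤ u r := by
  have h1 := h.sub_div_le ha hμ hr
  have h2 : r - a ≤ u r / u' r := by linarith
  rw [le_div_iff₀ (h.deriv_pos hμ hr)] at h2
  linarith

/-- The tangent at `r` has its zero at or left of `a`, and its value at `b` is at most `u b`. The
slope is thus bounded for all `r`, also beyond `b`, by that of the chord from `(a, 0)` to `(b, u
b)`. -/
theorem deriv_mul_sub_le' (h : IsScatteringSolution μ v r₀ u u') (hμ : 0 < μ) {r b : ℝ}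
    (hr : r₀ < r) (hb : a < b) : u' r * (b - a) ≤ u b := by
  have h1 := h.tangent_le hμ hr (lt_of_le_of_lt (h.core_le ha hμ) hb)
  have h2 := h.deriv_mul_sub_le ha hμ hr
  linarith

/-- The quantity `r u' - u` is at most `a u (b) / (b - a)` everywhere. -/
theorem moment_le (h : IsScatteringSolution μ v r₀ u u') (hμ : 0 < μ) {r b : ℝ}
    (hr : r₀ < r) (hb : a < b) : r * u' r - u r ≤ a * (u b / (b - a)) := by
  have h1 := h.deriv_mul_sub_le ha hμ hr
  have h2 := h.deriv_mul_sub_le' ha hμ hr hb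
  rw [← le_div_iff₀ (by linarith)] at h2
  have := mul_le_mul_of_nonneg_left h2 (h.scatteringLength_nonneg ha hμ)
  linarith

/-- The tangent at `b` is no steeper than the chord from `(a, 0)`, so to the left of `b` it stays
above the chord, and `u` stays above the tangent. This is the source of the lower bound on the
profile. -/
theorem chord_le (h : IsScatteringSolution μ v r₀ u u') (hμ : 0 < μ) {r b : ℝ}
    (hr : r₀ < r) (hrb : r ≤ b) (hb : a < b) : u b / (b - a) * (r - a) ≤ u r := by
  have hb' := lt_of_le_of_lt (h.core_le ha hμ) hb
  have h1 := h.tangent_le hμ hb' hr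
  have h2 := h.deriv_mul_sub_le ha hμ hb'
  rw [← le_div_iff₀ (by linarith)] at h2
  have h3 := mul_le_mul_of_nonneg_right h2 (by linarith : 0 ≤ b - r)
  have h4 : u b / (b - a) * (b - a) = u b := div_mul_cancel₀ _ (by linarith)
  nlinarith

end ScatteringLength

/-! ### The quantity `r u' - u` and the scattering energy. -/

theorem moment_nonneg (h : IsScatteringSolution μ v r₀ u u') (hμ : 0 < μ) {r : ℝ} (hr : r₀ < r) :
    0 ≤ r * u' r - u r := by
  have h1 := h.le_sub_mul_deriv hμ hr
  have h2 := mul_nonneg h.core_nonneg (h.deriv_pos hμ hr).le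
  linarith

/-- Formally the derivative is `r u'' ≥ 0`; the tangent inequality gives the same without a second
derivative. -/
theorem moment_mono (h : IsScatteringSolution μ v r₀ u u') (hμ : 0 < μ) {s t : ℝ}
    (hs : r₀ < s) (hst : s ≤ t) : s * u' s - u s ≤ t * u' t - u t := by
  have h1 := h.tangent_le hμ (hs.trans_le hst) hs
  have h2 := mul_le_mul_of_nonneg_left (h.deriv_mono hμ hs hst) (h.core_nonneg.trans hs.le)
  linarith

theorem hasDerivAt_div (h : IsScatteringSolution μ v r₀ u u') {r : ℝ} (hr : r₀ < r) :
    HasDerivAt (fun r => u r / r) ((r * u' r - u r) / r ^ 2) r := by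
  have := (h.hasDerivAt r hr).div (hasDerivAt_id r) (h.core_nonneg.trans_lt hr).ne'
  refine HasDerivAt.congr_deriv (f := fun r => u r / r) this ?_
  simp only [id]
  ring

theorem div_mono (h : IsScatteringSolution μ v r₀ u u') (hμ : 0 < μ) {s t : ℝ}
    (hs : r₀ < s) (hst : s ≤ t) : u s / s ≤ u t / t := by
  have hs0 := h.core_nonneg.trans_lt hs
  have h1 := h.tangent_le hμ hs (hs.trans_le hst)
  have h2 := h.moment_nonneg hμ hs
  rw [div_le_div_iff₀ hs0 (by linarith)]
  have := mul_nonneg h2 (by linarith : 0 ≤ t - s)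
  nlinarith

theorem continuousOn_deriv (h : IsScatteringSolution μ v r₀ u u') (hμ : 0 < μ) (hv : Measurable v) :
    ContinuousOn u' (Ioi r₀) := by
  intro r hr
  have hr : r₀ < r := hr
  set s := (r₀ + r) / 2 with hs
  have hs1 : r₀ < s := by linarith
  have hs2 : s < r := by linarith
  have h1 := intervalIntegral.continuousOn_primitive_interval
    ((intervalIntegrable_iff' ).1 (h.intervalIntegrable hv hs1 (by linarith : s ≤ r + 1)))
  rw [uIcc_of_le (by linarith)] at h1
  have h2 : ContinuousOn u' (Icc s (r + 1)) := by
    have : ContinuousOn (fun x => u' s + (∫ r in s..x, (v r).toReal * u r) / (2 * μ))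
      (Icc s (r + 1)) := by fun_prop
    refine this.congr fun x hx => ?_
    simp only
    rw [← h.equation s x hs1 hx.1]
    field_simp
    ring
  exact (h2.continuousAt (Icc_mem_nhds hs2 (by linarith))).continuousWithinAt

/-- Integration by parts against `2 μ u'' = v u`. As `u''` exists only in the integrated sense, `2 μ
u'` is replaced by a primitive of `v u`, which is absolutely continuous. It is applied with `φ = u`
for the energy inside `b` and with `φ = id` for the tail. -/
theorem integral_mul (h : IsScatteringSolution μ v r₀ u u') (hv : Measurable v) {s t : ℝ}
    (hs : r₀ < s) (hst : s ≤ t) {φ φ' : ℝ → ℝ} {C : ℝ}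
    (hφ : ∀ r ∈ Icc s t, HasDerivAt φ (φ' r) r)
    (hC : ∀ r ∈ Icc s t, |φ' r| ≤ C) (hint : IntervalIntegrable φ' volume s t)
    (hint' : IntervalIntegrable (fun r => φ' r * u' r) volume s t) :
    ∫ r in s..t, φ r * ((v r).toReal * u r) =
      2 * μ * (φ t * u' t - φ s * u' s - ∫ r in s..t, φ' r * u' r) := by
  have hI := h.intervalIntegrable hv hs hst
  set F : ℝ → ℝ := fun x => ∫ r in s..x, (v r).toReal * u r with hF
  have hFac : AbsolutelyContinuousOnInterval F s t :=
    hI.absolutelyContinuousOnInterval_intervalIntegral (by simp)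
  have hφac : AbsolutelyContinuousOnInterval φ s t := by
    have : LipschitzOnWith C.toNNReal φ (uIcc s t) := by
      rw [uIcc_of_le hst]
      refine (convex_Icc s t).lipschitzOnWith_of_nnnorm_hasDerivWithin_le
        (fun r hr => (hφ r hr).hasDerivWithinAt) fun r hr => ?_
      rw [← NNReal.coe_le_coe, coe_nnnorm, Real.norm_eq_abs]
      exact (hC r hr).trans (Real.le_coe_toNNReal C)
    exact this.absolutelyContinuousOnInterval
  have h1 := hφac.integral_mul_deriv_eq_deriv_mul hFac
  have h2 : ∫ r in s..t, φ r * deriv F r = ∫ r in s..t, φ r * ((v r).toReal * u r) := by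
    refine intervalIntegral.integral_congr_ae ?_
    filter_upwards [hI.ae_hasDerivAt_integral] with x hx hx'
    rw [(hx (uIoc_subset_uIcc hx') s (by simp)).deriv]
  have h3 : ∫ r in s..t, deriv φ r * F r =
      2 * μ * (∫ r in s..t, φ' r * u' r) - 2 * μ * u' s * (φ t - φ s) := by
    have e : ∫ r in s..t, φ' r = φ t - φ s :=
      intervalIntegral.integral_eq_sub_of_hasDerivAt
        (fun r hr => hφ r (by rwa [uIcc_of_le hst] at hr)) hint
    rw [← e, ← intervalIntegral.integral_const_mul, ← intervalIntegral.integral_const_mul,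
      ← intervalIntegral.integral_sub (hint'.const_mul _) (hint.const_mul _)]
    refine intervalIntegral.integral_congr fun r hr => ?_
    rw [uIcc_of_le hst] at hr
    simp only [hF]
    rw [(hφ r hr).deriv, ← h.equation s r hs hr.1]
    ring
  have h4 : F t = 2 * μ * (u' t - u' s) := (h.equation s t hs hst).symm
  have h5 : F s = 0 := by simp [hF]
  rw [h2, h3, h4, h5] at h1
  rw [h1]
  ring

/-- For `f = u/r` one has `r² f'² = (u' - u/r)²`, and the integrand is formally the derivative of `μ
(u u' - u²/r)`. -/
theorem integral_energy (h : IsScatteringSolution μ v r₀ u u') (hμ : 0 < μ) (hv : Measurable v)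
    {s t : ℝ} (hs : r₀ < s) (hst : s ≤ t) :
    ∫ r in s..t, (μ * (u' r - u r / r) ^ 2 + (v r).toReal * u r ^ 2 / 2) =
      μ * (u t / t * (t * u' t - u t)) - μ * (u s / s * (s * u' s - u s)) := by
  have hs0 := h.core_nonneg.trans_lt hs
  have hsub : uIcc s t ⊆ Ioi r₀ := by
    rw [uIcc_of_le hst]; exact fun r hr => hs.trans_le hr.1
  have hsub0 : ∀ r ∈ uIcc s t, r ≠ 0 := fun r hr => (h.core_nonneg.trans_lt (hsub hr)).ne'
  have cu : ContinuousOn u (uIcc s t) := h.continuousOn.mono hsub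
  have cu' : ContinuousOn u' (uIcc s t) := (h.continuousOn_deriv hμ hv).mono hsub
  have h1 := h.integral_mul hv hs hst (φ := u) (φ' := u') (C := u' t)
    (fun r hr => h.hasDerivAt r (hs.trans_le hr.1))
    (fun r hr => by
      rw [abs_of_pos (h.deriv_pos hμ (hs.trans_le hr.1))]
      exact h.deriv_mono hμ (hs.trans_le hr.1) hr.2)
    cu'.intervalIntegrable (cu'.mul cu').intervalIntegrable
  have h2 : ∫ r in s..t, (2 * u r * u' r / r - u r ^ 2 / r ^ 2) = u t ^ 2 / t - u s ^ 2 / s := by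
    refine intervalIntegral.integral_eq_sub_of_hasDerivAt (f := fun r => u r ^ 2 / r)
      (fun r hr => ?_) (ContinuousOn.intervalIntegrable ?_)
    · have := ((h.hasDerivAt r (hsub hr)).pow 2).div (hasDerivAt_id r) (hsub0 r hr)
      refine HasDerivAt.congr_deriv (f := fun r => u r ^ 2 / r) this ?_
      have := hsub0 r hr
      simp only [id, Pi.pow_apply]
      field_simp
      push_cast
      ring
    · refine ((continuousOn_const.mul cu).mul cu').div continuousOn_id hsub0 |>.sub
        ((cu.pow 2).div (continuousOn_id.pow 2) fun r hr => pow_ne_zero 2 (hsub0 r hr))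
  have iA : IntervalIntegrable (fun r => u' r * u' r) volume s t := (cu'.mul cu').intervalIntegrable
  have iB : IntervalIntegrable (fun r => 2 * u r * u' r / r - u r ^ 2 / r ^ 2) volume s t :=
    (((continuousOn_const.mul cu).mul cu').div continuousOn_id hsub0 |>.sub
        ((cu.pow 2).div (continuousOn_id.pow 2) fun r hr =>
          pow_ne_zero 2 (hsub0 r hr))).intervalIntegrable
  have iC : IntervalIntegrable (fun r => u r * ((v r).toReal * u r)) volume s t :=
    (h.intervalIntegrable hv hs hst).continuousOn_mul cu
  have h3 : ∫ r in s..t, (μ * (u' r - u r / r) ^ 2 + (v r).toReal * u r ^ 2 / 2) =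
      ∫ r in s..t, (μ * (u' r * u' r - (2 * u r * u' r / r - u r ^ 2 / r ^ 2))
        + 1 / 2 * (u r * ((v r).toReal * u r))) := by
    refine intervalIntegral.integral_congr fun r hr => ?_
    have := hsub0 r hr
    field_simp
    ring
  rw [h3, intervalIntegral.integral_add ((iA.sub iB).const_mul _) (iC.const_mul _),
    intervalIntegral.integral_const_mul, intervalIntegral.integral_const_mul,
    intervalIntegral.integral_sub iA iB, h2, h1]
  have : s ≠ 0 := hs0.ne'
  have : t ≠ 0 := (hs0.trans_le hst).ne'
  field_simp
  ring

/-- The boundary term at the lower end is nonnegative and is dropped; monotone convergence then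
moves that end to the core. -/
theorem lintegral_energy_le (h : IsScatteringSolution μ v r₀ u u') (hμ : 0 < μ)
    (hv : Measurable v) {t : ℝ} (ht : r₀ < t) :
    ∫⁻ r in Ioo r₀ t, (ENNReal.ofReal (μ * (u' r - u r / r) ^ 2) +
      v r * ENNReal.ofReal (u r ^ 2) / 2) ≤ ENNReal.ofReal (μ * (u t / t * (t * u' t - u t))) := by
  have key : ∀ s, r₀ < s → s < t → ∫⁻ r in Ioo s t, (ENNReal.ofReal (μ * (u' r - u r / r) ^ 2) +
      v r * ENNReal.ofReal (u r ^ 2) / 2) ≤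
      ENNReal.ofReal (μ * (u t / t * (t * u' t - u t))) := by
    intro s hs hst
    have hs0 := h.core_nonneg.trans_lt hs
    have h1 : ∀ᵐ r ∂volume.restrict (Ioo s t), ENNReal.ofReal (μ * (u' r - u r / r) ^ 2) +
      v r * ENNReal.ofReal (u r ^ 2) / 2 =
        ENNReal.ofReal (μ * (u' r - u r / r) ^ 2 + (v r).toReal * u r ^ 2 / 2) := by
      filter_upwards [h.ae_lt_top hv hs] with r hr
      rw [ENNReal.ofReal_add (by positivity) (by positivity),
        ENNReal.ofReal_div_of_pos (by norm_num), ENNReal.ofReal_mul ENNReal.toReal_nonneg,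
        ENNReal.ofReal_toReal hr.ne]
      simp
    rw [lintegral_congr_ae h1]
    have hsub : uIcc s t ⊆ Ioi r₀ := by
      rw [uIcc_of_le hst.le]; exact fun r hr => hs.trans_le hr.1
    have hsub0 : ∀ r ∈ uIcc s t, r ≠ 0 := fun r hr => (h.core_nonneg.trans_lt (hsub hr)).ne'
    have cu : ContinuousOn u (uIcc s t) := h.continuousOn.mono hsub
    have cu' : ContinuousOn u' (uIcc s t) := (h.continuousOn_deriv hμ hv).mono hsub
    have hint : IntervalIntegrable (fun r => μ * (u' r - u r / r) ^ 2 + (v r).toReal * u r ^ 2 / 2)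
        volume s t := by
      refine IntervalIntegrable.add
        (continuousOn_const.mul ((cu'.sub (cu.div continuousOn_id hsub0)).pow 2)).intervalIntegrable
        ?_
      have := ((h.intervalIntegrable hv hs hst.le).continuousOn_mul cu).const_mul (1 / 2)
      refine this.congr fun r _ => ?_
      ring
    rw [intervalIntegrable_iff_integrableOn_Ioo_of_le hst.le] at hint
    rw [← ofReal_integral_eq_lintegral_ofReal hint (ae_of_all _ fun r => by positivity),
      ← integral_Ioc_eq_integral_Ioo, ← intervalIntegral.integral_of_le hst.le,
      h.integral_energy hμ hv hs hst.le]
    refine ENNReal.ofReal_le_ofReal ?_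
    have := mul_nonneg (div_nonneg (h.pos s hs).le hs0.le) (h.moment_nonneg hμ hs)
    have := mul_nonneg hμ.le this
    linarith
  obtain ⟨s, hs, hs', hlim⟩ := exists_seq_strictAnti_tendsto' ht
  have hU : Ioo r₀ t = ⋃ n, Ioo (s n) t := by
    ext r
    simp only [mem_Ioo, mem_iUnion, exists_and_right]
    refine and_congr_left fun _ => ⟨fun hr => ?_, fun ⟨n, hn⟩ => (hs' n).1.trans hn⟩
    exact ((tendsto_order.1 hlim).2 r hr).exists
  rw [hU, setLIntegral_iUnion_of_directed _
    (directed_of_isDirected_le fun i j hij => Ioo_subset_Ioo_left (hs.antitone hij))]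
  exact iSup_le fun n => key _ (hs' n).1 (hs' n).2

/-- The profile is constant beyond `b`, but `v` may still act there. Since `u/r` increases, the
integrand is at most `(u b / b) r v u / 2`, whose integral is `μ u b / b` times the increase of `r
u' - u`, and `moment_le` bounds this quantity at infinity. The subtracted term is the boundary term
of `lintegral_energy_le` at `b`. -/
theorem lintegral_tail_le (h : IsScatteringSolution μ v r₀ u u') (hμ : 0 < μ)
    (hv : Measurable v) {a b : ℝ} (ha : Tendsto (fun r => r - u r / u' r) atTop (𝓝 a))
    (hb : a < b) :
    ∫⁻ r in Ioi b, v r * ENNReal.ofReal ((u b / b) ^ 2 * r ^ 2) / 2 ≤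
      ENNReal.ofReal (μ * (u b / b * (a * (u b / (b - a)) - (b * u' b - u b)))) := by
  have hb' : r₀ < b := lt_of_le_of_lt (h.core_le ha hμ) hb
  have hb0 := h.core_nonneg.trans_lt hb'
  have hub := h.pos b hb'
  have key : ∀ T, b < T → ∫⁻ r in Ioo b T, v r * ENNReal.ofReal ((u b / b) ^ 2 * r ^ 2) / 2 ≤
      ENNReal.ofReal (μ * (u b / b * (a * (u b / (b - a)) - (b * u' b - u b)))) := by
    intro T hT
    have hsub : uIcc b T ⊆ Ioi r₀ := by
      rw [uIcc_of_le hT.le]; exact fun r hr => hb'.trans_le hr.1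
    have cu' : ContinuousOn u' (uIcc b T) := (h.continuousOn_deriv hμ hv).mono hsub
    have h1 := h.integral_mul hv hb' hT.le (φ := id) (φ' := fun _ => 1) (C := 1)
      (fun r _ => hasDerivAt_id r) (by simp) (by simp) (by simpa using cu'.intervalIntegrable)
    have h2 : ∫ r in b..T, u' r = u T - u b :=
      intervalIntegral.integral_eq_sub_of_hasDerivAt (fun r hr => h.hasDerivAt r (hsub hr))
        cu'.intervalIntegrable
    simp only [id, one_mul, h2] at h1
    have hint : IntervalIntegrable (fun r => r * ((v r).toReal * u r)) volume b T :=
      (h.intervalIntegrable hv hb' hT.le).continuousOn_mul continuousOn_id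
    rw [intervalIntegrable_iff_integrableOn_Ioo_of_le hT.le] at hint
    calc _ ≤ ∫⁻ r in Ioo b T, ENNReal.ofReal (u b / b / 2 * (r * ((v r).toReal * u r))) := by
          refine lintegral_mono_ae ?_
          filter_upwards [h.ae_lt_top hv hb', ae_restrict_mem measurableSet_Ioo] with r hr hr'
          have hr0 : 0 < r := hb0.trans hr'.1
          have hd := h.div_mono hμ hb' hr'.1.le
          rw [le_div_iff₀ hr0] at hd
          calc _ = ENNReal.ofReal ((v r).toReal * ((u b / b) ^ 2 * r ^ 2) / 2) := by
                rw [ENNReal.ofReal_div_of_pos (by norm_num),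
                  ENNReal.ofReal_mul ENNReal.toReal_nonneg, ENNReal.ofReal_toReal hr.ne]
                simp
            _ ≤ _ := by
                refine ENNReal.ofReal_le_ofReal ?_
                have : 0 ≤ (v r).toReal * (u b / b) * r := by positivity
                nlinarith [mul_le_mul_of_nonneg_left hd this]
      _ = ENNReal.ofReal (μ * (u b / b * ((T * u' T - u T) - (b * u' b - u b)))) := by
          rw [← ofReal_integral_eq_lintegral_ofReal (hint.const_mul _), integral_const_mul,
            ← integral_Ioc_eq_integral_Ioo, ← intervalIntegral.integral_of_le hT.le, h1]
          · congr 1; ring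
          · filter_upwards [ae_restrict_mem measurableSet_Ioo] with r hr
            have hr0 : 0 < r := hb0.trans hr.1
            have := h.pos r (hb'.trans hr.1)
            simp only [Pi.zero_apply]
            positivity
      _ ≤ _ := by
          have := h.moment_le ha hμ (hb'.trans hT) hb
          gcongr
  have hU : Ioi b = ⋃ n : ℕ, Ioo b (b + 1 + n) := by
    ext r
    simp only [mem_Ioi, mem_iUnion, mem_Ioo, exists_and_left]
    refine ⟨fun hr => ⟨hr, ?_⟩, fun hr => hr.1⟩
    obtain ⟨n, hn⟩ := exists_nat_gt r
    exact ⟨⌈r - b⌉₊, by have := Nat.le_ceil (r - b); linarith⟩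
  rw [hU, setLIntegral_iUnion_of_directed _
    (directed_of_isDirected_le fun i j hij => Ioo_subset_Ioo_right (by
      have : (i : ℝ) ≤ j := by exact_mod_cast hij
      linarith))]
  exact iSup_le fun n => key _ (by have : (0 : ℝ) ≤ n := n.cast_nonneg; linarith)

end IsScatteringSolution

/-! ### Radial profiles -/

/-- A radial profile `f` with derivative `g` (away from two points), cut off at distance `b`,
which nearly saturates the scattering energy of `v`. -/
structure IsProfile (μ : ℝ) (v : ℝ → ℝ≥0∞) (a b τ : ℝ) (f g : ℝ → ℝ) : Prop where
  lipschitz : ∃ C, LipschitzWith C f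
  mono : Monotone f
  nonneg : ∀ r, 0 ≤ f r
  eq_one : ∀ r, b ≤ r → f r = 1
  measurable : Measurable g
  hasDerivAt : ∃ p, 0 < p ∧ ∀ r, r ≠ p → r ≠ b → HasDerivAt f (g r) r
  deriv_nonneg : ∀ r, 0 ≤ g r
  deriv_eq_zero : ∀ r, r ∉ Ioo 0 b → g r = 0
  deriv_le : ∀ r, 0 < r → g r * r ^ 2 ≤ a / (1 - a / b) / (1 - τ)
  le_sq : ∀ r, a < r → r < b → 0 < r → ((1 - a / r) / (1 - a / b)) ^ 2 - 2 * τ ≤ f r ^ 2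
  energy_le : ∫⁻ r in Ioi 0, ENNReal.ofReal (r ^ 2) *
    (ENNReal.ofReal (μ * g r ^ 2) + v r * ENNReal.ofReal (f r ^ 2) / 2) ≤
      ENNReal.ofReal (μ * (a / (1 - a / b)) / (1 - τ) ^ 2)

theorem IsProfile.le_one {μ : ℝ} {v : ℝ → ℝ≥0∞} {a b τ : ℝ} {f g : ℝ → ℝ}
    (hf : IsProfile μ v a b τ f g) (r : ℝ) : f r ≤ 1 :=
  (hf.mono (le_max_left r b)).trans_eq (hf.eq_one _ (le_max_right r b))

namespace IsScatteringSolution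

variable {μ : ℝ} {v : ℝ → ℝ≥0∞} {r₀ : ℝ} {u u' : ℝ → ℝ}

/-- The limit `ℓ` of `u (r) / r` at the core. -/
theorem exists_core_value (h : IsScatteringSolution μ v r₀ u u') (hμ : 0 < μ) {b ε : ℝ}
    (hb : r₀ < b) (hε : 0 < ε) :
    ∃ ℓ p, 0 ≤ ℓ ∧ (0 < r₀ → ℓ = 0) ∧ (∀ r, r₀ < r → ℓ ≤ u r / r) ∧ r₀ < p ∧ p < b ∧
      u p / p - ℓ ≤ ε := by
  set S := (fun r => u r / r) '' Ioi r₀ with hS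
  have hpos : ∀ r, r₀ < r → 0 < u r / r := fun r hr =>
    div_pos (h.pos r hr) (h.core_nonneg.trans_lt hr)
  have hbdd : BddBelow S := ⟨0, by rintro _ ⟨r, hr, rfl⟩; exact (hpos r hr).le⟩
  have hne : S.Nonempty := ⟨_, b, hb, rfl⟩
  have hle : ∀ r, r₀ < r → sInf S ≤ u r / r := fun r hr => csInf_le hbdd ⟨r, hr, rfl⟩
  have h0 : 0 ≤ sInf S := le_csInf hne (by rintro _ ⟨r, hr, rfl⟩; exact (hpos r hr).le)
  obtain ⟨_, ⟨p, hp, rfl⟩, hp'⟩ := exists_lt_of_csInf_lt hne (lt_add_of_pos_right (sInf S) hε)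
  have hp : r₀ < p := hp
  refine ⟨sInf S, min p ((r₀ + b) / 2), h0, fun hr₀ => le_antisymm ?_ h0, hle,
    lt_min hp (by linarith), (min_le_right _ _).trans_lt (by linarith), ?_⟩
  · have h1 : Tendsto (fun r => u r / r) (𝓝[>] r₀) (𝓝 (0 / r₀)) :=
      h.tendsto_zero.div (tendsto_id.mono_left nhdsWithin_le_nhds) hr₀.ne'
    rw [zero_div] at h1
    exact ge_of_tendsto h1 (by filter_upwards [self_mem_nhdsWithin] with r hr using hle r hr)
  · have := h.div_mono hμ (lt_min hp (by linarith : r₀ < (r₀ + b) / 2)) (min_le_left _ _)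
    simp only at hp'
    linarith

/-- `u/r` need not be Lipschitz near the core, so it is frozen below `p`. Shifting by `F p - ℓ`
turns the frozen value into `ℓ`, which is below `u/r` and is 0 if there is a hard core; the
potential energy below `p` is then still controlled by that of `u/r`. As `F p - ℓ ≤ τ B`, the losses
are of order `τ`. -/
theorem exists_profile (h : IsScatteringSolution μ v r₀ u u') (hμ : 0 < μ) (hv : Measurable v)
    {a b τ : ℝ} (ha : Tendsto (fun r => r - u r / u' r) atTop (𝓝 a)) (hab : a < b)
    (hτ : 0 < τ) (hτ1 : τ < 1) : ∃ f g, IsProfile μ v a b τ f g := by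
  have ha0 := h.scatteringLength_nonneg ha hμ
  have hrb : r₀ < b := (h.core_le ha hμ).trans_lt hab
  have hb0 : 0 < b := ha0.trans_lt hab
  have hub := h.pos b hrb
  set B := u b / b with hB
  have hB0 : 0 < B := div_pos hub hb0
  obtain ⟨ℓ, p, hℓ, hℓ0, hℓle, hrp, hpb, hpℓ⟩ := h.exists_core_value hμ hrb (mul_pos hτ hB0)
  have hp0 : 0 < p := h.core_nonneg.trans_lt hrp
  -- Normalisation making `f` equal to 1 at `b`; it lies between `(1 - τ) B` and `B`.
  set c := B - (u p / p - ℓ) with hc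
  have hcB : B * (1 - τ) ≤ c := by linarith
  have hc0 : 0 < c := lt_of_lt_of_le (mul_pos hB0 (by linarith)) hcB
  have hx : 0 < 1 - a / b := by rw [sub_pos, div_lt_one hb0]; exact hab
  set F : ℝ → ℝ := fun r => u r / r with hF
  set cl : ℝ → ℝ := fun r => max p (min r b) with hcl
  set f : ℝ → ℝ := fun r => (F (cl r) - (F p - ℓ)) / c with hf
  set g : ℝ → ℝ := (Ioo p b).indicator fun r => (r * u' r - u r) / r ^ 2 / c with hg
  have hclp : ∀ r, p ≤ cl r := fun r => le_max_left _ _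
  have hclb : ∀ r, cl r ≤ b := fun r => max_le hpb.le (min_le_right _ _)
  have hFmono : ∀ {s t}, r₀ < s → s ≤ t → F s ≤ F t := fun hs hst => h.div_mono hμ hs hst
  have hclmono : Monotone cl := fun s t hst => max_le_max le_rfl (min_le_min hst le_rfl)
  have fmono : Monotone f := fun s t hst => by
    have := hFmono (hrp.trans_le (hclp s)) (hclmono hst)
    simp only [hf]
    gcongr
  have fnonneg : ∀ r, 0 ≤ f r := fun r => by
    have := hFmono hrp (hclp r)
    exact div_nonneg (by linarith) hc0.le
  have cl_lo : ∀ r, r ≤ p → cl r = p := fun r hr => max_eq_left ((min_le_left _ _).trans hr)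
  have cl_mid : ∀ r, p ≤ r → r ≤ b → cl r = r := fun r hr hr' => by
    simp only [hcl]; rw [min_eq_left hr', max_eq_right hr]
  have cl_hi : ∀ r, b ≤ r → cl r = b := fun r hr => by
    simp only [hcl]; rw [min_eq_right hr, max_eq_right hpb.le]
  have f_lo : ∀ r, r ≤ p → f r = ℓ / c := fun r hr => by
    simp only [hf, cl_lo r hr]; congr 1; ring
  have f_mid : ∀ r, p ≤ r → r ≤ b → f r = (F r - (F p - ℓ)) / c := fun r hr hr' => by
    simp only [hf, cl_mid r hr hr']
  have f_hi : ∀ r, b ≤ r → f r = 1 := fun r hr => by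
    simp only [hf, cl_hi r hr]; exact div_self hc0.ne'
  have f_le : ∀ r, r₀ < r → r ≤ b → c * f r ≤ F r := fun r hr hrb' => by
    rcases le_total r p with h1 | h1
    · rw [f_lo r h1, mul_div_cancel₀ _ hc0.ne']; exact hℓle r hr
    · rw [f_mid r h1 hrb', mul_div_cancel₀ _ hc0.ne']; have := hℓle p hrp; simp only [hF]; linarith
  have mpos : ∀ r ∈ Ioo p b, 0 ≤ r * u' r - u r := fun r hr => h.moment_nonneg hμ (hrp.trans hr.1)
  have g_mid : ∀ r ∈ Ioo p b, g r = (r * u' r - u r) / r ^ 2 / c := fun r hr =>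
    indicator_of_mem hr _
  have g_out : ∀ r, r ∉ Ioo p b → g r = 0 := fun r hr => indicator_of_notMem hr _
  refine ⟨f, g, ?_, fmono, fnonneg, f_hi, ?_, ⟨p, hp0, ?_⟩, ?_, ?_, ?_, ?_, ?_⟩
  · have hFl : LipschitzOnWith ((b * u' b - u b) / p ^ 2).toNNReal F (Icc p b) := by
      refine (convex_Icc p b).lipschitzOnWith_of_nnnorm_hasDerivWithin_le
        (fun r hr => (h.hasDerivAt_div (hrp.trans_le hr.1)).hasDerivWithinAt) fun r hr => ?_
      have h1 := h.moment_nonneg hμ (hrp.trans_le hr.1)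
      have h2 := h.moment_mono hμ (hrp.trans_le hr.1) hr.2
      have h3 : p ^ 2 ≤ r ^ 2 := pow_le_pow_left₀ hp0.le hr.1 2
      rw [← NNReal.coe_le_coe, coe_nnnorm, Real.norm_eq_abs, abs_of_nonneg (by positivity)]
      refine le_trans ?_ (Real.le_coe_toNNReal _)
      gcongr
      exact h1.trans h2
    have hcll : LipschitzWith 1 cl := ((LipschitzWith.id).min_const b).const_max p
    have h1 : LipschitzWith (((b * u' b - u b) / p ^ 2).toNNReal * 1) (F ∘ cl) := by
      rw [← lipschitzOnWith_univ]
      exact hFl.comp hcll.lipschitzOnWith fun r _ => ⟨hclp r, hclb r⟩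
    refine ⟨_, LipschitzWith.of_dist_le_mul
      (K := (1 / c).toNNReal * (((b * u' b - u b) / p ^ 2).toNNReal * 1)) fun s t => ?_⟩
    have h2 := h1.dist_le_mul s t
    rw [Real.dist_eq] at h2 ⊢
    have h3 : f s - f t = 1 / c * ((F ∘ cl) s - (F ∘ cl) t) := by
      simp only [hf, Function.comp]; ring
    rw [h3, abs_mul, abs_of_pos (by positivity), NNReal.coe_mul,
      Real.coe_toNNReal _ (by positivity : 0 ≤ 1 / c), mul_assoc]
    gcongr
  · have c1 : ContinuousOn (fun r => (r * u' r - u r) / r ^ 2 / c) (Ioo p b) := by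
      have cu' : ContinuousOn u' (Ioo p b) :=
        (h.continuousOn_deriv hμ hv).mono fun r hr => hrp.trans hr.1
      have cu : ContinuousOn u (Ioo p b) := h.continuousOn.mono fun r hr => hrp.trans hr.1
      exact (((continuousOn_id.mul cu').sub cu).div (continuousOn_id.pow 2)
        fun r hr => pow_ne_zero 2 (hp0.trans hr.1).ne').div_const c
    rw [hg, ← piecewise_eq_indicator]
    exact c1.measurable_piecewise continuousOn_const measurableSet_Ioo
  · intro r hrp' hrb'
    rcases lt_or_gt_of_ne hrp' with h1 | h1
    · rw [g_out r fun h2 => lt_asymm h1 h2.1]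
      refine (hasDerivAt_const r (ℓ / c)).congr_of_eventuallyEq ?_
      filter_upwards [Iio_mem_nhds h1] with s hs using f_lo s (le_of_lt hs)
    rcases lt_or_gt_of_ne hrb' with h2 | h2
    · rw [g_mid r ⟨h1, h2⟩]
      refine (((h.hasDerivAt_div (hrp.trans h1)).sub_const (F p - ℓ)).div_const c
        ).congr_of_eventuallyEq ?_
      filter_upwards [Ioo_mem_nhds h1 h2] with s hs using f_mid s hs.1.le hs.2.le
    · rw [g_out r fun h3 => lt_asymm h2 h3.2]
      refine (hasDerivAt_const r 1).congr_of_eventuallyEq ?_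
      filter_upwards [Ioi_mem_nhds h2] with s hs using f_hi s (le_of_lt hs)
  · exact fun r => indicator_nonneg (fun s hs => div_nonneg
      (div_nonneg (mpos s hs) (sq_nonneg s)) hc0.le) r
  · exact fun r hr => g_out r fun h1 => hr ⟨hp0.trans h1.1, h1.2⟩
  · intro r hr
    by_cases hr' : r ∈ Ioo p b
    · rw [g_mid r hr']
      have h1 := h.moment_le ha hμ (hrp.trans hr'.1) hab
      calc _ = (r * u' r - u r) / c := by field_simp
        _ ≤ a * (u b / (b - a)) / (B * (1 - τ)) := by
          have := sub_pos.2 hab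
          gcongr
        _ = _ := by
          have := sub_pos.2 hab
          have : 1 - τ ≠ 0 := by linarith
          have : 1 - a / b = (b - a) / b := by field_simp
          rw [this, hB]
          field_simp
    · rw [g_out r hr', zero_mul]
      exact div_nonneg (div_nonneg ha0 hx.le) (by linarith)
  · intro r har hrb' hr0
    have hr : r₀ < r := (h.core_le ha hμ).trans_lt har
    have hchord := h.chord_le ha hμ hr hrb'.le hab
    set y := (1 - a / r) / (1 - a / b) with hy
    have hy0 : 0 ≤ y := div_nonneg (by rw [sub_nonneg, div_le_one hr0]; exact har.le) hx.le
    have hyF : B * y ≤ F r := by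
      simp only [hF]
      rw [le_div_iff₀ hr0]
      refine le_trans (le_of_eq ?_) hchord
      have := sub_pos.2 hab
      have : 1 - a / b = (b - a) / b := by field_simp
      rw [hy, this, hB]
      field_simp
    have hy1 : y ≤ 1 := by
      rw [hy, div_le_one hx]
      gcongr
    have hcle : c ≤ B := by have := hℓle p hrp; linarith
    have hfr : B * f r ≥ B * (y - τ) := by
      have h1 : F r - τ * B ≤ c * f r := by
        rcases le_total r p with h1 | h1
        · rw [f_lo r h1, mul_div_cancel₀ _ hc0.ne']
          have := hFmono hr h1
          simp only [hF] at this ⊢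
          linarith
        · rw [f_mid r h1 hrb'.le, mul_div_cancel₀ _ hc0.ne']; simp only [hF]; linarith
      have h2 := mul_le_mul_of_nonneg_right hcle (fnonneg r)
      linarith
    have hfr := le_of_mul_le_mul_left hfr hB0
    have := fnonneg r
    -- If `y ≤ τ`, then `y² - 2τ` is not positive. Otherwise square `y - τ ≤ f r` and use `y ≤ 1`.
    rcases le_total y τ with h1 | h1
    · nlinarith
    · nlinarith [mul_self_le_mul_self (sub_nonneg.2 h1) hfr]
  · set E : ℝ → ℝ≥0∞ := fun r => ENNReal.ofReal (r ^ 2) *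
      (ENNReal.ofReal (μ * g r ^ 2) + v r * ENNReal.ofReal (f r ^ 2) / 2) with hE
    have hU : Ioi (0 : ℝ) ⊆ (Ioc 0 r₀ ∪ Ioo r₀ b) ∪ Ici b := by
      intro r hr
      have hr : 0 < r := hr
      by_cases h1 : r ≤ r₀
      · exact Or.inl (Or.inl ⟨hr, h1⟩)
      · by_cases h2 : r < b
        · exact Or.inl (Or.inr ⟨not_le.1 h1, h2⟩)
        · exact Or.inr (not_lt.1 h2)
    have h1 : ∫⁻ r in Ioc 0 r₀, E r = 0 := by
      rw [lintegral_eq_zero_of_ae_eq_zero]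
      filter_upwards [ae_restrict_mem measurableSet_Ioc] with r hr
      have hr0 : 0 < r₀ := hr.1.trans_le hr.2
      simp only [hE]
      rw [g_out r fun h2 => by linarith [h2.1, hr.2], f_lo r (hr.2.trans hrp.le), hℓ0 hr0]
      simp
    have h2 : ∫⁻ r in Ioo r₀ b, E r ≤ ENNReal.ofReal (1 / c ^ 2) *
        ENNReal.ofReal (μ * (u b / b * (b * u' b - u b))) := by
      refine le_trans ?_ (mul_le_mul_right (h.lintegral_energy_le hμ hv hrb) _)
      rw [← lintegral_const_mul' _ _ ENNReal.ofReal_ne_top]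
      refine setLIntegral_mono' measurableSet_Ioo fun r hr => ?_
      have hr0 : 0 < r := h.core_nonneg.trans_lt hr.1
      simp only [hE]
      rw [mul_add, mul_add]
      gcongr ?_ + ?_
      · rw [← ENNReal.ofReal_mul (by positivity), ← ENNReal.ofReal_mul (by positivity)]
        refine ENNReal.ofReal_le_ofReal ?_
        by_cases hr' : r ∈ Ioo p b
        · rw [g_mid r hr']
          refine le_of_eq ?_
          field_simp
        · rw [g_out r hr']
          have : 0 ≤ μ * (u' r - u r / r) ^ 2 := by positivity
          simp only [ne_eq, OfNat.ofNat_ne_zero, not_false_eq_true, zero_pow, mul_zero]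
          positivity
      · have h3 : r ^ 2 * f r ^ 2 ≤ 1 / c ^ 2 * u r ^ 2 := by
          have h4 := f_le r hr.1 hr.2.le
          simp only [hF] at h4
          rw [le_div_iff₀ hr0] at h4
          rw [one_div, le_inv_mul_iff₀ (by positivity)]
          have := pow_le_pow_left₀ (mul_nonneg (mul_nonneg hc0.le (fnonneg r)) hr0.le) h4 2
          linarith
        calc _ = v r * ENNReal.ofReal (r ^ 2 * f r ^ 2) / 2 := by
              rw [ENNReal.ofReal_mul (by positivity), div_eq_mul_inv, div_eq_mul_inv]; ring
          _ ≤ v r * ENNReal.ofReal (1 / c ^ 2 * u r ^ 2) / 2 := by gcongr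
          _ = _ := by
              rw [ENNReal.ofReal_mul (by positivity)]
              generalize ENNReal.ofReal (1 / c ^ 2) = K
              simp only [div_eq_mul_inv]
              ring
    have h3 : ∫⁻ r in Ici b, E r ≤ ENNReal.ofReal (1 / c ^ 2) *
        ENNReal.ofReal (μ * (u b / b * (a * (u b / (b - a)) - (b * u' b - u b)))) := by
      refine le_trans ?_ (mul_le_mul_right (h.lintegral_tail_le hμ hv ha hab) _)
      rw [← lintegral_const_mul' _ _ ENNReal.ofReal_ne_top, setLIntegral_congr Ioi_ae_eq_Ici.symm]
      refine setLIntegral_mono' measurableSet_Ioi fun r hr => ?_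
      have hr : b < r := hr
      have hcle : c ≤ B := by have := hℓle p hrp; linarith
      simp only [hE]
      rw [g_out r fun h2 => lt_asymm hr h2.2, f_hi r hr.le]
      have h3 : r ^ 2 ≤ 1 / c ^ 2 * (B ^ 2 * r ^ 2) := by
        rw [one_div, le_inv_mul_iff₀ (by positivity)]
        gcongr
      calc _ = v r * ENNReal.ofReal (r ^ 2) / 2 := by
            simp only [ne_eq, OfNat.ofNat_ne_zero, not_false_eq_true, zero_pow, mul_zero,
              ENNReal.ofReal_zero, zero_add, one_pow, ENNReal.ofReal_one, mul_one]
            rw [div_eq_mul_inv, div_eq_mul_inv]; ring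
        _ ≤ v r * ENNReal.ofReal (1 / c ^ 2 * (B ^ 2 * r ^ 2)) / 2 := by gcongr
        _ = ENNReal.ofReal (1 / c ^ 2) * (v r * ENNReal.ofReal (B ^ 2 * r ^ 2) / 2) := by
            rw [ENNReal.ofReal_mul (by positivity)]
            generalize ENNReal.ofReal (1 / c ^ 2) = K
            simp only [div_eq_mul_inv]
            ring
    have hm := h.moment_nonneg hμ hrb
    have hm' := h.moment_le ha hμ hrb hab
    calc ∫⁻ r in Ioi 0, E r ≤ ∫⁻ r in (Ioc 0 r₀ ∪ Ioo r₀ b) ∪ Ici b, E r := lintegral_mono_set hU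
      _ ≤ (∫⁻ r in Ioc 0 r₀, E r) + (∫⁻ r in Ioo r₀ b, E r) + ∫⁻ r in Ici b, E r :=
          (lintegral_union_le _ _ _).trans (add_le_add (lintegral_union_le _ _ _) le_rfl)
      _ ≤ ENNReal.ofReal (1 / c ^ 2) * ENNReal.ofReal (μ * (u b / b * (b * u' b - u b))) +
          ENNReal.ofReal (1 / c ^ 2) *
          ENNReal.ofReal (μ * (u b / b * (a * (u b / (b - a)) - (b * u' b - u b)))) := by
          rw [h1, zero_add]; exact add_le_add h2 h3
      -- The boundary terms at `b` cancel, and `u b / (b - a) = B / (1 - a/b)`.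
      _ = ENNReal.ofReal (μ * (a / (1 - a / b)) * (B ^ 2 / c ^ 2)) := by
          rw [← mul_add, ← ENNReal.ofReal_add (by positivity)
            (by have := sub_nonneg.2 hm'; positivity), ← ENNReal.ofReal_mul (by positivity)]
          congr 1
          have := sub_pos.2 hab
          have : 1 - a / b = (b - a) / b := by field_simp
          rw [this, hB]
          field_simp
          ring
      _ ≤ _ := by
          refine ENNReal.ofReal_le_ofReal ?_
          rw [div_eq_mul_one_div (μ * _)]
          have h4 : B ^ 2 / c ^ 2 ≤ 1 / (1 - τ) ^ 2 := by
            have : 0 < 1 - τ := by linarith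
            rw [div_le_div_iff₀ (by positivity) (by positivity), one_mul, ← mul_pow]
            gcongr
          gcongr

end IsScatteringSolution

/-! ### Radial functions on `ℝ³` -/

theorem lintegral_fun_norm {F : ℝ → ℝ≥0∞} (hF : Measurable F) :
    ∫⁻ z : Space, F ‖z‖ =
      ENNReal.ofReal (4 * Real.pi) * ∫⁻ r in Ioi 0, ENNReal.ofReal (r ^ 2) * F r := by
  have hdim : Module.finrank ℝ Space = 3 := by simp
  calc ∫⁻ z : Space, F ‖z‖ = ∫⁻ z in ({0}ᶜ : Set Space), F ‖z‖ := by rw [restrict_compl_singleton]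
    _ = ∫⁻ z : ({(0)}ᶜ : Set Space), F ‖z.1‖ ∂(volume.comap Subtype.val) := by
      rw [lintegral_subtype_comap (measurableSet_singleton _).compl fun z => F ‖z‖]
    _ = ∫⁻ x : Metric.sphere (0 : Space) 1 × Ioi (0 : ℝ), F x.2 ∂(volume : Measure Space).toSphere.prod (.volumeIoiPow 2) := by
      have := (volume : Measure Space).measurePreserving_homeomorphUnitSphereProd.lintegral_comp_emb
        (Homeomorph.measurableEmbedding _) (F ∘ Subtype.val ∘ Prod.snd)
      rw [hdim] at this
      simpa using this
    _ = (volume : Measure Space).toSphere univ * ∫⁻ x : Ioi (0 : ℝ), F x ∂.volumeIoiPow 2 := by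
      rw [lintegral_prod _ (by fun_prop)]
      simp [mul_comm]
    _ = _ := by
      congr 1
      · rw [Measure.toSphere_apply_univ, hdim, EuclideanSpace.volume_ball_fin_three]
        simp only [ENNReal.ofReal_one, one_pow, one_mul]
        rw [show ((3 : ℕ) : ℝ≥0∞) = ENNReal.ofReal 3 by simp, ← ENNReal.ofReal_mul (by norm_num)]
        congr 1
        ring
      · rw [Measure.volumeIoiPow, lintegral_withDensity_eq_lintegral_mul _ (by fun_prop)
          (by fun_prop)]
        exact lintegral_subtype_comap measurableSet_Ioi fun r => ENNReal.ofReal (r ^ 2) * F r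

namespace IsProfile

variable {μ : ℝ} {v : ℝ → ℝ≥0∞} {a b τ : ℝ} {f g : ℝ → ℝ}

theorem continuous (hf : IsProfile μ v a b τ f g) : Continuous f :=
  let ⟨_, hC⟩ := hf.lipschitz
  hC.continuous

/-- The chain rule fails at most at the origin and on two spheres, all null sets. -/
theorem enorm_fderiv_le (hf : IsProfile μ v a b τ f g) :
    ∀ᵐ z : Space, ‖fderiv ℝ (fun z : Space => f ‖z‖) z‖ₑ ≤ ENNReal.ofReal (g ‖z‖) := by
  obtain ⟨p, hp, hd⟩ := hf.hasDerivAt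
  have h0 : ∀ᵐ z : Space, z ≠ 0 := by simp [ae_iff]
  have hs : ∀ r : ℝ, ∀ᵐ z : Space, ‖z‖ ≠ r := fun r => by
    have := Measure.addHaar_sphere (volume : Measure Space) 0 r
    simpa [ae_iff, Metric.sphere] using this
  filter_upwards [h0, hs p, hs b] with z hz hzp hzb
  have h1 : HasFDerivAt (fun z : Space => ‖z‖) (fderiv ℝ (fun z : Space => ‖z‖) z) z :=
    ((contDiffAt_norm ℝ hz (n := 1)).differentiableAt (by norm_num)).hasFDerivAt
  have h2 := (hd ‖z‖ hzp hzb).comp_hasFDerivAt z h1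
  rw [show (fun z : Space => f ‖z‖) = f ∘ fun z => ‖z‖ from rfl, h2.fderiv,
    ← ofReal_norm, norm_smul, Real.norm_eq_abs, abs_of_nonneg (hf.deriv_nonneg _)]
  refine ENNReal.ofReal_le_ofReal (mul_le_of_le_one_right (hf.deriv_nonneg _) ?_)
  simpa using norm_fderiv_le_of_lipschitz ℝ (x₀ := z) (lipschitzWith_one_norm (E := Space))

theorem lintegral_energy_le (hf : IsProfile μ v a b τ f g) (hμ : 0 < μ) (hv : Measurable v) :
    ∫⁻ z : Space, (ENNReal.ofReal μ * ‖fderiv ℝ (fun z : Space => f ‖z‖) z‖ₑ ^ 2 +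
      v ‖z‖ * ENNReal.ofReal (f ‖z‖ ^ 2) / 2) ≤
      ENNReal.ofReal (4 * Real.pi * μ * (a / (1 - a / b)) / (1 - τ) ^ 2) := by
  have hfm := hf.continuous.measurable
  have hgm := hf.measurable
  calc _ ≤ ∫⁻ z : Space, (fun r => ENNReal.ofReal (μ * g r ^ 2) +
        v r * ENNReal.ofReal (f r ^ 2) / 2) ‖z‖ := by
        refine lintegral_mono_ae ?_
        filter_upwards [hf.enorm_fderiv_le] with z hz
        rw [ENNReal.ofReal_mul hμ.le, ENNReal.ofReal_pow (hf.deriv_nonneg _)]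
        gcongr
    _ ≤ _ := by
        rw [lintegral_fun_norm (F := fun r => ENNReal.ofReal (μ * g r ^ 2) +
          v r * ENNReal.ofReal (f r ^ 2) / 2) (by fun_prop), mul_assoc (4 * Real.pi), mul_div_assoc,
          ENNReal.ofReal_mul (p := 4 * Real.pi) (by positivity)]
        exact mul_le_mul_right hf.energy_le _

/-- The factor `f ≤ 1` is given away. In polar coordinates `r² g` is bounded by a constant and lives
on `(0, b)`, whence the factor `b`. -/
theorem lintegral_mul_deriv_le (hf : IsProfile μ v a b τ f g) (ha : 0 ≤ a) (hab : a < b)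
    (hτ : τ < 1) :
    ∫⁻ z : Space, ENNReal.ofReal (f ‖z‖) * ‖fderiv ℝ (fun z : Space => f ‖z‖) z‖ₑ ≤
      ENNReal.ofReal (4 * Real.pi * (a / (1 - a / b)) * b / (1 - τ)) := by
  have hfm := hf.continuous.measurable
  have hgm := hf.measurable
  have hb : 0 < b := ha.trans_lt hab
  have hx : 0 < 1 - a / b := by rw [sub_pos, div_lt_one hb]; exact hab
  have hτ' : 0 < 1 - τ := by linarith
  calc _ ≤ ∫⁻ z : Space, (fun r => ENNReal.ofReal (g r)) ‖z‖ := by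
        refine lintegral_mono_ae ?_
        filter_upwards [hf.enorm_fderiv_le] with z hz
        calc _ ≤ 1 * ENNReal.ofReal (g ‖z‖) := by
              gcongr
              exact ENNReal.ofReal_le_one.2 (hf.le_one _)
          _ = _ := one_mul _
    _ = ENNReal.ofReal (4 * Real.pi) * ∫⁻ r in Ioi 0, ENNReal.ofReal (r ^ 2) *
          ENNReal.ofReal (g r) :=
        lintegral_fun_norm (F := fun r => ENNReal.ofReal (g r)) hgm.ennreal_ofReal
    _ ≤ ENNReal.ofReal (4 * Real.pi) * (ENNReal.ofReal (a / (1 - a / b) / (1 - τ)) *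
          ENNReal.ofReal b) := by
        gcongr
        calc _ ≤ ∫⁻ r in Ioi (0 : ℝ), (Ioo 0 b).indicator
              (fun _ => ENNReal.ofReal (a / (1 - a / b) / (1 - τ))) r := by
              refine setLIntegral_mono' measurableSet_Ioi fun r hr => ?_
              have hr : 0 < r := hr
              by_cases hrb : r ∈ Ioo 0 b
              · rw [indicator_of_mem hrb, ← ENNReal.ofReal_mul (by positivity)]
                refine ENNReal.ofReal_le_ofReal ?_
                rw [mul_comm]
                exact hf.deriv_le r hr
              · rw [hf.deriv_eq_zero r hrb]; simp
          _ ≤ ∫⁻ r : ℝ, (Ioo 0 b).indicator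
              (fun _ => ENNReal.ofReal (a / (1 - a / b) / (1 - τ))) r := setLIntegral_le_lintegral _ _
          _ = _ := by rw [lintegral_indicator_const measurableSet_Ioo]; simp
    _ = _ := by
        rw [← ENNReal.ofReal_mul (by positivity), ← ENNReal.ofReal_mul (by positivity)]
        congr 1
        ring

/-- Below `a` only `f² ≥ 0` is used; between `a` and `b` the chord bound removes `(r - a)²/(1 -
a/b)²`, whose integral is `(b³/3)(1 - a/b)`. What remains of `b³/3` is the fraction `a/b`, the
source of the denominators `1 - a/b` from the normalisation. -/
theorem lintegral_one_sub_sq_le (hf : IsProfile μ v a b τ f g) (ha : 0 ≤ a) (hab : a < b)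
    (hτ : 0 < τ) :
    ∫⁻ z : Space, ENNReal.ofReal (1 - f ‖z‖ ^ 2) ≤
      ENNReal.ofReal (4 * Real.pi / 3 * b ^ 3 * (a / b + 2 * τ)) := by
  have hfm := hf.continuous.measurable
  have hb : 0 < b := ha.trans_lt hab
  have hx : 0 < 1 - a / b := by rw [sub_pos, div_lt_one hb]; exact hab
  have hU : Ioi (0 : ℝ) ⊆ (Ioo 0 a ∪ Icc a b) ∪ Ioi b := by
    intro r hr
    have hr : 0 < r := hr
    by_cases h1 : r < a
    · exact Or.inl (Or.inl ⟨hr, h1⟩)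
    · by_cases h2 : r ≤ b
      · exact Or.inl (Or.inr ⟨not_lt.1 h1, h2⟩)
      · exact Or.inr (not_le.1 h2)
  set E : ℝ → ℝ≥0∞ := fun r => ENNReal.ofReal (r ^ 2) * ENNReal.ofReal (1 - f r ^ 2) with hE
  -- The factor `1 + 2 τ` is not needed here; it makes the two pieces add up to a single integral of
  -- `r²`.
  have h1 : ∫⁻ r in Ioo 0 a, E r ≤ ENNReal.ofReal (a ^ 3 / 3 * (1 + 2 * τ)) := by
    calc _ ≤ ∫⁻ r in Ioo 0 a, ENNReal.ofReal (r ^ 2 * (1 + 2 * τ)) := by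
          refine setLIntegral_mono' measurableSet_Ioo fun r hr => ?_
          simp only [hE]
          rw [← ENNReal.ofReal_mul (by positivity)]
          refine ENNReal.ofReal_le_ofReal ?_
          gcongr
          have := sq_nonneg (f r)
          linarith
      _ = _ := by
          rw [← ofReal_integral_eq_lintegral_ofReal]
          · rw [← integral_Ioc_eq_integral_Ioo, ← intervalIntegral.integral_of_le ha,
              intervalIntegral.integral_mul_const, integral_pow]
            congr 1
            norm_num
          · exact (Continuous.integrableOn_Icc (by fun_prop)).mono_set Ioo_subset_Icc_self
          · exact ae_of_all _ fun r => by positivity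
  have h2 : ∫⁻ r in Icc a b, E r ≤ ENNReal.ofReal ((b ^ 3 - a ^ 3) / 3 * (1 + 2 * τ) -
      (b - a) ^ 3 / 3 / (1 - a / b) ^ 2) := by
    calc _ ≤ ∫⁻ r in Ioo a b, ENNReal.ofReal
            (r ^ 2 * (1 + 2 * τ) - (r - a) ^ 2 / (1 - a / b) ^ 2) := by
          rw [setLIntegral_congr Ioo_ae_eq_Icc.symm]
          refine setLIntegral_mono' measurableSet_Ioo fun r hr => ?_
          have hr0 : 0 < r := ha.trans_lt hr.1
          simp only [hE]
          rw [← ENNReal.ofReal_mul (by positivity)]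
          refine ENNReal.ofReal_le_ofReal ?_
          have h1 := mul_le_mul_of_nonneg_left (hf.le_sq r hr.1 hr.2 hr0) (sq_nonneg r)
          have h2 : r ^ 2 * (((1 - a / r) / (1 - a / b)) ^ 2 - 2 * τ) =
              (r - a) ^ 2 / (1 - a / b) ^ 2 - r ^ 2 * (2 * τ) := by
            rw [div_pow, mul_sub]
            congr 1
            have : 1 - a / r = (r - a) / r := by field_simp
            rw [this]
            field_simp
          linarith
      _ = _ := by
          rw [← ofReal_integral_eq_lintegral_ofReal]
          · rw [← integral_Ioc_eq_integral_Ioo, ← intervalIntegral.integral_of_le hab.le,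
              intervalIntegral.integral_sub (Continuous.intervalIntegrable (by fun_prop) _ _)
                (Continuous.intervalIntegrable (by fun_prop) _ _),
              intervalIntegral.integral_mul_const, integral_pow, intervalIntegral.integral_div,
              intervalIntegral.integral_comp_sub_right (fun r => r ^ 2), integral_pow]
            congr 1
            norm_num
          · exact (Continuous.integrableOn_Icc (by fun_prop)).mono_set Ioo_subset_Icc_self
          · filter_upwards [ae_restrict_mem measurableSet_Ioo] with r hr
            have hr0 : 0 < r := ha.trans_lt hr.1
            have h1 : r - a ≤ r * (1 - a / b) := by
              have h3 : a * (r / b) ≤ a * 1 :=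
                mul_le_mul_of_nonneg_left ((div_le_one hb).2 hr.2.le) ha
              have h4 : r * (1 - a / b) = r - a * (r / b) := by ring
              linarith
            have h2 : (r - a) ^ 2 / (1 - a / b) ^ 2 ≤ r ^ 2 := by
              rw [div_le_iff₀ (by positivity), ← mul_pow]
              exact pow_le_pow_left₀ (by linarith [hr.1]) h1 2
            have h3 : 0 ≤ r ^ 2 * (2 * τ) := by positivity
            simp only [Pi.zero_apply]
            linarith
  have h3 : ∫⁻ r in Ioi b, E r = 0 := by
    rw [lintegral_eq_zero_of_ae_eq_zero]
    filter_upwards [ae_restrict_mem measurableSet_Ioi] with r hr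
    simp only [hE, hf.eq_one r (le_of_lt hr)]
    simp
  have h4 : (b - a) ^ 3 / 3 / (1 - a / b) ^ 2 = b ^ 3 / 3 * (1 - a / b) := by
    have := sub_pos.2 hab
    have : 1 - a / b = (b - a) / b := by field_simp
    rw [this]
    field_simp
  calc _ = ENNReal.ofReal (4 * Real.pi) * ∫⁻ r in Ioi 0, E r :=
        lintegral_fun_norm (F := fun r => ENNReal.ofReal (1 - f r ^ 2)) (by fun_prop)
    _ ≤ ENNReal.ofReal (4 * Real.pi) * (ENNReal.ofReal (a ^ 3 / 3 * (1 + 2 * τ)) +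
          ENNReal.ofReal ((b ^ 3 - a ^ 3) / 3 * (1 + 2 * τ) -
            (b - a) ^ 3 / 3 / (1 - a / b) ^ 2)) := by
        gcongr
        calc ∫⁻ r in Ioi 0, E r ≤ ∫⁻ r in (Ioo 0 a ∪ Icc a b) ∪ Ioi b, E r := lintegral_mono_set hU
          _ ≤ (∫⁻ r in Ioo 0 a, E r) + (∫⁻ r in Icc a b, E r) + ∫⁻ r in Ioi b, E r :=
              (lintegral_union_le _ _ _).trans (add_le_add (lintegral_union_le _ _ _) le_rfl)
          _ ≤ _ := by rw [h3, add_zero]; exact add_le_add h1 h2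
    _ = _ := by
        rw [h4, ← ENNReal.ofReal_add (by positivity), ← ENNReal.ofReal_mul (by positivity)]
        · congr 1; ring
        · have h5 : b ^ 3 * (1 - a / b) ≤ b ^ 3 - a ^ 3 := by
            have h6 : b ^ 3 * (1 - a / b) = b ^ 2 * (b - a) := by field_simp
            rw [h6]
            nlinarith [mul_nonneg (sub_nonneg.2 hab.le) (by positivity : 0 ≤ a * b + a ^ 2)]
          have h7 : 0 ≤ b ^ 3 - a ^ 3 := sub_nonneg.2 (pow_le_pow_left₀ ha hab.le 3)
          have := mul_nonneg h7 hτ.le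
          nlinarith

end IsProfile

/-! ### Products over particles and pairs -/

/-- The Jastrow product `∏ g (x_i) ∏_{i < j} h (x_i, x_j)` over the particles in `S`. -/
def jastrow {X M : Type*} [CommMonoid M] {N : ℕ} (g : X → M) (h : X → X → M)
    (S : Finset (Fin N)) (x : Fin N → X) : M :=
  (∏ i ∈ S, g (x i)) * ∏ i ∈ S, ∏ j ∈ S, if i < j then h (x i) (x j) else 1

section Jastrow

variable {X M M' : Type*} [CommMonoid M] [CommMonoid M'] {N : ℕ} {g : X → M} {h : X → X → M}

/-- Symmetry of `h` makes the index order irrelevant, so the factors of one particle split off. All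
estimates that integrate out a particle rest on this. -/
theorem jastrow_insert (hsymm : ∀ x y, h x y = h y x) {S : Finset (Fin N)} {i : Fin N}
    (hi : i ∉ S) (x : Fin N → X) :
    jastrow g h (insert i S) x = jastrow g h S x * (g (x i) * ∏ j ∈ S, h (x i) (x j)) := by
  have h1 : (∏ k ∈ insert i S, ∏ j ∈ insert i S, if k < j then h (x k) (x j) else 1) =
      (∏ j ∈ S, h (x i) (x j)) * ∏ k ∈ S, ∏ j ∈ S, if k < j then h (x k) (x j) else 1 := by
    simp only [Finset.prod_insert hi, lt_irrefl, if_false, one_mul]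
    rw [Finset.prod_mul_distrib, ← mul_assoc, ← Finset.prod_mul_distrib]
    congr 1
    refine Finset.prod_congr rfl fun j hj => ?_
    rcases lt_trichotomy i j with hij | rfl | hij
    · rw [if_pos hij, if_neg hij.not_gt, mul_one]
    · exact absurd hj hi
    · rw [if_neg hij.not_gt, if_pos hij, one_mul, hsymm]
  rw [jastrow, jastrow, h1, Finset.prod_insert hi]
  ac_rfl

theorem jastrow_univ (hsymm : ∀ x y, h x y = h y x) (i : Fin N) (x : Fin N → X) :
    jastrow g h Finset.univ x = jastrow g h (Finset.univ.erase i) x *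
      (g (x i) * ∏ j ∈ Finset.univ.erase i, h (x i) (x j)) := by
  rw [← jastrow_insert hsymm (Finset.notMem_erase i _), Finset.insert_erase (Finset.mem_univ i)]

theorem jastrow_update {S : Finset (Fin N)} {i : Fin N} (hi : i ∉ S) (x : Fin N → X) (y : X) :
    jastrow g h S (Function.update x i y) = jastrow g h S x := by
  have h1 : ∀ j ∈ S, Function.update x i y j = x j := fun j hj =>
    Function.update_of_ne (ne_of_mem_of_not_mem hj hi) _ _
  unfold jastrow
  congr 1
  · exact Finset.prod_congr rfl fun j hj => by rw [h1 j hj]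
  · exact Finset.prod_congr rfl fun j hj => Finset.prod_congr rfl fun k hk => by
      rw [h1 j hj, h1 k hk]

theorem map_jastrow (φ : M →* M') (S : Finset (Fin N)) (x : Fin N → X) :
    φ (jastrow g h S x) = jastrow (fun y => φ (g y)) (fun y z => φ (h y z)) S x := by
  simp only [jastrow, map_mul, map_prod, apply_ite φ, map_one]

/-- The square is a product over ordered pairs, which is visibly permutation invariant; for
nonnegative factors the invariance passes to the root. -/
theorem jastrow_sq (hsymm : ∀ x y, h x y = h y x) (x : Fin N → X) :
    jastrow g h Finset.univ x ^ 2 =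
      (∏ i, g (x i)) ^ 2 * ∏ i, ∏ j, if i ≠ j then h (x i) (x j) else 1 := by
  rw [jastrow, mul_pow]
  congr 1
  rw [sq]
  nth_rw 2 [Finset.prod_comm]
  simp only [← Finset.prod_mul_distrib]
  refine Finset.prod_congr rfl fun i _ => Finset.prod_congr rfl fun j _ => ?_
  rcases lt_trichotomy i j with hij | rfl | hij
  · rw [if_pos hij, if_neg hij.not_gt, if_pos hij.ne, mul_one]
  · simp
  · rw [if_neg hij.not_gt, if_pos hij, if_pos hij.ne', one_mul, hsymm]

end Jastrow

theorem jastrow_nonneg {X : Type*} {N : ℕ} {g : X → ℝ} {h : X → X → ℝ} (hg : ∀ x, 0 ≤ g x)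
    (hh : ∀ x y, 0 ≤ h x y) (S : Finset (Fin N)) (x : Fin N → X) : 0 ≤ jastrow g h S x :=
  mul_nonneg (Finset.prod_nonneg fun _ _ => hg _) (Finset.prod_nonneg fun _ _ =>
    Finset.prod_nonneg fun _ _ => by split_ifs <;> simp [hh])

theorem jastrow_comp_perm {X : Type*} {N : ℕ} {g : X → ℝ} {h : X → X → ℝ} (hg : ∀ x, 0 ≤ g x)
    (hh : ∀ x y, 0 ≤ h x y) (hsymm : ∀ x y, h x y = h y x) (σ : Equiv.Perm (Fin N))
    (x : Fin N → X) :
    jastrow g h Finset.univ (x ∘ σ) = jastrow g h Finset.univ x := by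
  rw [← sq_eq_sq₀ (jastrow_nonneg hg hh _ _) (jastrow_nonneg hg hh _ _), jastrow_sq hsymm,
    jastrow_sq hsymm]
  simp only [Function.comp]
  congr 1
  · rw [Equiv.prod_comp σ fun i => g (x i)]
  · rw [← Equiv.prod_comp σ fun i => ∏ j, if i ≠ j then h (x i) (x j) else 1]
    refine Finset.prod_congr rfl fun i _ => ?_
    rw [← Equiv.prod_comp σ fun j => if σ i ≠ j then h (x (σ i)) (x j) else 1]
    simp

/-! ### Integrals of Jastrow products -/

section Integrals

variable {X : Type*} [MeasurableSpace X] {ν : Measure X} {N : ℕ}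

/-- Once coordinate `i` has been resampled, the integrand no longer depends on its old value, and
integrating over that value only gives the total mass. -/
theorem lintegral_lintegral_update [IsFiniteMeasure ν] {f : (Fin N → X) → ℝ≥0∞} (hf : Measurable f) (i : Fin N) :
    ∫⁻ x, ∫⁻ y, f (Function.update x i y) ∂ν ∂Measure.pi (fun _ => ν) =
      ν univ * ∫⁻ x, f x ∂Measure.pi (fun _ => ν) := by
  classical
  by_cases hX : Nonempty X
  swap
  · have : IsEmpty (Fin N → X) := ⟨fun x => hX ⟨x i⟩⟩
    simp
  obtain ⟨y₀⟩ := hX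
  have x₀ : Fin N → X := fun _ => y₀
  set M : (Fin N → X) → ℝ≥0∞ := fun x => ∫⁻ y, f (Function.update x i y) ∂ν with hM
  have hM' : M = lmarginal (fun _ : Fin N => ν) {i} f := by
    ext x; rw [lmarginal_singleton]
  have hMm : Measurable M := by rw [hM']; exact hf.lmarginal _
  rw [lintegral_eq_lmarginal_univ x₀, lintegral_eq_lmarginal_univ x₀,
    lmarginal_erase' _ hMm (Finset.mem_univ i), lmarginal_erase' _ hf (Finset.mem_univ i)]
  have h1 : (fun x => ∫⁻ y, M (Function.update x i y) ∂ν) = fun x => ν univ * M x := by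
    ext x
    have : ∀ y, M (Function.update x i y) = M x := fun y => by simp [hM]
    simp [this, mul_comm]
  rw [h1]
  simp only [lmarginal]
  rw [lintegral_const_mul]
  exact hMm.comp measurable_updateFinset

variable {G : X → ℝ≥0∞} {H : X → X → ℝ≥0∞} (hG : Measurable G)
  (hH : Measurable (Function.uncurry H))

include hG hH in
theorem measurable_jastrow (S : Finset (Fin N)) : Measurable (jastrow G H S) := by
  refine (Finset.measurable_prod _ fun i _ => hG.comp (measurable_pi_apply i)).mul
    (Finset.measurable_prod _ fun i _ => Finset.measurable_prod _ fun j _ => ?_)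
  split_ifs
  · exact hH.comp (f := fun x : Fin N → X => (x i, x j))
      ((measurable_pi_apply i).prodMk (measurable_pi_apply j))
  · exact measurable_const

include hG hH in
/-- Integrating out a particle that only enters through `φ`. -/
theorem lintegral_jastrow_mul_le [IsFiniteMeasure ν] {S : Finset (Fin N)} {i : Fin N} (hi : i ∉ S)
    {φ F : (Fin N → X) → ℝ≥0∞} (hφ : Measurable φ) (hF : Measurable F)
    (hF' : ∀ x y, F (Function.update x i y) = F x) {D : ℝ≥0∞}
    (hD : ∀ x, ∫⁻ y, φ (Function.update x i y) ∂ν ≤ D) :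
    ν univ * ∫⁻ x, jastrow G H S x * F x * φ x ∂Measure.pi (fun _ => ν) ≤
      D * ∫⁻ x, jastrow G H S x * F x ∂Measure.pi (fun _ => ν) := by
  have hw := measurable_jastrow (N := N) hG hH S
  rw [← lintegral_lintegral_update (f := fun x => jastrow G H S x * F x * φ x)
    ((hw.mul hF).mul hφ) i,
    ← lintegral_const_mul (f := fun x => jastrow G H S x * F x) _ (hw.mul hF)]
  refine lintegral_mono fun x => ?_
  simp only [jastrow_update hi, hF']
  rw [lintegral_const_mul (f := fun y => φ (Function.update x i y)) _
    (hφ.comp (measurable_update x)), mul_comm D]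
  gcongr
  exact hD x

include hG hH in
-- `A` bounds from below the weight available to particle `i`, uniformly in the positions of the
-- others.
theorem mul_lintegral_jastrow_le [IsFiniteMeasure ν] (hsymm : ∀ x y, H x y = H y x) {S : Finset (Fin N)} {i : Fin N}
    (hi : i ∉ S) {A : ℝ≥0∞}
    (hA : ∀ x : Fin N → X, A ≤ ∫⁻ y, G y * ∏ j ∈ S, H y (x j) ∂ν) :
    A * ∫⁻ x, jastrow G H S x ∂Measure.pi (fun _ => ν) ≤
      ν univ * ∫⁻ x, jastrow G H (insert i S) x ∂Measure.pi (fun _ => ν) := by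
  have hw := measurable_jastrow (N := N) hG hH S
  rw [← lintegral_lintegral_update (measurable_jastrow hG hH _) i, ← lintegral_const_mul _ hw]
  refine lintegral_mono fun x => ?_
  have h1 : ∀ y, jastrow G H (insert i S) (Function.update x i y) =
      jastrow G H S x * (G y * ∏ j ∈ S, H y (x j)) := fun y => by
    rw [jastrow_insert hsymm hi, jastrow_update hi, Function.update_self]
    congr 2
    refine Finset.prod_congr rfl fun j hj => ?_
    rw [Function.update_of_ne (ne_of_mem_of_not_mem hj hi)]
  simp only [h1]
  rw [lintegral_const_mul, mul_comm A]
  · gcongr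
    exact hA x
  · exact hG.mul (Finset.measurable_prod _ fun j _ => hH.comp (measurable_id.prodMk measurable_const))

/-- The union bound `1 - ∏ c ≤ ∑ (1 - c)`, written additively because subtraction is truncated. It
yields the lower bound on the weight left to one particle. -/
theorem one_le_prod_add_sum {ι : Type*} (S : Finset ι) (c : ι → ℝ≥0∞) (hc : ∀ i ∈ S, c i ≤ 1) :
    1 ≤ ∏ i ∈ S, c i + ∑ i ∈ S, (1 - c i) := by
  classical
  induction S using Finset.induction_on with
  | empty => simp
  | insert i S hi ih =>
    have h1 := ih fun j hj => hc j (Finset.mem_insert_of_mem hj)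
    have h2 := hc i (Finset.mem_insert_self i S)
    rw [Finset.prod_insert hi, Finset.sum_insert hi]
    calc (1 : ℝ≥0∞) = c i * 1 + (1 - c i) := by rw [mul_one, add_tsub_cancel_of_le h2]
      _ ≤ c i * (∏ i ∈ S, c i + ∑ i ∈ S, (1 - c i)) + (1 - c i) := by gcongr
      _ ≤ c i * ∏ i ∈ S, c i + 1 * ∑ i ∈ S, (1 - c i) + (1 - c i) := by rw [mul_add]; gcongr
      _ = _ := by rw [one_mul]; ring

include hH in
theorem sub_le_lintegral_mul_prod (hG1 : ∀ y, G y ≤ 1) (hH1 : ∀ y z, H y z ≤ 1) {I : ℝ≥0∞}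
    (hI : ∀ z, ∫⁻ y, (1 - H y z) ∂ν ≤ I) (S : Finset (Fin N)) (x : Fin N → X) :
    ∫⁻ y, G y ∂ν - S.card * I ≤ ∫⁻ y, G y * ∏ j ∈ S, H y (x j) ∂ν := by
  rw [tsub_le_iff_right]
  have hm : ∀ z, Measurable fun y => 1 - H y z := fun z =>
    measurable_const.sub (hH.comp (measurable_id.prodMk measurable_const))
  calc ∫⁻ y, G y ∂ν ≤ ∫⁻ y, (G y * ∏ j ∈ S, H y (x j) + ∑ j ∈ S, (1 - H y (x j))) ∂ν := by
        refine lintegral_mono fun y => ?_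
        calc G y = G y * 1 := (mul_one _).symm
          _ ≤ G y * (∏ j ∈ S, H y (x j) + ∑ j ∈ S, (1 - H y (x j))) := by
            gcongr
            exact one_le_prod_add_sum S _ fun j _ => hH1 _ _
          _ ≤ _ := by
            rw [mul_add]
            gcongr
            exact mul_le_of_le_one_left' (hG1 y)
    _ = ∫⁻ y, G y * ∏ j ∈ S, H y (x j) ∂ν + ∑ j ∈ S, ∫⁻ y, (1 - H y (x j)) ∂ν := by
        rw [lintegral_add_right _ (Finset.measurable_sum _ fun j _ => hm (x j)),
          lintegral_finsetSum _ fun j _ => hm (x j)]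
    _ ≤ _ := by
        gcongr
        exact (Finset.sum_le_card_nsmul _ _ _ fun j _ => hI (x j)).trans_eq (nsmul_eq_mul _ _)

end Integrals

/-! ### Ratios of integrals with particles removed. -/

section JastrowBounds

variable {X : Type*} {N : ℕ} {G : X → ℝ≥0∞} {H : X → X → ℝ≥0∞}

theorem jastrow_insert_le (hG1 : ∀ y, G y ≤ 1) (hH1 : ∀ y z, H y z ≤ 1)
    (hsymm : ∀ x y, H x y = H y x) (S : Finset (Fin N)) (i : Fin N) (x : Fin N → X) :
    jastrow G H S x ≤ jastrow G H (S.erase i) x := by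
  by_cases hi : i ∈ S
  · conv_lhs => rw [← Finset.insert_erase hi]
    rw [jastrow_insert hsymm (Finset.notMem_erase i S)]
    exact mul_le_of_le_one_right' (mul_le_one' (hG1 _) (Finset.prod_le_one' fun _ _ => hH1 _ _))
  · rw [Finset.erase_eq_of_notMem hi]

variable [MeasurableSpace X] {ν : Measure X} [IsFiniteMeasure ν] (hν : ν univ ≠ 0) (hG : Measurable G)
  (hH : Measurable (Function.uncurry H)) (hG1 : ∀ y, G y ≤ 1) (hH1 : ∀ y z, H y z ≤ 1)
  (hsymm : ∀ x y, H x y = H y x) {I A : ℝ≥0∞} (hI : ∀ z, ∫⁻ y, (1 - H y z) ∂ν ≤ I)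
  (hA : A ≤ ∫⁻ y, G y ∂ν - ((N - 1 : ℕ) : ℝ≥0∞) * I)
include hG hH hG1 hH1 hsymm hI hA

/-- At most `N - 1` other particles are present whatever `S` is, so one `A` serves for every
reinsertion. -/
theorem mul_lintegral_jastrow_erase_le {S : Finset (Fin N)} {i : Fin N} (hi : i ∈ S) :
    A * ∫⁻ x : Fin N → X, jastrow G H (S.erase i) x ∂Measure.pi (fun _ => ν) ≤
      ν univ * ∫⁻ x : Fin N → X, jastrow G H S x ∂Measure.pi (fun _ => ν) := by
  conv_rhs => rw [← Finset.insert_erase hi]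
  refine mul_lintegral_jastrow_le hG hH hsymm (Finset.notMem_erase i S) fun x => ?_
  refine le_trans (hA.trans (tsub_le_tsub_left ?_ _))
    (sub_le_lintegral_mul_prod hH hG1 hH1 hI _ x)
  gcongr
  rw [Finset.card_erase_of_mem hi]
  exact Nat.sub_le_sub_right ((Finset.card_le_univ S).trans_eq (Fintype.card_fin N)) 1

include hν

/-- The weight does not contain particle `i`, so integrating `φ` over it gives `D` per volume;
reinserting the particle costs volume over `A`, and the volume cancels. -/
theorem lintegral_jastrow_erase_mul_le (hA0 : A ≠ 0) (hA' : A ≠ ∞) (i : Fin N)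
    {φ : (Fin N → X) → ℝ≥0∞} (hφ : Measurable φ) {D : ℝ≥0∞}
    (hD : ∀ x, ∫⁻ y, φ (Function.update x i y) ∂ν ≤ D) :
    ∫⁻ x : Fin N → X, jastrow G H (Finset.univ.erase i) x * φ x ∂Measure.pi (fun _ => ν) ≤
      D / A * ∫⁻ x : Fin N → X, jastrow G H Finset.univ x ∂Measure.pi (fun _ => ν) := by
  have h1 := lintegral_jastrow_mul_le (ν := ν) hG hH (Finset.notMem_erase i Finset.univ) hφ
    (F := fun _ => 1) measurable_const (fun _ _ => rfl) hD
  simp only [mul_one] at h1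
  have h2 := mul_lintegral_jastrow_erase_le (ν := ν) hG hH hG1 hH1 hsymm hI hA (Finset.mem_univ i)
  set Z := ∫⁻ x : Fin N → X, jastrow G H Finset.univ x ∂Measure.pi (fun _ => ν)
  set Z' := ∫⁻ x : Fin N → X, jastrow G H (Finset.univ.erase i) x ∂Measure.pi (fun _ => ν)
  set Y := ∫⁻ x : Fin N → X, jastrow G H (Finset.univ.erase i) x * φ x ∂Measure.pi (fun _ => ν)
  rw [← ENNReal.mul_div_right_comm, ENNReal.le_div_iff_mul_le (Or.inl hA0) (Or.inl hA'),
    ← ENNReal.mul_le_mul_iff_right hν (measure_ne_top ν univ)]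
  calc ν univ * (Y * A) = A * (ν univ * Y) := by ring
    _ ≤ A * (D * Z') := by gcongr
    _ = D * (A * Z') := by ring
    _ ≤ D * (ν univ * Z) := by gcongr
    _ = _ := by ring

/-- Particles `j` and `l` are removed as well. Integrating over `l` and then `j`, with `i` as common
centre, gives `K²` per volume squared; three reinsertions give the cube of volume over `A`. -/
theorem lintegral_jastrow_erase_mul_mul_le (hA0 : A ≠ 0) (hA' : A ≠ ∞) {i j l : Fin N}
    (hij : i ≠ j) (hil : i ≠ l) (hjl : j ≠ l)
    {ψ : X → X → ℝ≥0∞} (hψ : Measurable (Function.uncurry ψ)) (hψs : ∀ y z, ψ y z = ψ z y)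
    {K : ℝ≥0∞} (hK : ∀ z, ∫⁻ y, ψ y z ∂ν ≤ K) :
    ∫⁻ x : Fin N → X, jastrow G H (Finset.univ.erase i) x * (ψ (x i) (x j) * ψ (x i) (x l))
      ∂Measure.pi (fun _ => ν) ≤
      K ^ 2 * ν univ / A ^ 3 * ∫⁻ x : Fin N → X, jastrow G H Finset.univ x ∂Measure.pi (fun _ => ν) := by
  have hm : ∀ p q : Fin N, Measurable fun x : Fin N → X => ψ (x p) (x q) := fun p q =>
    hψ.comp (f := fun x : Fin N → X => (x p, x q))
      ((measurable_pi_apply p).prodMk (measurable_pi_apply q))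
  set S := ((Finset.univ.erase i).erase j).erase l with hS
  have hlS : l ∉ S := Finset.notMem_erase _ _
  have hjS : j ∉ S := fun h => Finset.notMem_erase _ _ (Finset.mem_of_mem_erase h)
  have hmono : ∀ x, jastrow G H (Finset.univ.erase i) x ≤ jastrow G H S x := fun x =>
    (jastrow_insert_le hG1 hH1 hsymm _ j x).trans (jastrow_insert_le hG1 hH1 hsymm _ l x)
  have h1 := lintegral_jastrow_mul_le (ν := ν) hG hH hlS (hm i l) (F := fun x => ψ (x i) (x j))
    (hm i j) (fun x y => by rw [Function.update_of_ne hil, Function.update_of_ne hjl]) (D := K)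
    (fun x => by
      simp only [Function.update_of_ne hil, Function.update_self]
      simp only [hψs (x i)]
      exact hK (x i))
  have h2 := lintegral_jastrow_mul_le (ν := ν) hG hH hjS (hm i j) (F := fun _ => 1)
    measurable_const (fun _ _ => rfl) (D := K)
    (fun x => by
      simp only [Function.update_of_ne hij, Function.update_self]
      simp only [hψs (x i)]
      exact hK (x i))
  simp only [mul_one] at h2
  have e1 := mul_lintegral_jastrow_erase_le (ν := ν) hG hH hG1 hH1 hsymm hI hA (Finset.mem_univ i)
  have e2 := mul_lintegral_jastrow_erase_le (ν := ν) hG hH hG1 hH1 hsymm hI hA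
    (Finset.mem_erase.2 ⟨hij.symm, Finset.mem_univ j⟩)
  have e3 := mul_lintegral_jastrow_erase_le (ν := ν) hG hH hG1 hH1 hsymm hI hA
    (Finset.mem_erase.2 ⟨hjl.symm, Finset.mem_erase.2 ⟨hil.symm, Finset.mem_univ l⟩⟩)
  rw [← hS] at e3
  set Z := ∫⁻ x : Fin N → X, jastrow G H Finset.univ x ∂Measure.pi (fun _ => ν)
  set Z1 := ∫⁻ x : Fin N → X, jastrow G H (Finset.univ.erase i) x ∂Measure.pi (fun _ => ν)
  set Z2 := ∫⁻ x : Fin N → X, jastrow G H ((Finset.univ.erase i).erase j) x ∂Measure.pi (fun _ => ν)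
  set Z3 := ∫⁻ x : Fin N → X, jastrow G H S x ∂Measure.pi (fun _ => ν)
  set Q := ∫⁻ x : Fin N → X, jastrow G H S x * ψ (x i) (x j) ∂Measure.pi (fun _ => ν)
  set P := ∫⁻ x : Fin N → X, jastrow G H S x * ψ (x i) (x j) * ψ (x i) (x l) ∂Measure.pi (fun _ => ν)
  refine le_trans (b := P) (lintegral_mono fun x => ?_) ?_
  · rw [mul_assoc]
    gcongr
    exact hmono x
  have hV := measure_ne_top ν univ
  rw [← ENNReal.mul_div_right_comm,
    ENNReal.le_div_iff_mul_le (Or.inl (pow_ne_zero 3 hA0)) (Or.inl (ENNReal.pow_ne_top hA')),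
    ← ENNReal.mul_le_mul_iff_right (pow_ne_zero 2 hν) (ENNReal.pow_ne_top hV (n := 2))]
  calc ν univ ^ 2 * (P * A ^ 3) = ν univ * A ^ 3 * (ν univ * P) := by ring
    _ ≤ ν univ * A ^ 3 * (K * Q) := by gcongr
    _ = K * A ^ 3 * (ν univ * Q) := by ring
    _ ≤ K * A ^ 3 * (K * Z3) := by gcongr
    _ = K ^ 2 * A ^ 2 * (A * Z3) := by ring
    _ ≤ K ^ 2 * A ^ 2 * (ν univ * Z2) := by gcongr
    _ = K ^ 2 * ν univ * A * (A * Z2) := by ring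
    _ ≤ K ^ 2 * ν univ * A * (ν univ * Z1) := by gcongr
    _ = K ^ 2 * ν univ ^ 2 * (A * Z1) := by ring
    _ ≤ K ^ 2 * ν univ ^ 2 * (ν univ * Z) := by gcongr
    _ = _ := by ring

end JastrowBounds

theorem sum_card_Ioi (N : ℕ) :
    ∑ i : Fin N, (((Finset.Ioi i).card : ℕ) : ℝ≥0∞) = N * (N - 1 : ℕ) / 2 := by
  have h : ∑ i : Fin N, (Finset.Ioi i).card = ∑ i ∈ Finset.range N, i := by
    rw [← Finset.sum_range_reflect, Finset.sum_range]
    exact Finset.sum_congr rfl fun i _ => by rw [Fin.card_Ioi]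
  rw [← Nat.cast_sum, h, ENNReal.eq_div_iff (by norm_num) (by norm_num), ← Nat.cast_mul,
    ← Finset.sum_range_id_mul_two]
  push_cast
  ring

/-! ### The box -/

/-- The open cube `(0, L)³`. -/
def cube (L : ℝ) : Set Space := {y | ∀ k, y k ∈ Ioo 0 L}

theorem isOpen_cube (L : ℝ) : IsOpen (cube L) := by
  have : cube L = ⋂ k, (fun y : Space => y k) ⁻¹' Ioo 0 L := by ext; simp [cube]
  rw [this]
  exact isOpen_iInter_of_finite fun k => isOpen_Ioo.preimage (by fun_prop)

theorem box_eq_pi (N : ℕ) (L : ℝ) : box N L = univ.pi fun _ => cube L := by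
  ext; simp [box, cube]

theorem isOpen_box (N : ℕ) (L : ℝ) : IsOpen (box N L) := by
  rw [box_eq_pi]
  exact isOpen_set_pi finite_univ fun _ _ => isOpen_cube L

theorem restrict_box (N : ℕ) (L : ℝ) :
    (volume : Measure (Config N)).restrict (box N L) =
      Measure.pi fun _ => (volume : Measure Space).restrict (cube L) := by
  rw [box_eq_pi, volume_pi, Measure.restrict_pi_pi]

theorem volume_setOf_mem_Ioo (α β : ℝ) :
    volume {y : Space | ∀ k, y k ∈ Ioo α β} = ENNReal.ofReal (β - α) ^ 3 := by
  have h1 : {y : Space | ∀ k, y k ∈ Ioo α β} =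
      (WithLp.ofLp : Space → Fin 3 → ℝ) ⁻¹' (univ.pi fun _ => Ioo α β) := by
    ext y; simp
  rw [h1, (PiLp.volume_preserving_ofLp (Fin 3)).measure_preimage
    (MeasurableSet.univ_pi fun _ => measurableSet_Ioo).nullMeasurableSet, volume_pi_pi]
  simp

theorem volume_cube (L : ℝ) : volume (cube L) = ENNReal.ofReal L ^ 3 := by
  have := volume_setOf_mem_Ioo 0 L
  rwa [sub_zero] at this

theorem norm_le_of_mem_box {N : ℕ} {L : ℝ} (hL : 0 < L) {x : Config N} (hx : x ∈ box N L) :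
    ‖x‖ ≤ 2 * L := by
  refine (pi_norm_le_iff_of_nonneg (by positivity)).2 fun i => ?_
  rw [← sq_le_sq₀ (norm_nonneg _) (by positivity), EuclideanSpace.norm_sq_eq]
  have h1 : ∀ k, ‖x i k‖ ^ 2 ≤ L ^ 2 := fun k => by
    have := hx i k
    rw [Real.norm_eq_abs, sq_abs]
    exact pow_le_pow_left₀ this.1.le this.2.le 2
  calc ∑ k, ‖x i k‖ ^ 2 ≤ ∑ _k : Fin 3, L ^ 2 := Finset.sum_le_sum fun k _ => h1 k
    _ ≤ _ := by simp; nlinarith [sq_nonneg L]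

theorem norm_unitVec {N : ℕ} (i : Fin N) (k : Fin 3) : ‖unitVec i k‖ = 1 := by
  simp [unitVec, Pi.norm_single]

/-! ### Bounded Lipschitz functions -/

/-- A Lipschitz function with values in `[-1, 1]`. -/
def IsLipOne {E : Type*} [PseudoEMetricSpace E] (f : E → ℝ) : Prop :=
  (∃ C, LipschitzWith C f) ∧ ∀ x, |f x| ≤ 1

theorem IsLipOne.mul {E : Type*} [PseudoMetricSpace E] {f g : E → ℝ} (hf : IsLipOne f)
    (hg : IsLipOne g) : IsLipOne fun x => f x * g x := by
  obtain ⟨⟨C, hC⟩, hf1⟩ := hf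
  obtain ⟨⟨D, hD⟩, hg1⟩ := hg
  refine ⟨⟨C + D, LipschitzWith.of_dist_le_mul fun x y => ?_⟩, fun x => ?_⟩
  · have h1 := hC.dist_le_mul x y
    have h2 := hD.dist_le_mul x y
    rw [Real.dist_eq] at h1 h2 ⊢
    calc |f x * g x - f y * g y| = |(f x - f y) * g x + f y * (g x - g y)| := by ring_nf
      _ ≤ |f x - f y| * |g x| + |f y| * |g x - g y| := by
        rw [← abs_mul, ← abs_mul]; exact abs_add_le _ _
      _ ≤ |f x - f y| * 1 + 1 * |g x - g y| := by gcongr <;> simp [hf1, hg1]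
      _ ≤ _ := by push_cast; linarith
  · rw [abs_mul]
    exact mul_le_one₀ (hf1 x) (abs_nonneg _) (hg1 x)

theorem IsLipOne.one {E : Type*} [PseudoMetricSpace E] : IsLipOne fun _ : E => (1 : ℝ) :=
  ⟨⟨0, LipschitzWith.const 1⟩, by simp⟩

theorem IsLipOne.prod {E ι : Type*} [PseudoMetricSpace E] {f : ι → E → ℝ} {S : Finset ι}
    (hf : ∀ i ∈ S, IsLipOne (f i)) : IsLipOne fun x => ∏ i ∈ S, f i x := by
  classical
  induction S using Finset.induction_on with
  | empty => simpa using IsLipOne.one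
  | insert i S hi ih =>
    simp only [Finset.prod_insert hi]
    exact (hf i (Finset.mem_insert_self _ _)).mul
      (ih fun j hj => hf j (Finset.mem_insert_of_mem hj))

theorem IsLipOne.comp {E F : Type*} [PseudoMetricSpace E] [PseudoMetricSpace F] {f : F → ℝ}
    (hf : IsLipOne f) {φ : E → F} {C : ℝ≥0} (hφ : LipschitzWith C φ) :
    IsLipOne fun x => f (φ x) :=
  let ⟨⟨_, hD⟩, h1⟩ := hf
  ⟨⟨_, hD.comp hφ⟩, fun x => h1 (φ x)⟩

theorem isLipOne_jastrow {N : ℕ} {g h : Space → ℝ} (hg : IsLipOne g) (hh : IsLipOne h)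
    (S : Finset (Fin N)) :
    IsLipOne fun x : Config N => jastrow g (fun y z => h (y - z)) S x := by
  refine IsLipOne.mul (IsLipOne.prod fun i _ => hg.comp (LipschitzWith.eval i))
    (IsLipOne.prod fun i _ => IsLipOne.prod fun j _ => ?_)
  split_ifs
  · exact hh.comp ((LipschitzWith.eval i).sub (LipschitzWith.eval j))
  · exact IsLipOne.one

/-! ### Integration by parts on the box -/

theorem exists_contDiff_eq_on_ball {N : ℕ} {φ : Config N → ℝ} (hφ : ContDiff ℝ (⊤ : ℕ∞) φ)
    {R : ℝ} (hR : 0 < R) : ∃ ψ : Config N → ℝ, ContDiff ℝ (⊤ : ℕ∞) ψ ∧ HasCompactSupport ψ ∧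
      ∀ x, ‖x‖ < R → ψ x = φ x := by
  let η : ContDiffBump (0 : Config N) := ⟨R, R + 1, hR, by linarith⟩
  refine ⟨fun x => η x * φ x, η.contDiff.mul hφ, η.hasCompactSupport.mul_right, fun x hx => ?_⟩
  simp only
  rw [η.one_of_mem_closedBall (by simpa [η] using hx.le), one_mul]

theorem fderiv_eq_of_eq_on_ball {N : ℕ} {φ ψ : Config N → ℝ} {R : ℝ}
    (h : ∀ x, ‖x‖ < R → ψ x = φ x) {x : Config N} (hx : ‖x‖ < R) :
    fderiv ℝ ψ x = fderiv ℝ φ x := by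
  refine Filter.EventuallyEq.fderiv_eq ?_
  filter_upwards [Metric.isOpen_ball.mem_nhds (by simpa using hx : x ∈ Metric.ball 0 R)] with y hy
  exact h y (by simpa using hy)

/-- A test function need not vanish at the walls. It is made compactly supported without change on
the box, and integration by parts on the whole space applies because `u` is Lipschitz there and zero
outside. -/
theorem setIntegral_mul_fderiv_of_eq_zero {N : ℕ} {L : ℝ} (hL : 0 < L) {u φ : Config N → ℝ}
    (hu : IsLipOne u) (hu0 : ∀ x, 0 ≤ u x) (hbox : ∀ x, x ∉ box N L → u x = 0)
    (hφ : ContDiff ℝ (⊤ : ℕ∞) φ) (w : Config N) :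
    ∫ x in box N L, u x * fderiv ℝ φ x w = -∫ x in box N L, fderiv ℝ u x w * φ x := by
  obtain ⟨⟨C, hC⟩, -⟩ := hu
  obtain ⟨ψ, hψ, hψc, hψφ⟩ := exists_contDiff_eq_on_ball hφ (by positivity : 0 < 3 * L)
  obtain ⟨D, hD⟩ := hψ.lipschitzWith_of_hasCompactSupport hψc (by simp)
  have hin : ∀ x ∈ box N L, ‖x‖ < 3 * L := fun x hx =>
    (norm_le_of_mem_box hL hx).trans_lt (by linarith)
  have huc : HasCompactSupport u := HasCompactSupport.of_support_subset_isCompact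
    (isCompact_closedBall (0 : Config N) (3 * L)) fun x hx => by
      have : x ∈ box N L := by by_contra h; exact hx (hbox x h)
      simpa using (hin x this).le
  have key := LipschitzWith.integral_lineDeriv_mul_eq (μ := volume) hD hC huc w
  have h1 : ∫ x in box N L, u x * fderiv ℝ φ x w = ∫ x, lineDeriv ℝ ψ x w * u x := by
    have hz : ∀ x, x ∉ box N L → lineDeriv ℝ ψ x w * u x = 0 := fun x hx => by
      rw [hbox x hx, mul_zero]
    rw [← setIntegral_eq_integral_of_forall_compl_eq_zero hz]
    refine setIntegral_congr_fun (isOpen_box N L).measurableSet fun x hx => ?_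
    rw [((hψ.differentiable (by simp)) x).lineDeriv_eq_fderiv,
      fderiv_eq_of_eq_on_ball hψφ (hin x hx), mul_comm]
  have h2 : -∫ x in box N L, fderiv ℝ u x w * φ x = ∫ x, lineDeriv ℝ u x (-w) * ψ x := by
    have hz : ∀ x, x ∉ box N L → fderiv ℝ u x w * φ x = 0 := fun x hx => by
      -- Off the box `u` attains its minimum 0, so `fderiv` is 0 there, differentiable or not.
      have : IsLocalMin u x := Filter.Eventually.of_forall fun y => by rw [hbox x hx]; exact hu0 y
      rw [this.fderiv_eq_zero]; simp
    rw [setIntegral_eq_integral_of_forall_compl_eq_zero hz, ← integral_neg]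
    refine integral_congr_ae ?_
    filter_upwards [hC.ae_differentiableAt (μ := volume)] with x hx
    rw [hx.lineDeriv_eq_fderiv, map_neg]
    by_cases hxb : x ∈ box N L
    · rw [hψφ x (hin x hxb)]; ring
    · have : IsLocalMin u x := Filter.Eventually.of_forall fun y => by rw [hbox x hxb]; exact hu0 y
      rw [this.fderiv_eq_zero]; simp
  rw [h1, h2, key]

/-! ### Integration by parts on the torus. -/

section Periodic

variable {N : ℕ} {L : ℝ} {i : Fin N} {k : Fin 3}

theorem add_smul_unitVec_apply (x : Config N) (t : ℝ) (j : Fin N) (m : Fin 3) :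
    (x + t • unitVec i k) j m = x j m + if j = i ∧ m = k then t else 0 := by
  by_cases hj : j = i
  · subst hj
    by_cases hm : m = k <;> simp [unitVec, hm]
  · simp [unitVec, hj]

/-- The part of configuration space where the `k`-th coordinate of particle `i` is in `(α, β)`
and all others are in `(0, L)`. -/
def slab (L : ℝ) (i : Fin N) (k : Fin 3) (α β : ℝ) : Set (Config N) :=
  {x | (∀ j m, ¬ (j = i ∧ m = k) → x j m ∈ Ioo 0 L) ∧ x i k ∈ Ioo α β}

theorem slab_zero : slab L i k 0 L = box N L := by
  ext x
  refine ⟨fun h j m => ?_, fun h => ⟨fun j m _ => h j m, h i k⟩⟩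
  by_cases hjm : j = i ∧ m = k
  · rw [hjm.1, hjm.2]; exact h.2
  · exact h.1 j m hjm

theorem measurableSet_slab (α β : ℝ) : MeasurableSet (slab L i k α β) := by
  have h : ∀ j m, Measurable fun x : Config N => x j m := fun j m => by fun_prop
  have : slab L i k α β = (⋂ j, ⋂ m, ⋂ _ : ¬ (j = i ∧ m = k),
      (fun x : Config N => x j m) ⁻¹' Ioo 0 L) ∩ (fun x : Config N => x i k) ⁻¹' Ioo α β := by
    ext; simp [slab]
  rw [this]
  exact (MeasurableSet.iInter fun j => MeasurableSet.iInter fun m => MeasurableSet.iInter fun _ =>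
    h j m measurableSet_Ioo).inter (h i k measurableSet_Ioo)

theorem setIntegral_slab_add (w : Config N → ℝ) (t α β : ℝ) :
    ∫ x in slab L i k α β, w (x + t • unitVec i k) = ∫ x in slab L i k (α + t) (β + t), w x := by
  have h := (measurePreserving_add_right (volume : Measure (Config N))
    (t • unitVec i k)).setIntegral_preimage_emb (measurableEmbedding_addRight _) w
      (slab L i k (α + t) (β + t))
  rw [← h]
  congr 2
  ext x
  simp only [slab, mem_ofPred_eq, mem_preimage, add_smul_unitVec_apply]
  refine and_congr (forall_congr' fun j => forall_congr' fun m => forall_congr' fun hjm => ?_) ?_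
  · rw [if_neg hjm, add_zero]
  · simp

theorem ae_coord_ne (i : Fin N) (k : Fin 3) (c : ℝ) : ∀ᵐ x : Config N, x i k ≠ c := by
  let l : Config N →ₗ[ℝ] ℝ :=
    { toFun := fun x => x i k, map_add' := fun _ _ => rfl, map_smul' := fun _ _ => rfl }
  have hl : Function.Surjective l := fun t => ⟨t • unitVec i k, by
    change (t • unitVec i k : Config N) i k = t
    simp [unitVec]⟩
  have := (ae_comp_linearMap_mem_iff l volume volume hl (s := {c}ᶜ) (by measurability)).2
    (by simp [ae_iff])
  filter_upwards [this] with x hx using hx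

theorem setIntegral_slab_split {w : Config N → ℝ} {α β γ : ℝ} (hαγ : α ≤ γ) (hγβ : γ ≤ β)
    (hw : IntegrableOn w (slab L i k α β)) :
    ∫ x in slab L i k α β, w x = (∫ x in slab L i k α γ, w x) + ∫ x in slab L i k γ β, w x := by
  have h1 : slab L i k α γ ⊆ slab L i k α β := fun x hx => ⟨hx.1, hx.2.1, hx.2.2.trans_le hγβ⟩
  have h2 : slab L i k γ β ⊆ slab L i k α β := fun x hx => ⟨hx.1, hαγ.trans_lt hx.2.1, hx.2.2⟩
  rw [← setIntegral_union _ (measurableSet_slab γ β) (hw.mono_set h1) (hw.mono_set h2)]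
  · refine setIntegral_congr_set ?_
    filter_upwards [ae_coord_ne i k γ] with x hx
    refine propext ⟨fun h => ?_, fun h => h.elim (fun h => h1 h) fun h => h2 h⟩
    rcases lt_or_gt_of_ne hx with h3 | h3
    · exact Or.inl ⟨h.1, h.2.1, h3⟩
    · exact Or.inr ⟨h.1, h3, h.2.2⟩
  · exact disjoint_left.2 fun x hx hx' => lt_asymm hx.2.2 hx'.2.1

/-- The shift carries the box to a slab sticking out beyond `L`; periodicity moves the excess back
to the empty part. -/
theorem setIntegral_box_add (hL : 0 < L) {w : Config N → ℝ} (hw : Continuous w)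
    (hper : ∀ x, w (x + L • unitVec i k) = w x) {t : ℝ} (ht : 0 < t) (htL : t < L) :
    ∫ x in box N L, w (x + t • unitVec i k) = ∫ x in box N L, w x := by
  have hint : ∀ α β, 0 ≤ α → β ≤ 2 * L → IntegrableOn w (slab L i k α β) := fun α β hα hβ => by
    refine (hw.continuousOn.integrableOn_compact (isCompact_closedBall 0 (4 * L))).mono_set ?_
    intro x hx
    have : x ∈ box N (2 * L) := fun j m => by
      by_cases hjm : j = i ∧ m = k
      · rw [hjm.1, hjm.2]; exact ⟨hα.trans_lt hx.2.1, hx.2.2.trans_le hβ⟩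
      · have := hx.1 j m hjm; exact ⟨this.1, by linarith [this.2]⟩
    have := norm_le_of_mem_box (by positivity) this
    simpa using this.trans (by linarith)
  rw [← slab_zero (i := i) (k := k), setIntegral_slab_add,
    setIntegral_slab_split (γ := L) (by linarith) (by linarith) (hint _ _ (by linarith) (by linarith)),
    setIntegral_slab_split (γ := t) ht.le htL.le (hint 0 L le_rfl (by linarith))]
  have h := setIntegral_slab_add (L := L) (i := i) (k := k) w L 0 t
  simp only [hper] at h
  rw [h, zero_add, zero_add, add_comm t L, add_comm]

/-- Difference quotients of the periodic product integrate to exactly zero. The Lipschitz bound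
allows dominated convergence to the derivative, which exists almost everywhere by Rademacher's
theorem. -/
theorem setIntegral_mul_fderiv_of_periodic (hL : 0 < L) {u φ : Config N → ℝ} (hu : IsLipOne u)
    (hu' : ∀ x, u (x + L • unitVec i k) = u x) (hφ : ContDiff ℝ (⊤ : ℕ∞) φ)
    (hφ' : ∀ x, φ (x + L • unitVec i k) = φ x) :
    ∫ x in box N L, u x * fderiv ℝ φ x (unitVec i k) =
      -∫ x in box N L, fderiv ℝ u x (unitVec i k) * φ x := by
  obtain ⟨⟨C, hC⟩, hu1⟩ := hu
  set e : Config N := unitVec i k with he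
  have hen : ‖e‖ = 1 := norm_unitVec i k
  obtain ⟨ψ, hψ, hψc, hψφ⟩ := exists_contDiff_eq_on_ball hφ (by positivity : 0 < 4 * L)
  obtain ⟨D, hD⟩ := hψ.lipschitzWith_of_hasCompactSupport hψc (by simp)
  obtain ⟨M, hM⟩ := hψc.exists_bound_of_continuous hψ.continuous
  have hM0 : 0 ≤ M := (norm_nonneg _).trans (hM 0)
  have hin : ∀ x ∈ box N L, ‖x‖ ≤ 2 * L := fun x hx => norm_le_of_mem_box hL hx
  -- The compactly supported `ψ` makes `w` globally Lipschitz. The radius `4L` leaves room for the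
  -- box, of norm at most `2L`, and for a step shorter than `L`.
  set w : Config N → ℝ := fun x => u x * ψ x with hw
  have hwl : LipschitzWith (D + M.toNNReal * C) w := LipschitzWith.of_dist_le_mul fun x y => by
    have h1 := hC.dist_le_mul x y
    have h2 := hD.dist_le_mul x y
    have h3 := hM y
    rw [Real.norm_eq_abs] at h3
    rw [Real.dist_eq] at h1 h2 ⊢
    calc |u x * ψ x - u y * ψ y| = |u x * (ψ x - ψ y) + ψ y * (u x - u y)| := by ring_nf
      _ ≤ |u x| * |ψ x - ψ y| + |ψ y| * |u x - u y| := by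
        rw [← abs_mul, ← abs_mul]; exact abs_add_le _ _
      _ ≤ 1 * |ψ x - ψ y| + M * |u x - u y| := by
        gcongr
        exact hu1 x
      _ ≤ 1 * (D * dist x y) + M * (C * dist x y) := by gcongr
      _ = _ := by push_cast; rw [Real.coe_toNNReal M hM0]; ring
  have hfin : volume (box N L) ≠ ∞ := by
    refine ((measure_mono fun x hx => ?_).trans_lt
      (isCompact_closedBall (0 : Config N) (2 * L)).measure_lt_top).ne
    simpa using hin x hx
  have hzero : ∀ t, 0 < t → t < L → ∫ x in box N L, t⁻¹ • (w (x + t • e) - w x) = 0 := by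
    intro t ht htL
    have huc := hC.continuous
    have hφc := hφ.continuous
    have huφ : Continuous fun x => u x * φ x := hC.continuous.mul hφ.continuous
    have h1 : ∫ x in box N L, t⁻¹ • (w (x + t • e) - w x) =
        ∫ x in box N L, t⁻¹ • (u (x + t • e) * φ (x + t • e) - u x * φ x) := by
      refine setIntegral_congr_fun (isOpen_box N L).measurableSet fun x hx => ?_
      have h2 := hin x hx
      have h3 : ‖x + t • e‖ < 4 * L := by
        refine (norm_add_le _ _).trans_lt ?_
        rw [norm_smul, hen, Real.norm_eq_abs, abs_of_pos ht]
        linarith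
      simp only [hw]
      rw [hψφ _ h3, hψφ x (by linarith)]
    have hint : ∀ f : Config N → ℝ, Continuous f → IntegrableOn f (box N L) := fun f hf =>
      (hf.continuousOn.integrableOn_compact (isCompact_closedBall 0 (2 * L))).mono_set
        fun x hx => by simpa using hin x hx
    rw [h1, integral_smul, integral_sub (hint _ (by fun_prop)) (hint _ huφ),
      setIntegral_box_add hL huφ (fun x => by rw [hu', hφ']) ht htL]
    simp
  have hlim : Tendsto (fun t : ℝ => ∫ x in box N L, t⁻¹ • (w (x + t • e) - w x)) (𝓝[>] 0)
      (𝓝 (∫ x in box N L, fderiv ℝ w x e)) := by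
    have : IsFiniteMeasure (volume.restrict (box N L)) := ⟨by simpa using hfin.lt_top⟩
    refine tendsto_integral_filter_of_dominated_convergence
      (fun _ => ((D + M.toNNReal * C : ℝ≥0) : ℝ)) ?_ ?_ (integrable_const _) ?_
    · refine Eventually.of_forall fun t => Continuous.aestronglyMeasurable ?_
      have := hwl.continuous
      fun_prop
    · filter_upwards [self_mem_nhdsWithin] with t ht
      have ht : 0 < t := ht
      refine Eventually.of_forall fun x => ?_
      have := hwl.dist_le_mul (x + t • e) x
      rw [dist_eq_norm, dist_eq_norm, add_sub_cancel_left, norm_smul t e, hen, mul_one,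
        Real.norm_eq_abs t, abs_of_pos ht] at this
      rw [norm_smul, norm_inv, Real.norm_eq_abs t, abs_of_pos ht, inv_mul_le_iff₀ ht, mul_comm]
      exact this
    · filter_upwards [ae_restrict_of_ae (hwl.ae_differentiableAt (μ := volume))] with x hx
      exact (hx.hasFDerivAt.hasLineDerivAt e).tendsto_slope_zero_right
  have hint0 : ∫ x in box N L, fderiv ℝ w x e = 0 := by
    refine tendsto_nhds_unique hlim (tendsto_const_nhds.congr' ?_)
    filter_upwards [Ioo_mem_nhdsGT hL] with t ht using (hzero t ht.1 ht.2).symm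
  have h2 : ∫ x in box N L, fderiv ℝ w x e =
      ∫ x in box N L, (u x * fderiv ℝ φ x e + fderiv ℝ u x e * φ x) := by
    refine setIntegral_congr_ae (isOpen_box N L).measurableSet ?_
    filter_upwards [hC.ae_differentiableAt (μ := volume)] with x hx hxb
    have h3 : ‖x‖ < 4 * L := (hin x hxb).trans_lt (by linarith)
    rw [hw, fderiv_fun_mul hx ((hψ.differentiable (by simp)) x),
      fderiv_eq_of_eq_on_ball hψφ h3, hψφ x h3]
    simp
    ring
  have hb : ∀ (f : Config N → ℝ) (K : ℝ), Measurable f → (∀ x ∈ box N L, |f x| ≤ K) →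
      IntegrableOn f (box N L) := fun f K hf hK =>
    Measure.integrableOn_of_bounded hfin hf.aestronglyMeasurable (M := K)
      ((ae_restrict_iff' (isOpen_box N L).measurableSet).2 (Eventually.of_forall hK))
  rw [h2, integral_add (hb _ D ?_ ?_) (hb _ (C * M) ?_ ?_)] at hint0
  · linarith
  · exact hC.continuous.measurable.mul (measurable_fderiv_apply_const ℝ φ e)
  · intro x hx
    rw [← fderiv_eq_of_eq_on_ball hψφ ((hin x hx).trans_lt (by linarith)), abs_mul]
    have h4 := (fderiv ℝ ψ x).le_opNorm e
    rw [hen, mul_one, Real.norm_eq_abs] at h4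
    have h5 := h4.trans (norm_fderiv_le_of_lipschitz ℝ hD)
    calc _ ≤ 1 * (D : ℝ) := by gcongr; exact hu1 x
      _ = _ := one_mul _
  · exact (measurable_fderiv_apply_const ℝ u e).mul hφ.continuous.measurable
  · intro x hx
    rw [← hψφ x ((hin x hx).trans_lt (by linarith)), abs_mul]
    have h4 := (fderiv ℝ u x).le_opNorm e
    rw [hen, mul_one, Real.norm_eq_abs] at h4
    have h5 := h4.trans (norm_fderiv_le_of_lipschitz ℝ hC)
    have h6 := hM x
    rw [Real.norm_eq_abs] at h6
    gcongr

end Periodic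

/-! ### The variational principle for real Lipschitz functions -/

theorem volume_box_lt_top (N : ℕ) {L : ℝ} (hL : 0 < L) : volume (box N L) < ∞ := by
  refine (measure_mono fun x hx => ?_).trans_lt
    (isCompact_closedBall (0 : Config N) (2 * L)).measure_lt_top
  simpa using norm_le_of_mem_box hL hx

/-- A normalised multiple of `u`, with its pointwise derivative as weak gradient, is admissible; the
right side is its Rayleigh quotient. -/
theorem groundStateEnergy_le_of_isLipOne {bc : BoundaryCondition} {μ : ℝ} {v : ℝ → ℝ≥0∞} {N : ℕ}
    {L : ℝ} (hL : 0 < L) {u : Config N → ℝ} (hu : IsLipOne u)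
    (hsymm : ∀ (σ : Equiv.Perm (Fin N)) x, u (x ∘ σ) = u x)
    (hweak : ∀ φ : Config N → ℝ, IsTestFunction bc L φ → ∀ i k,
      ∫ x in box N L, u x * fderiv ℝ φ x (unitVec i k) =
        -∫ x in box N L, fderiv ℝ u x (unitVec i k) * φ x)
    (hZ : ∫⁻ x in box N L, ‖u x‖ₑ ^ 2 ≠ 0) :
    groundStateEnergy bc μ v N L ≤
      ((ENNReal.ofReal μ * ∑ i, ∑ k, ∫⁻ x in box N L, ‖fderiv ℝ u x (unitVec i k)‖ₑ ^ 2) +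
        ∫⁻ x in box N L, (∑ i, ∑ j ∈ Finset.Ioi i, pairPotential bc v L (x i) (x j)) *
          ‖u x‖ₑ ^ 2) / ∫⁻ x in box N L, ‖u x‖ₑ ^ 2 := by
  obtain ⟨⟨C, hC⟩, hu1⟩ := hu
  have hvol := volume_box_lt_top N hL
  have : IsFiniteMeasure (volume.restrict (box N L)) := ⟨by simpa using hvol⟩
  set Z := ∫⁻ x in box N L, ‖u x‖ₑ ^ 2 with hZdef
  have hZt : Z ≠ ∞ := by
    refine ((lintegral_mono fun x => (?_ : ‖u x‖ₑ ^ 2 ≤ 1)).trans_lt (by simpa using hvol)).ne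
    refine pow_le_one' ?_ 2
    rw [← ofReal_norm]
    exact ENNReal.ofReal_le_one.2 (hu1 x)
  have hZ0 : 0 < Z.toReal := ENNReal.toReal_pos hZ hZt
  set c : ℝ := (Real.sqrt Z.toReal)⁻¹ with hc
  have hc0 : 0 < c := by positivity
  have hcZ : ‖c‖ₑ ^ 2 = Z⁻¹ := by
    rw [Real.enorm_of_nonneg hc0.le, ← ENNReal.ofReal_pow hc0.le, hc, inv_pow,
      Real.sq_sqrt hZ0.le, ENNReal.ofReal_inv_of_pos hZ0, ENNReal.ofReal_toReal hZt]
  have hsq : ∀ a : ℝ, ‖((c * a : ℝ) : ℂ)‖ₑ ^ 2 = Z⁻¹ * ‖a‖ₑ ^ 2 := fun a => by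
    rw [← hcZ, ← mul_pow, ← enorm_mul, ← ofReal_norm, Complex.norm_real, ofReal_norm]
  have hd : ∀ (x : Config N) (i : Fin N) (k : Fin 3), ‖fderiv ℝ u x (unitVec i k)‖ ≤ C :=
    fun x i k => by
      have h4 := (fderiv ℝ u x).le_opNorm (unitVec i k)
      rw [norm_unitVec, mul_one] at h4
      exact h4.trans (norm_fderiv_le_of_lipschitz ℝ hC)
  have hstate : IsBosonicState bc L (fun x => ((c * u x : ℝ) : ℂ))
      (fun i k x => ((c * fderiv ℝ u x (unitVec i k) : ℝ) : ℂ)) := by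
    refine ⟨?_, fun i k => ?_, fun φ hφ i k => ?_, fun σ => ?_, ?_⟩
    · refine MemLp.of_bound (Continuous.aestronglyMeasurable ?_) (c * 1)
        (Eventually.of_forall fun x => ?_)
      · have := hC.continuous
        fun_prop
      · rw [Complex.norm_real, norm_mul, Real.norm_eq_abs c, abs_of_pos hc0]
        gcongr
        exact hu1 x
    · refine MemLp.of_bound (Measurable.aestronglyMeasurable ?_) (c * C)
        (Eventually.of_forall fun x => ?_)
      · exact Complex.measurable_ofReal.comp
          ((measurable_fderiv_apply_const ℝ u (unitVec i k)).const_mul c)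
      · rw [Complex.norm_real, norm_mul, Real.norm_eq_abs c, abs_of_pos hc0]
        gcongr
        exact hd x i k
    · have h1 := hweak φ hφ i k
      simp only [← Complex.ofReal_mul, integral_complex_ofReal, mul_assoc, integral_const_mul]
      rw [h1]
      push_cast
      ring
    · exact Eventually.of_forall fun x => by simp only [hsymm]
    · simp only [hsq]
      rw [lintegral_const_mul' _ _ (ENNReal.inv_ne_top.2 hZ), ← hZdef, ENNReal.inv_mul_cancel hZ hZt]
  refine iInf_le_of_le _ (iInf_le_of_le _ (iInf_le_of_le hstate (le_of_eq ?_)))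
  simp only [energy, hsq, mul_left_comm _ Z⁻¹]
  simp only [lintegral_const_mul' _ _ (ENNReal.inv_ne_top.2 hZ), ← Finset.mul_sum]
  rw [mul_left_comm, ← mul_add, mul_comm, ← div_eq_mul_inv]

/-! ### The gradient of a Jastrow function -/

theorem sum_sq_apply_single_le (l : Space →L[ℝ] ℝ) :
    ∑ k, l (EuclideanSpace.single k 1) ^ 2 ≤ ‖l‖ ^ 2 := by
  set a := (InnerProductSpace.toDual ℝ Space).symm l with ha
  have h1 : ∀ k, l (EuclideanSpace.single k 1) = a k := fun k => by
    rw [← InnerProductSpace.toDual_symm_apply, ← ha, EuclideanSpace.inner_single_right]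
    simp
  have h2 : ‖a‖ = ‖l‖ := LinearIsometryEquiv.norm_map _ _
  rw [← h2, EuclideanSpace.norm_sq_eq]
  simp [h1]

/-- In an off-diagonal term, the product lacking `h j` still contains `h l` and conversely, so a
factor `h j * h l` survives. For hard cores this keeps the cross terms on the support of `h`. -/
theorem sq_sum_mul_prod_erase_le {ι : Type*} [DecidableEq ι] (S : Finset ι) (h κ : ι → ℝ)
    (h0 : ∀ j, 0 ≤ h j) (h1 : ∀ j, h j ≤ 1) (hκ : ∀ j, 0 ≤ κ j) :
    (∑ j ∈ S, κ j * ∏ l ∈ S.erase j, h l) ^ 2 ≤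
      ∑ j ∈ S, κ j ^ 2 + ∑ j ∈ S, ∑ l ∈ S.erase j, (h j * κ j) * (h l * κ l) := by
  have hP0 : ∀ j, 0 ≤ ∏ l ∈ S.erase j, h l := fun j => Finset.prod_nonneg fun l _ => h0 l
  have hP1 : ∀ j, ∏ l ∈ S.erase j, h l ≤ 1 := fun j =>
    Finset.prod_le_one (fun l _ => h0 l) fun l _ => h1 l
  have hPl : ∀ j, ∀ l ∈ S.erase j, ∏ l ∈ S.erase j, h l ≤ h l := fun j l hl => by
    rw [← Finset.mul_prod_erase _ _ hl]
    exact mul_le_of_le_one_right (h0 l)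
      (Finset.prod_le_one (fun l _ => h0 l) fun l _ => h1 l)
  rw [sq, Finset.sum_mul_sum, ← Finset.sum_add_distrib]
  refine Finset.sum_le_sum fun j hj => ?_
  rw [← Finset.add_sum_erase _ _ hj]
  refine add_le_add ?_ (Finset.sum_le_sum fun l hl => ?_)
  · have := mul_le_one₀ (hP1 j) (hP0 j) (hP1 j)
    nlinarith [sq_nonneg (κ j)]
  · have hl' : j ∈ S.erase l :=
      Finset.mem_erase.2 ⟨(Finset.ne_of_mem_erase hl).symm, hj⟩
    have h2 := mul_le_mul (hPl j l hl) (hPl l j hl') (hP0 l) (h0 l)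
    have h3 := mul_le_mul_of_nonneg_left h2 (mul_nonneg (hκ j) (hκ l))
    linarith

/-- The weighted inequality with `t` separates the wall gradient from the pair gradients. The large
constant falls on the wall term, which is the one of order `1/L²`. -/
theorem norm_fderiv_mul_prod_sq_le {ι : Type*} [DecidableEq ι] (S : Finset ι) {g h : Space → ℝ}
    (hg0 : ∀ y, 0 ≤ g y) (hg1 : ∀ y, g y ≤ 1) (hh0 : ∀ y, 0 ≤ h y) (hh1 : ∀ y, h y ≤ 1)
    (x : ι → Space) {y : Space} (hg : DifferentiableAt ℝ g y)
    (hh : ∀ j ∈ S, DifferentiableAt ℝ h (y - x j)) {t : ℝ} (ht : 0 < t) :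
    ‖fderiv ℝ (fun y => g y * ∏ j ∈ S, h (y - x j)) y‖ ^ 2 ≤
      (1 + 1 / t) * ‖fderiv ℝ g y‖ ^ 2 + (1 + t) * (∑ j ∈ S, ‖fderiv ℝ h (y - x j)‖ ^ 2 +
        ∑ j ∈ S, ∑ l ∈ S.erase j, (h (y - x j) * ‖fderiv ℝ h (y - x j)‖) *
          (h (y - x l) * ‖fderiv ℝ h (y - x l)‖)) := by
  set κ : ι → ℝ := fun j => ‖fderiv ℝ h (y - x j)‖ with hκ
  set P := ∏ j ∈ S, h (y - x j) with hP
  have hP0 : 0 ≤ P := Finset.prod_nonneg fun l _ => hh0 _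
  have hP1 : P ≤ 1 := Finset.prod_le_one (fun l _ => hh0 _) fun l _ => hh1 _
  have hd1 : ∀ j ∈ S, HasFDerivAt (fun y => h (y - x j)) (fderiv ℝ h (y - x j)) y := fun j hj => by
    have := (hh j hj).hasFDerivAt.comp y ((hasFDerivAt_id y).sub_const (x j))
    simpa [Function.comp_def] using this
  have hd2 := HasFDerivAt.finsetProd hd1
  have hd3 := hg.hasFDerivAt.mul hd2
  have hn : ‖fderiv ℝ (fun y => g y * ∏ j ∈ S, h (y - x j)) y‖ ≤
      ‖fderiv ℝ g y‖ + ∑ j ∈ S, κ j * ∏ l ∈ S.erase j, h (y - x l) := by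
    rw [show fderiv ℝ (fun y => g y * ∏ j ∈ S, h (y - x j)) y = _ from hd3.fderiv, add_comm]
    refine (norm_add_le _ _).trans (add_le_add ?_ ?_)
    · rw [norm_smul, Real.norm_eq_abs, abs_of_nonneg hP0]
      exact mul_le_of_le_one_left (norm_nonneg _) hP1
    · rw [norm_smul, Real.norm_eq_abs, abs_of_nonneg (hg0 y)]
      refine (mul_le_of_le_one_left (norm_nonneg _) (hg1 y)).trans ?_
      refine (norm_sum_le _ _).trans (Finset.sum_le_sum fun j _ => ?_)
      rw [norm_smul, Real.norm_eq_abs, abs_of_nonneg (Finset.prod_nonneg fun l _ => hh0 _),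
        mul_comm]
  have hs := sq_sum_mul_prod_erase_le S (fun j => h (y - x j)) κ (fun j => hh0 _) (fun j => hh1 _)
    fun j => norm_nonneg _
  set α := ‖fderiv ℝ g y‖
  set β := ∑ j ∈ S, κ j * ∏ l ∈ S.erase j, h (y - x l)
  calc _ ≤ (α + β) ^ 2 := pow_le_pow_left₀ (norm_nonneg _) hn 2
    _ ≤ (1 + 1 / t) * α ^ 2 + (1 + t) * β ^ 2 := by
        have h1 : (1 + 1 / t) * α ^ 2 + (1 + t) * β ^ 2 - (α + β) ^ 2 = (α - t * β) ^ 2 / t := by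
          field_simp
          ring
        have h2 : 0 ≤ (α - t * β) ^ 2 / t := by positivity
        linarith
    _ ≤ _ := by gcongr

/-- Null sets pull back to null sets under the surjective linear map `x ↦ x i - x j`. -/
theorem ae_differentiableAt_sub {N : ℕ} {h : Space → ℝ} (hh : IsLipOne h) {i j : Fin N}
    (hij : i ≠ j) : ∀ᵐ x : Config N, DifferentiableAt ℝ h (x i - x j) := by
  obtain ⟨⟨C, hC⟩, -⟩ := hh
  let l : Config N →ₗ[ℝ] Space :=
    (LinearMap.proj i : Config N →ₗ[ℝ] Space) - LinearMap.proj j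
  have hl : Function.Surjective l := fun y => ⟨Pi.single i y, by simp [l, hij.symm]⟩
  exact (ae_comp_linearMap_mem_iff l volume volume hl (measurableSet_of_differentiableAt ℝ h)).2
    hC.ae_differentiableAt

theorem ae_differentiableAt_apply {N : ℕ} {g : Space → ℝ} (hg : IsLipOne g) (i : Fin N) :
    ∀ᵐ x : Config N, DifferentiableAt ℝ g (x i) := by
  obtain ⟨⟨C, hC⟩, -⟩ := hg
  let l : Config N →ₗ[ℝ] Space := LinearMap.proj i
  have hl : Function.Surjective l := fun y => ⟨Pi.single i y, by simp [l]⟩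
  exact (ae_comp_linearMap_mem_iff l volume volume hl (measurableSet_of_differentiableAt ℝ g)).2
    hC.ae_differentiableAt

/-- With the other particles frozen, the Jastrow function is a constant `W` times a one-body
function of `x i`. The bound carries the weight without particle `i`, as needed for integrating that
particle out. -/
theorem sum_sq_fderiv_jastrow_le {N : ℕ} {g h : Space → ℝ} (hg : IsLipOne g) (hh : IsLipOne h)
    (hg0 : ∀ y, 0 ≤ g y) (hh0 : ∀ y, 0 ≤ h y) (heven : ∀ y, h (-y) = h y) {t : ℝ} (ht : 0 < t)
    (i : Fin N) :
    ∀ᵐ x : Config N, ∑ k, fderiv ℝ (jastrow g (fun y z => h (y - z)) Finset.univ) x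
        (unitVec i k) ^ 2 ≤
      jastrow g (fun y z => h (y - z)) (Finset.univ.erase i) x ^ 2 *
        ((1 + 1 / t) * ‖fderiv ℝ g (x i)‖ ^ 2 +
          (1 + t) * (∑ j ∈ Finset.univ.erase i, ‖fderiv ℝ h (x i - x j)‖ ^ 2 +
          ∑ j ∈ Finset.univ.erase i, ∑ l ∈ (Finset.univ.erase i).erase j,
            (h (x i - x j) * ‖fderiv ℝ h (x i - x j)‖) *
              (h (x i - x l) * ‖fderiv ℝ h (x i - x l)‖))) := by
  have hsymm : ∀ y z, h (y - z) = h (z - y) := fun y z => by rw [← heven, neg_sub]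
  obtain ⟨⟨C, hC⟩, -⟩ := isLipOne_jastrow (N := N) hg hh Finset.univ
  have hall : ∀ᵐ x : Config N, ∀ j ∈ Finset.univ.erase i, DifferentiableAt ℝ h (x i - x j) :=
    (Finset.eventually_all _).2 fun j hj =>
      ae_differentiableAt_sub hh (Finset.ne_of_mem_erase hj).symm
  filter_upwards [hC.ae_differentiableAt (μ := volume), ae_differentiableAt_apply hg i, hall]
    with x hx hgx hhx
  set W := jastrow g (fun y z => h (y - z)) (Finset.univ.erase i) x with hW
  set p : Space → ℝ := fun y => g y * ∏ j ∈ Finset.univ.erase i, h (y - x j) with hp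
  have h1 : ∀ y, jastrow g (fun y z => h (y - z)) Finset.univ (Function.update x i y) = W * p y := by
    intro y
    rw [jastrow_univ hsymm i, jastrow_update (Finset.notMem_erase i _), Function.update_self]
    congr 2
    refine Finset.prod_congr rfl fun j hj => ?_
    rw [Function.update_of_ne (Finset.ne_of_mem_erase hj)]
  have hx' : DifferentiableAt ℝ (jastrow g (fun y z => h (y - z)) Finset.univ)
      (Function.update x i (x i)) := by rwa [Function.update_eq_self]
  have h2 := hx'.hasFDerivAt.comp (x i) (hasFDerivAt_update (𝕜 := ℝ) x (x i))
  have h3 : (jastrow g (fun y z => h (y - z)) Finset.univ ∘ Function.update x i) =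
      fun y => W * p y := funext h1
  have hpd : DifferentiableAt ℝ p (x i) := by
    have hd : ∀ j ∈ Finset.univ.erase i, HasFDerivAt (fun y => h (y - x j))
        (fderiv ℝ h (x i - x j)) (x i) := fun j hj => by
      have := (hhx j hj).hasFDerivAt.comp (x i) ((hasFDerivAt_id (x i)).sub_const (x j))
      simpa [Function.comp_def] using this
    exact hgx.mul (HasFDerivAt.finsetProd hd).differentiableAt
  rw [h3, Function.update_eq_self] at h2
  have h4 := h2.unique (hpd.hasFDerivAt.const_mul W)
  have h5 : ∀ k, fderiv ℝ (jastrow g (fun y z => h (y - z)) Finset.univ) x (unitVec i k) =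
      W * fderiv ℝ p (x i) (EuclideanSpace.single k 1) := fun k => by
    have := congrArg (fun l => l (EuclideanSpace.single k 1)) h4
    simp only [ContinuousLinearMap.comp_apply, smul_apply, smul_eq_mul] at this
    rw [← this]
    congr 1
    ext j
    by_cases hj : j = i
    · subst hj; simp [unitVec]
    · simp [unitVec, hj]
  simp only [h5, mul_pow]
  rw [← Finset.mul_sum]
  gcongr
  refine (sum_sq_apply_single_le _).trans ?_
  exact norm_fderiv_mul_prod_sq_le _ hg0 (fun y => (le_abs_self _).trans (hg.2 y)) hh0
    (fun y => (le_abs_self _).trans (hh.2 y)) x hgx hhx ht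

/-! ### The energy of a Jastrow function -/

theorem enorm_sq_eq_ofReal {E : Type*} [SeminormedAddCommGroup E] (a : E) :
    ‖a‖ₑ ^ 2 = ENNReal.ofReal (‖a‖ ^ 2) := by
  rw [← ofReal_norm, ENNReal.ofReal_pow (norm_nonneg _)]

/-- Squaring the modulus, as a monoid homomorphism. -/
noncomputable def enormSqHom : ℝ →* ℝ≥0∞ where
  toFun a := ‖a‖ₑ ^ 2
  map_one' := by simp
  map_mul' a b := by rw [enorm_mul, mul_pow]

theorem enorm_jastrow_sq {X : Type*} {N : ℕ} (g : X → ℝ) (h : X → X → ℝ) (S : Finset (Fin N))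
    (x : Fin N → X) : ‖jastrow g h S x‖ₑ ^ 2 =
      jastrow (fun y => ‖g y‖ₑ ^ 2) (fun y z => ‖h y z‖ₑ ^ 2) S x :=
  map_jastrow enormSqHom S x

theorem norm_fderiv_neg {h : Space → ℝ} (heven : ∀ y, h (-y) = h y) (y : Space) :
    ‖fderiv ℝ h (-y)‖ = ‖fderiv ℝ h y‖ := by
  have h1 := (ContinuousLinearEquiv.neg ℝ (M := Space)).comp_right_fderiv (f := h) (x := y)
  have h2 : h ∘ ContinuousLinearEquiv.neg ℝ (M := Space) = h := funext fun z => heven z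
  rw [h2] at h1
  rw [h1, ← norm_neg]
  congr 1
  ext z
  simp

theorem sum_enorm_fderiv_jastrow_le {N : ℕ} {g h : Space → ℝ} (hg : IsLipOne g) (hh : IsLipOne h)
    (hg0 : ∀ y, 0 ≤ g y) (hh0 : ∀ y, 0 ≤ h y) (heven : ∀ y, h (-y) = h y) {t : ℝ} (ht : 0 < t)
    (i : Fin N) :
    ∀ᵐ x : Config N, ∑ k, ‖fderiv ℝ (jastrow g (fun y z => h (y - z)) Finset.univ) x
        (unitVec i k)‖ₑ ^ 2 ≤
      jastrow (fun y => ‖g y‖ₑ ^ 2) (fun y z => ‖h (y - z)‖ₑ ^ 2) (Finset.univ.erase i) x *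
        (ENNReal.ofReal (1 + 1 / t) * ‖fderiv ℝ g (x i)‖ₑ ^ 2 +
          ENNReal.ofReal (1 + t) * (∑ j ∈ Finset.univ.erase i, ‖fderiv ℝ h (x i - x j)‖ₑ ^ 2 +
          ∑ j ∈ Finset.univ.erase i, ∑ l ∈ (Finset.univ.erase i).erase j,
            (‖h (x i - x j)‖ₑ * ‖fderiv ℝ h (x i - x j)‖ₑ) *
              (‖h (x i - x l)‖ₑ * ‖fderiv ℝ h (x i - x l)‖ₑ))) := by
  filter_upwards [sum_sq_fderiv_jastrow_le hg hh hg0 hh0 heven ht i] with x hx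
  have h1 : ∀ z, ‖h z‖ₑ * ‖fderiv ℝ h z‖ₑ = ENNReal.ofReal (h z * ‖fderiv ℝ h z‖) := fun z => by
    rw [ENNReal.ofReal_mul (hh0 z), ofReal_norm, Real.enorm_of_nonneg (hh0 z)]
  have hn : ∀ z, 0 ≤ h z * ‖fderiv ℝ h z‖ := fun z => mul_nonneg (hh0 z) (norm_nonneg _)
  rw [← enorm_jastrow_sq]
  simp only [enorm_sq_eq_ofReal, h1, ← ENNReal.ofReal_mul (hn _)]
  have hn2 : ∀ j ∈ Finset.univ.erase i, 0 ≤ ∑ l ∈ (Finset.univ.erase i).erase j,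
      h (x i - x j) * ‖fderiv ℝ h (x i - x j)‖ * (h (x i - x l) * ‖fderiv ℝ h (x i - x l)‖) :=
    fun j _ => Finset.sum_nonneg fun l _ => mul_nonneg (hn _) (hn _)
  have e1 : ∀ j ∈ Finset.univ.erase i, ∑ l ∈ (Finset.univ.erase i).erase j,
      ENNReal.ofReal (h (x i - x j) * ‖fderiv ℝ h (x i - x j)‖ *
        (h (x i - x l) * ‖fderiv ℝ h (x i - x l)‖)) =
      ENNReal.ofReal (∑ l ∈ (Finset.univ.erase i).erase j,
        h (x i - x j) * ‖fderiv ℝ h (x i - x j)‖ * (h (x i - x l) * ‖fderiv ℝ h (x i - x l)‖)) :=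
    fun j _ => (ENNReal.ofReal_sum_of_nonneg fun l _ => mul_nonneg (hn _) (hn _)).symm
  rw [← ENNReal.ofReal_sum_of_nonneg fun k _ => sq_nonneg _, Finset.sum_congr rfl e1,
    ← ENNReal.ofReal_sum_of_nonneg hn2, ← ENNReal.ofReal_sum_of_nonneg fun j _ => sq_nonneg _,
    ← ENNReal.ofReal_add (Finset.sum_nonneg fun j _ => sq_nonneg _) (Finset.sum_nonneg hn2),
    ← ENNReal.ofReal_mul (by positivity), ← ENNReal.ofReal_mul (by positivity),
    ← ENNReal.ofReal_add (by positivity)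
      (mul_nonneg (by positivity) (add_nonneg (Finset.sum_nonneg fun j _ => sq_nonneg _)
        (Finset.sum_nonneg hn2))), ← ENNReal.ofReal_mul (sq_nonneg _)]
  refine ENNReal.ofReal_le_ofReal ?_
  simpa only [Real.norm_eq_abs, sq_abs] using hx

/-- Numerator terms are divided by the norm through the ratio bounds. In the kinetic part the weight
already lacks particle `i`; in the potential part all its factors except the one shared with `j` are
bounded by 1. -/
theorem groundStateEnergy_le_of_jastrow {bc : BoundaryCondition} {μ : ℝ} {v : ℝ → ℝ≥0∞} {N : ℕ}
    {L : ℝ} (hL : 0 < L) {g h : Space → ℝ} (hg : IsLipOne g) (hh : IsLipOne h)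
    (hg0 : ∀ y, 0 ≤ g y) (hh0 : ∀ y, 0 ≤ h y) (heven : ∀ y, h (-y) = h y)
    (hweak : ∀ φ : Config N → ℝ, IsTestFunction bc L φ → ∀ i k,
      ∫ x in box N L, jastrow g (fun y z => h (y - z)) Finset.univ x *
          fderiv ℝ φ x (unitVec i k) =
        -∫ x in box N L, fderiv ℝ (jastrow g (fun y z => h (y - z)) Finset.univ) x
          (unitVec i k) * φ x)
    (hpair : Measurable (Function.uncurry (pairPotential bc v L)))
    {I D K U Γ A : ℝ≥0∞}
    (hI : ∀ z, ∫⁻ y in cube L, (1 - ‖h (y - z)‖ₑ ^ 2) ≤ I)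
    (hD : ∀ z, ∫⁻ y in cube L, ‖fderiv ℝ h (y - z)‖ₑ ^ 2 ≤ D)
    (hK : ∀ z, ∫⁻ y in cube L, ‖h (y - z)‖ₑ * ‖fderiv ℝ h (y - z)‖ₑ ≤ K)
    (hU : ∀ z, ∫⁻ y in cube L, pairPotential bc v L y z * ‖h (y - z)‖ₑ ^ 2 ≤ U)
    (hΓ : ∫⁻ y in cube L, ‖fderiv ℝ g y‖ₑ ^ 2 ≤ Γ)
    (hA : A ≤ (∫⁻ y in cube L, ‖g y‖ₑ ^ 2) - ((N - 1 : ℕ) : ℝ≥0∞) * I) (hA0 : A ≠ 0) (hA' : A ≠ ∞)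
    {t : ℝ} (ht : 0 < t) :
    groundStateEnergy bc μ v N L ≤ ENNReal.ofReal μ * (N * (ENNReal.ofReal (1 + 1 / t) * (Γ / A) +
      ENNReal.ofReal (1 + t) * ((N - 1 : ℕ) * (D / A) +
        (N - 1 : ℕ) * ((N - 1 : ℕ) * (K ^ 2 * ENNReal.ofReal L ^ 3 / A ^ 3))))) +
      N * (N - 1 : ℕ) / 2 * (U / A) := by
  set ν : Measure Space := volume.restrict (cube L) with hν
  have hνuniv : ν univ = ENNReal.ofReal L ^ 3 := by
    rw [hν, Measure.restrict_apply_univ, volume_cube]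
  have : IsFiniteMeasure ν := ⟨by rw [hνuniv]; exact ENNReal.pow_lt_top ENNReal.ofReal_lt_top⟩
  have hν0 : ν univ ≠ 0 := by
    rw [hνuniv]; exact pow_ne_zero 3 (ENNReal.ofReal_pos.2 hL).ne'
  set G : Space → ℝ≥0∞ := fun y => ‖g y‖ₑ ^ 2 with hGdef
  set H : Space → Space → ℝ≥0∞ := fun y z => ‖h (y - z)‖ₑ ^ 2 with hHdef
  have hgc : Continuous g := let ⟨⟨_, hC⟩, _⟩ := hg; hC.continuous
  have hhc : Continuous h := let ⟨⟨_, hC⟩, _⟩ := hh; hC.continuous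
  have hle1 : ∀ a : ℝ, |a| ≤ 1 → ‖a‖ₑ ^ 2 ≤ 1 := fun a ha => by
    refine pow_le_one' ?_ 2
    rw [← ofReal_norm]
    exact ENNReal.ofReal_le_one.2 ha
  have hG : Measurable G := by fun_prop
  have hhm : Measurable fun p : Space × Space => ‖h (p.1 - p.2)‖ₑ :=
    hhc.measurable.enorm.comp (by fun_prop)
  have hH : Measurable (Function.uncurry H) := hhm.pow_const 2
  have hG1 : ∀ y, G y ≤ 1 := fun y => hle1 _ (hg.2 y)
  have hH1 : ∀ y z, H y z ≤ 1 := fun y z => hle1 _ (hh.2 _)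
  have hsymm : ∀ y z, h (y - z) = h (z - y) := fun y z => by rw [← heven, neg_sub]
  have hHs : ∀ y z, H y z = H z y := fun y z => by simp only [hHdef, hsymm y z]
  set u : Config N → ℝ := jastrow g (fun y z => h (y - z)) Finset.univ with hu
  have huE : ∀ x, ‖u x‖ₑ ^ 2 = jastrow G H Finset.univ x := fun x => enorm_jastrow_sq _ _ _ x
  set Z := ∫⁻ x : Config N, jastrow G H Finset.univ x ∂Measure.pi (fun _ => ν) with hZ
  have hZu : ∫⁻ x in box N L, ‖u x‖ₑ ^ 2 = Z := by
    rw [restrict_box]; simp only [huE]; rfl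
  -- Each insertion multiplies the integral by at least `A` over the volume, so none of these
  -- integrals vanishes.
  have hZS : ∀ S : Finset (Fin N),
      ∫⁻ x : Config N, jastrow G H S x ∂Measure.pi (fun _ => ν) ≠ 0 := fun S => by
    induction S using Finset.induction_on with
    | empty =>
      simp only [jastrow, Finset.prod_empty, mul_one, lintegral_const, one_mul]
      rw [Measure.pi_univ]
      exact Finset.prod_ne_zero_iff.2 fun _ _ => hν0
    | insert i S hi ih =>
      have h1 := mul_lintegral_jastrow_erase_le (ν := ν) hG hH hG1 hH1 hHs hI hA
        (Finset.mem_insert_self i S)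
      rw [Finset.erase_insert hi] at h1
      intro h2
      rw [h2, mul_zero, nonpos_iff_eq_zero] at h1
      exact mul_ne_zero hA0 ih h1
  have hZ0 : Z ≠ 0 := hZS _
  have hdh : Measurable fun z => ‖fderiv ℝ h z‖ₑ := (measurable_fderiv ℝ h).enorm
  have hdg : Measurable fun z => ‖fderiv ℝ g z‖ₑ := (measurable_fderiv ℝ g).enorm
  set κ : Space → Space → ℝ≥0∞ := fun y z => ‖fderiv ℝ h (y - z)‖ₑ with hκdef
  set ψ : Space → Space → ℝ≥0∞ := fun y z => ‖h (y - z)‖ₑ * ‖fderiv ℝ h (y - z)‖ₑ with hψdef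
  have hκ : Measurable (Function.uncurry κ) := hdh.comp (f := fun p : Space × Space => p.1 - p.2)
    (by fun_prop)
  have hψ : Measurable (Function.uncurry ψ) := hhm.mul hκ
  have hψs : ∀ y z, ψ y z = ψ z y := fun y z => by
    simp only [hψdef, hsymm y z]
    rw [← neg_sub z y, ← ofReal_norm (fderiv ℝ h (-(z - y))), norm_fderiv_neg heven, ofReal_norm]
  have hm2 : ∀ {F : Space → Space → ℝ≥0∞}, Measurable (Function.uncurry F) → ∀ p q : Fin N,
      Measurable fun x : Config N => F (x p) (x q) := fun {F} hF p q =>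
    hF.comp (f := fun x : Config N => (x p, x q))
      ((measurable_pi_apply p).prodMk (measurable_pi_apply q))
  have hwm : ∀ S : Finset (Fin N), Measurable (jastrow G H S) := measurable_jastrow hG hH
  -- kinetic energy of one particle
  have hkin : ∀ i : Fin N, ∑ k, ∫⁻ x in box N L, ‖fderiv ℝ u x (unitVec i k)‖ₑ ^ 2 ≤
      (ENNReal.ofReal (1 + 1 / t) * (Γ / A) +
      ENNReal.ofReal (1 + t) * ((N - 1 : ℕ) * (D / A) +
        (N - 1 : ℕ) * ((N - 1 : ℕ) * (K ^ 2 * ENNReal.ofReal L ^ 3 / A ^ 3)))) * Z := by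
    intro i
    have hmg : Measurable fun x : Config N => ‖fderiv ℝ g (x i)‖ₑ ^ 2 :=
      (hdg.comp (measurable_pi_apply i)).pow_const 2
    have hmκ : ∀ j, Measurable fun x : Config N => κ (x i) (x j) ^ 2 := fun j =>
      (hm2 hκ i j).pow_const 2
    have hmψ : ∀ j l, Measurable fun x : Config N => ψ (x i) (x j) * ψ (x i) (x l) := fun j l =>
      (hm2 hψ i j).mul (hm2 hψ i l)
    have b1 := lintegral_jastrow_erase_mul_le (ν := ν) hν0 hG hH hG1 hH1 hHs hI hA hA0 hA' i hmg
      (D := Γ) (fun x => by simpa using hΓ)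
    have b2 : ∀ j ∈ Finset.univ.erase i,
        ∫⁻ x : Config N, jastrow G H (Finset.univ.erase i) x * κ (x i) (x j) ^ 2
          ∂Measure.pi (fun _ => ν) ≤ D / A * Z := fun j hj =>
      lintegral_jastrow_erase_mul_le (ν := ν) hν0 hG hH hG1 hH1 hHs hI hA hA0 hA' i (hmκ j)
        (D := D) (fun x => by
          simp only [Function.update_self, Function.update_of_ne (Finset.ne_of_mem_erase hj)]
          exact hD (x j))
    have b3 : ∀ j ∈ Finset.univ.erase i, ∀ l ∈ (Finset.univ.erase i).erase j,
        ∫⁻ x : Config N, jastrow G H (Finset.univ.erase i) x * (ψ (x i) (x j) * ψ (x i) (x l))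
          ∂Measure.pi (fun _ => ν) ≤ K ^ 2 * ENNReal.ofReal L ^ 3 / A ^ 3 * Z := fun j hj l hl => by
      have := lintegral_jastrow_erase_mul_mul_le (ν := ν) hν0 hG hH hG1 hH1 hHs hI hA hA0 hA'
        (Finset.ne_of_mem_erase hj).symm
        (Finset.ne_of_mem_erase (Finset.mem_of_mem_erase hl)).symm
        (Finset.ne_of_mem_erase hl).symm hψ hψs hK
      rwa [hνuniv] at this
    have c1 : (Finset.univ.erase i).card = N - 1 := by
      rw [Finset.card_erase_of_mem (Finset.mem_univ i), Finset.card_univ, Fintype.card_fin]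
    rw [← lintegral_finsetSum _ fun k _ => ?_]
    swap
    · exact (measurable_fderiv_apply_const ℝ u (unitVec i k)).enorm.pow_const 2
    set w := jastrow G H (Finset.univ.erase i) with hw
    have hwm' : Measurable w := hwm _
    calc _ ≤ ∫⁻ x in box N L, (ENNReal.ofReal (1 + 1 / t) * (w x * ‖fderiv ℝ g (x i)‖ₑ ^ 2) +
          ENNReal.ofReal (1 + t) * (∑ j ∈ Finset.univ.erase i, w x * κ (x i) (x j) ^ 2 +
          ∑ j ∈ Finset.univ.erase i, ∑ l ∈ (Finset.univ.erase i).erase j,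
            w x * (ψ (x i) (x j) * ψ (x i) (x l)))) := by
          refine lintegral_mono_ae (ae_restrict_of_ae ?_)
          filter_upwards [sum_enorm_fderiv_jastrow_le hg hh hg0 hh0 heven ht i] with x hx
          refine hx.trans (le_of_eq ?_)
          simp only [← Finset.mul_sum]
          rw [mul_add, mul_left_comm, mul_left_comm _ (ENNReal.ofReal (1 + t)), mul_add (jastrow _ _ _ _)]
      _ = ENNReal.ofReal (1 + 1 / t) * (∫⁻ x, w x * ‖fderiv ℝ g (x i)‖ₑ ^ 2 ∂Measure.pi fun _ => ν)
          + ENNReal.ofReal (1 + t) * (∑ j ∈ Finset.univ.erase i,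
            (∫⁻ x, w x * κ (x i) (x j) ^ 2 ∂Measure.pi fun _ => ν) +
          ∑ j ∈ Finset.univ.erase i, ∑ l ∈ (Finset.univ.erase i).erase j,
            ∫⁻ x, w x * (ψ (x i) (x j) * ψ (x i) (x l)) ∂Measure.pi fun _ => ν) := by
          have m1 : Measurable fun x => w x * ‖fderiv ℝ g (x i)‖ₑ ^ 2 := hwm'.mul hmg
          have m2 : ∀ j, Measurable fun x => w x * κ (x i) (x j) ^ 2 := fun j => hwm'.mul (hmκ j)
          have m3 : ∀ j l, Measurable fun x => w x * (ψ (x i) (x j) * ψ (x i) (x l)) :=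
            fun j l => hwm'.mul (hmψ j l)
          have m2' : Measurable fun x => ∑ j ∈ Finset.univ.erase i, w x * κ (x i) (x j) ^ 2 :=
            Finset.measurable_sum _ fun j _ => m2 j
          have m3' : ∀ j, Measurable fun x => ∑ l ∈ (Finset.univ.erase i).erase j,
              w x * (ψ (x i) (x j) * ψ (x i) (x l)) :=
            fun j => Finset.measurable_sum _ fun l _ => m3 j l
          have m3'' : Measurable fun x => ∑ j ∈ Finset.univ.erase i,
              ∑ l ∈ (Finset.univ.erase i).erase j, w x * (ψ (x i) (x j) * ψ (x i) (x l)) :=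
            Finset.measurable_sum _ fun j _ => m3' j
          rw [restrict_box, lintegral_add_left (m1.const_mul _), lintegral_const_mul _ m1,
            lintegral_const_mul (f := fun x => ∑ j ∈ Finset.univ.erase i, w x * κ (x i) (x j) ^ 2 +
              ∑ j ∈ Finset.univ.erase i, ∑ l ∈ (Finset.univ.erase i).erase j,
                w x * (ψ (x i) (x j) * ψ (x i) (x l))) _ (m2'.add m3''),
            lintegral_add_left m2',
            lintegral_finsetSum _ fun j _ => m2 j, lintegral_finsetSum _ fun j _ => m3' j]
          simp only [lintegral_finsetSum _ fun l _ => m3 _ l]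
          rfl
      _ ≤ ENNReal.ofReal (1 + 1 / t) * (Γ / A * Z) + ENNReal.ofReal (1 + t) *
          (∑ j ∈ Finset.univ.erase i, D / A * Z +
          ∑ j ∈ Finset.univ.erase i, ∑ l ∈ (Finset.univ.erase i).erase j,
            K ^ 2 * ENNReal.ofReal L ^ 3 / A ^ 3 * Z) := by
          gcongr with j hj j hj l hl
          · exact b2 j hj
          · exact b3 j hj l hl
      _ ≤ ENNReal.ofReal (1 + 1 / t) * (Γ / A * Z) + ENNReal.ofReal (1 + t) *
          ((N - 1 : ℕ) * (D / A * Z) +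
          (N - 1 : ℕ) * ((N - 1 : ℕ) * (K ^ 2 * ENNReal.ofReal L ^ 3 / A ^ 3 * Z))) := by
          simp only [Finset.sum_const, c1, nsmul_eq_mul]
          gcongr
          refine (Finset.sum_le_card_nsmul _ _ ((N - 1 : ℕ) *
            (K ^ 2 * ENNReal.ofReal L ^ 3 / A ^ 3 * Z)) fun j hj => ?_).trans_eq ?_
          · gcongr
            exact (Finset.card_le_card (Finset.erase_subset _ _)).trans_eq c1
          · rw [c1, nsmul_eq_mul]
      _ = _ := by ring
  have hpot : ∀ i : Fin N, ∀ j ∈ Finset.Ioi i,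
      ∫⁻ x in box N L, pairPotential bc v L (x i) (x j) * ‖u x‖ₑ ^ 2 ≤ U / A * Z := by
    intro i j hj
    have hij : j ≠ i := (Finset.mem_Ioi.1 hj).ne'
    have hm : Measurable fun x : Config N => pairPotential bc v L (x i) (x j) * H (x i) (x j) :=
      (hm2 hpair i j).mul (hm2 hH i j)
    have b := lintegral_jastrow_erase_mul_le (ν := ν) hν0 hG hH hG1 hH1 hHs hI hA hA0 hA' i hm
      (D := U) (fun x => by
        simp only [Function.update_self, Function.update_of_ne hij]
        exact hU (x j))
    refine le_trans ?_ b
    rw [restrict_box]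
    refine lintegral_mono fun x => ?_
    rw [huE, jastrow_univ hHs i, mul_left_comm]
    gcongr
    have hji : j ∈ Finset.univ.erase i := Finset.mem_erase.2 ⟨hij, Finset.mem_univ j⟩
    rw [← Finset.mul_prod_erase _ _ hji]
    calc _ ≤ 1 * (H (x i) (x j) * 1) := by
          gcongr
          · exact hG1 _
          · exact Finset.prod_le_one' fun _ _ => hH1 _ _
      _ = _ := by rw [one_mul, mul_one]
  have hpotm : ∀ i j : Fin N, Measurable fun x : Config N =>
      pairPotential bc v L (x i) (x j) * ‖u x‖ₑ ^ 2 := fun i j => by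
    refine (hm2 hpair i j).mul ?_
    simp only [huE]
    exact hwm _
  have hpot' : ∫⁻ x in box N L, (∑ i, ∑ j ∈ Finset.Ioi i, pairPotential bc v L (x i) (x j)) *
      ‖u x‖ₑ ^ 2 ≤ N * (N - 1 : ℕ) / 2 * (U / A) * Z := by
    simp only [Finset.sum_mul]
    rw [lintegral_finsetSum _ fun i _ => Finset.measurable_sum _ fun j _ => hpotm i j]
    simp only [lintegral_finsetSum _ fun j _ => hpotm _ j]
    calc _ ≤ ∑ i : Fin N, ∑ j ∈ Finset.Ioi i, U / A * Z :=
          Finset.sum_le_sum fun i _ => Finset.sum_le_sum fun j hj => hpot i j hj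
      _ = _ := by
          simp only [Finset.sum_const, nsmul_eq_mul]
          rw [← Finset.sum_mul, sum_card_Ioi, mul_assoc]
  refine (groundStateEnergy_le_of_isLipOne hL (isLipOne_jastrow hg hh _) (fun σ x =>
    jastrow_comp_perm hg0 (fun y z => hh0 _) hsymm σ x) hweak (by rw [hZu]; exact hZ0)).trans ?_
  rw [hZu]
  have hZt : Z ≠ ∞ := by
    refine ((lintegral_mono fun x => ?_).trans_lt (?_ : ∫⁻ x : Config N, 1 ∂Measure.pi (fun _ => ν) < ∞)).ne
    · exact mul_le_one' (Finset.prod_le_one' fun _ _ => hG1 _) (Finset.prod_le_one' fun _ _ =>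
        Finset.prod_le_one' fun _ _ => by split_ifs <;> simp [hH1])
    · simp
  rw [ENNReal.div_le_iff hZ0 hZt]
  refine (add_le_add (mul_le_mul_right (Finset.sum_le_sum fun i _ => hkin i) _) hpot').trans
    (le_of_eq ?_)
  rw [Finset.sum_const, Finset.card_univ, Fintype.card_fin, nsmul_eq_mul, add_mul]
  ring

/-! ### From pair quantities to the energy per particle -/

theorem lintegral_comp_sub_le {F : Space → ℝ≥0∞} (s : Set Space) (z : Space) :
    ∫⁻ y in s, F (y - z) ≤ ∫⁻ y, F y :=
  (setLIntegral_le_lintegral _ _).trans_eq (lintegral_sub_right_eq_self F z)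

/-- The correction factor of the Jastrow bound for `x = a / b` and the cutoff parameter `t`. -/
noncomputable def jastrowFactor (x t : ℝ) : ℝ :=
  (1 + t) / (1 - t) ^ 2 *
    (1 / ((1 - x) * (1 - x - 8 * t)) + 3 * x / ((1 - x) ^ 2 * (1 - x - 8 * t) ^ 3))

/-- `m` is the volume of `n` balls of radius `b` relative to the box. The pair term is linear in `m`
and the three-body term quadratic, so `m ≤ 1` removes it from both. -/
theorem jastrow_bound_le {μ a b t L n γ : ℝ} (hμ : 0 < μ) (hL : 0 < L) (hn : 0 ≤ n) (ha : 0 ≤ a)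
    (hab : a < b) (ht : 0 < t) (htq : 8 * t < 1 - a / b) (hnb : 4 * Real.pi / 3 * b ^ 3 * n ≤ L ^ 3) :
    μ * ((1 + 1 / t) * (γ / (L ^ 3 * (1 - a / b - 8 * t)))) + (1 + t) *
      (n * (4 * Real.pi * μ * (a / (1 - a / b)) / (1 - t) ^ 2 / (L ^ 3 * (1 - a / b - 8 * t))) +
       n * (n * (μ * ((4 * Real.pi * (a / (1 - a / b)) * b / (1 - t)) ^ 2 * L ^ 3 /
        (L ^ 3 * (1 - a / b - 8 * t)) ^ 3)))) ≤
    3 * μ * a / b ^ 3 * jastrowFactor (a / b) t +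
      μ * ((1 + 1 / t) * (γ / (L ^ 3 * (1 - a / b - 8 * t)))) := by
  have hb : 0 < b := ha.trans_lt hab
  have hx0 : 0 ≤ a / b := by positivity
  have hpi := Real.pi_pos
  set x := a / b with hx
  have hax : a = x * b := by rw [hx]; field_simp
  have hx1 : 0 < 1 - x := by linarith
  have ht1 : 0 < 1 - t := by linarith
  have hq : 0 < 1 - x - 8 * t := by linarith
  set q := 1 - x - 8 * t with hqdef
  set m := 4 * Real.pi / 3 * b ^ 3 * n / L ^ 3 with hm
  have hm1 : m ≤ 1 := (div_le_one (by positivity)).2 hnb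
  have hm0 : 0 ≤ m := by positivity
  have hnm : n = m * L ^ 3 * 3 / (4 * Real.pi * b ^ 3) := by rw [hm]; field_simp
  have e : (1 + t) *
      (n * (4 * Real.pi * μ * (a / (1 - x)) / (1 - t) ^ 2 / (L ^ 3 * q)) +
       n * (n * (μ * ((4 * Real.pi * (a / (1 - x)) * b / (1 - t)) ^ 2 * L ^ 3 /
        (L ^ 3 * q) ^ 3)))) = 3 * μ * a / b ^ 3 * ((1 + t) / (1 - t) ^ 2 *
    (m * (1 / ((1 - x) * q)) + m ^ 2 * (3 * x / ((1 - x) ^ 2 * q ^ 3)))) := by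
    rw [hnm, hax]
    clear_value m x q
    field_simp
  have h1 : m * (1 / ((1 - x) * q)) ≤ 1 * (1 / ((1 - x) * q)) := by gcongr
  have h2 : m ^ 2 * (3 * x / ((1 - x) ^ 2 * q ^ 3)) ≤ 1 * (3 * x / ((1 - x) ^ 2 * q ^ 3)) := by
    gcongr
    exact pow_le_one₀ hm0 hm1
  rw [e, jastrowFactor, ← hqdef, add_comm]
  gcongr
  · linarith
  · linarith

/-- Here `A = L³ (1 - a/b - 8t)`: `6t` is the volume lost in the wall layer, and `2t` comes from the
regularised profile. -/
theorem groundStateEnergy_div_le_of_jastrow {bc : BoundaryCondition} {μ : ℝ} {v : ℝ → ℝ≥0∞} {N : ℕ}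
    {L a b t : ℝ} (hμ : 0 < μ) (hL : 0 < L) (hN : 1 ≤ N) (ha : 0 ≤ a) (hab : a < b) (ht : 0 < t)
    (htq : 8 * t < 1 - a / b) (hnb : 4 * Real.pi / 3 * b ^ 3 * ((N - 1 : ℕ) : ℝ) ≤ L ^ 3)
    {g h : Space → ℝ} (hg : IsLipOne g) (hh : IsLipOne h)
    (hg0 : ∀ y, 0 ≤ g y) (hh0 : ∀ y, 0 ≤ h y) (heven : ∀ y, h (-y) = h y)
    (hweak : ∀ φ : Config N → ℝ, IsTestFunction bc L φ → ∀ i k,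
      ∫ x in box N L, jastrow g (fun y z => h (y - z)) Finset.univ x *
          fderiv ℝ φ x (unitVec i k) =
        -∫ x in box N L, fderiv ℝ (jastrow g (fun y z => h (y - z)) Finset.univ) x
          (unitVec i k) * φ x)
    (hpair : Measurable (Function.uncurry (pairPotential bc v L)))
    {D U : ℝ≥0∞} {γ : ℝ} (hγ0 : 0 ≤ γ)
    (hI : ∀ z, ∫⁻ y in cube L, (1 - ‖h (y - z)‖ₑ ^ 2) ≤
      ENNReal.ofReal (4 * Real.pi / 3 * b ^ 3 * (a / b + 2 * t)))
    (hD : ∀ z, ∫⁻ y in cube L, ‖fderiv ℝ h (y - z)‖ₑ ^ 2 ≤ D)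
    (hU : ∀ z, ∫⁻ y in cube L, pairPotential bc v L y z * ‖h (y - z)‖ₑ ^ 2 ≤ U)
    (hDU : ENNReal.ofReal μ * D + U / 2 ≤
      ENNReal.ofReal (4 * Real.pi * μ * (a / (1 - a / b)) / (1 - t) ^ 2))
    (hK : ∀ z, ∫⁻ y in cube L, ‖h (y - z)‖ₑ * ‖fderiv ℝ h (y - z)‖ₑ ≤
      ENNReal.ofReal (4 * Real.pi * (a / (1 - a / b)) * b / (1 - t)))
    (hγ : ∫⁻ y in cube L, ‖fderiv ℝ g y‖ₑ ^ 2 ≤ ENNReal.ofReal γ)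
    (hg2 : ENNReal.ofReal (L ^ 3 * (1 - 6 * t)) ≤ ∫⁻ y in cube L, ‖g y‖ₑ ^ 2) :
    groundStateEnergy bc μ v N L / N ≤
      ENNReal.ofReal (3 * μ * a / b ^ 3 * jastrowFactor (a / b) t +
        μ * ((1 + 1 / t) * (γ / (L ^ 3 * (1 - a / b - 8 * t))))) := by
  have hb : 0 < b := ha.trans_lt hab
  have hx0 : 0 ≤ a / b := by positivity
  have hx1 : 0 < 1 - a / b := by linarith
  have ht1 : 0 < 1 - t := by linarith
  have hq : 0 < 1 - a / b - 8 * t := by linarith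
  have hpi := Real.pi_pos
  set q := 1 - a / b - 8 * t with hqdef
  set n : ℕ := N - 1 with hn
  have hA : ENNReal.ofReal (L ^ 3 * q) ≤ (∫⁻ y in cube L, ‖g y‖ₑ ^ 2) - (n : ℝ≥0∞) *
      ENNReal.ofReal (4 * Real.pi / 3 * b ^ 3 * (a / b + 2 * t)) := by
    refine le_trans ?_ (tsub_le_tsub_right hg2 _)
    rw [← ENNReal.ofReal_natCast, ← ENNReal.ofReal_mul (by positivity),
      ← ENNReal.ofReal_sub _ (by positivity)]
    refine ENNReal.ofReal_le_ofReal ?_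
    have := mul_le_mul_of_nonneg_right hnb (by positivity : 0 ≤ a / b + 2 * t)
    rw [hqdef]
    linarith
  have hAp : 0 < L ^ 3 * q := by positivity
  have key := groundStateEnergy_le_of_jastrow (μ := μ) hL hg hh hg0 hh0 heven hweak hpair hI hD hK hU hγ hA
    (ENNReal.ofReal_pos.2 hAp).ne' ENNReal.ofReal_ne_top ht
  rw [← hn] at key
  refine le_trans ?_ (ENNReal.ofReal_le_ofReal
    (jastrow_bound_le (γ := γ) hμ hL (Nat.cast_nonneg n) ha hab ht htq hnb))
  rw [ENNReal.div_le_iff (by exact_mod_cast (by omega : N ≠ 0)) (ENNReal.natCast_ne_top N), mul_comm]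
  refine key.trans ?_
  have e1 : ENNReal.ofReal γ / ENNReal.ofReal (L ^ 3 * q) = ENNReal.ofReal (γ / (L ^ 3 * q)) :=
    (ENNReal.ofReal_div_of_pos hAp).symm
  have e2 : ENNReal.ofReal (4 * Real.pi * (a / (1 - a / b)) * b / (1 - t)) ^ 2 *
      ENNReal.ofReal L ^ 3 / ENNReal.ofReal (L ^ 3 * q) ^ 3 =
      ENNReal.ofReal ((4 * Real.pi * (a / (1 - a / b)) * b / (1 - t)) ^ 2 * L ^ 3 /
        (L ^ 3 * q) ^ 3) := by
    have h0 : 0 ≤ 4 * Real.pi * (a / (1 - a / b)) * b / (1 - t) := by positivity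
    generalize 4 * Real.pi * (a / (1 - a / b)) * b / (1 - t) = k at h0 ⊢
    rw [← ENNReal.ofReal_pow h0, ← ENNReal.ofReal_pow hL.le, ← ENNReal.ofReal_pow hAp.le,
      ← ENNReal.ofReal_mul (by positivity), ENNReal.ofReal_div_of_pos (by positivity)]
  rw [e1, e2]
  set k := (4 * Real.pi * (a / (1 - a / b)) * b / (1 - t)) ^ 2 * L ^ 3 / (L ^ 3 * q) ^ 3 with hk
  set A := ENNReal.ofReal (L ^ 3 * q) with hAdef
  have hk0 : 0 ≤ k := by positivity
  -- The potential energy is also given the factor `1 + t`, so that `hDU` applies to the combined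
  -- pair energy.
  have h1t : 1 ≤ ENNReal.ofReal (1 + t) := by
    rw [← ENNReal.ofReal_one]; exact ENNReal.ofReal_le_ofReal (by linarith)
  calc _ ≤ ENNReal.ofReal μ * (N * (ENNReal.ofReal (1 + 1 / t) * ENNReal.ofReal (γ / (L ^ 3 * q)) +
          ENNReal.ofReal (1 + t) * (n * (D / A) + n * (n * ENNReal.ofReal k)))) +
        ENNReal.ofReal (1 + t) * (N * n / 2 * (U / A)) := by
        exact add_le_add_right (le_mul_of_one_le_left zero_le h1t) _
    _ = N * (ENNReal.ofReal μ * (ENNReal.ofReal (1 + 1 / t) * ENNReal.ofReal (γ / (L ^ 3 * q))) +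
          ENNReal.ofReal (1 + t) * (n * ((ENNReal.ofReal μ * D + U / 2) / A) +
            n * (n * (ENNReal.ofReal μ * ENNReal.ofReal k)))) := by
        simp only [div_eq_mul_inv]
        generalize A⁻¹ = A'
        ring
    _ ≤ N * (ENNReal.ofReal μ * (ENNReal.ofReal (1 + 1 / t) * ENNReal.ofReal (γ / (L ^ 3 * q))) +
          ENNReal.ofReal (1 + t) * (n * (ENNReal.ofReal
            (4 * Real.pi * μ * (a / (1 - a / b)) / (1 - t) ^ 2) / A) +
            n * (n * (ENNReal.ofReal μ * ENNReal.ofReal k)))) := by gcongr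
    _ = _ := by
        rw [hAdef, ← ENNReal.ofReal_div_of_pos hAp, ← ENNReal.ofReal_natCast n]
        have : 0 ≤ 4 * Real.pi * μ * (a / (1 - a / b)) / (1 - t) ^ 2 / (L ^ 3 * q) := by positivity
        have h1 : 0 ≤ 1 + 1 / t := by positivity
        have h2 : 0 ≤ 1 + t := by positivity
        have h3 : 0 ≤ γ / (L ^ 3 * q) := by positivity
        rw [← hqdef]
        generalize 4 * Real.pi * μ * (a / (1 - a / b)) / (1 - t) ^ 2 / (L ^ 3 * q) = m at this ⊢
        generalize 1 + 1 / t = s at h1 ⊢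
        generalize 1 + t = s' at h2 ⊢
        generalize γ / (L ^ 3 * q) = r at h3 ⊢
        have hn0 : (0 : ℝ) ≤ n := Nat.cast_nonneg n
        generalize (n : ℝ) = n' at hn0 ⊢
        rw [ENNReal.ofReal_add (by positivity) (by positivity), ENNReal.ofReal_mul h2,
          ENNReal.ofReal_add (by positivity) (by positivity)]
        simp only [ENNReal.ofReal_mul hμ.le, ENNReal.ofReal_mul h1, ENNReal.ofReal_mul hn0]

/-! ### Dirichlet and Neumann boundary conditions -/

/-- A cutoff function vanishing outside the cube, at distance at most `δ` from `1`. -/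
noncomputable def cutoff (L δ : ℝ) (y : Space) : ℝ := min 1 (Metric.infDist y (cube L)ᶜ / δ)

theorem cutoff_nonneg (L : ℝ) {δ : ℝ} (hδ : 0 < δ) (y : Space) : 0 ≤ cutoff L δ y :=
  le_min zero_le_one (div_nonneg Metric.infDist_nonneg hδ.le)

theorem lipschitzWith_cutoff (L : ℝ) {δ : ℝ} (hδ : 0 < δ) :
    LipschitzWith (Real.toNNReal δ⁻¹) (cutoff L δ) := by
  have h1 : LipschitzWith (Real.toNNReal δ⁻¹) fun y => Metric.infDist y (cube L)ᶜ / δ := by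
    refine LipschitzWith.of_dist_le_mul fun y z => ?_
    rw [Real.dist_eq, ← sub_div, abs_div, abs_of_pos hδ, Real.coe_toNNReal _ (by positivity),
      inv_mul_eq_div]
    gcongr
    have := (Metric.lipschitz_infDist_pt (cube L)ᶜ).dist_le_mul y z
    rwa [Real.dist_eq, NNReal.coe_one, one_mul] at this
  exact h1.const_min 1

theorem isLipOne_cutoff (L : ℝ) {δ : ℝ} (hδ : 0 < δ) : IsLipOne (cutoff L δ) :=
  ⟨⟨_, lipschitzWith_cutoff L hδ⟩, fun y => by
    rw [abs_of_nonneg (cutoff_nonneg L hδ y)]; exact min_le_left _ _⟩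

theorem cutoff_eq_zero {L : ℝ} (δ : ℝ) {y : Space} (hy : y ∉ cube L) : cutoff L δ y = 0 := by
  rw [cutoff, Metric.infDist_zero_of_mem (show y ∈ (cube L)ᶜ from hy), zero_div]
  exact min_eq_right zero_le_one

theorem cutoff_eq_one {L δ : ℝ} (hδ : 0 < δ) {y : Space} (hy : ∀ k, y k ∈ Ioo δ (L - δ)) :
    cutoff L δ y = 1 := by
  refine min_eq_left ((one_le_div hδ).2 ?_)
  refine (Metric.le_infDist (show ((cube L)ᶜ).Nonempty from
    ⟨0, fun h => (lt_irrefl (0 : ℝ)) (h 0).1⟩)).2 fun z hz => ?_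
  obtain ⟨k, hk⟩ : ∃ k, z k ∉ Ioo 0 L := by simpa [cube] using hz
  have h1 : |y k - z k| ≤ dist y z := by
    rw [dist_eq_norm, ← Real.norm_eq_abs]
    exact PiLp.norm_apply_le (y - z) k
  refine le_trans ?_ h1
  have := hy k
  by_cases h0 : 0 < z k
  · have h2 : L ≤ z k := not_lt.1 fun h => hk ⟨h0, h⟩
    exact le_trans (by linarith [this.2]) (neg_le_abs _)
  · exact le_trans (by linarith [this.1, not_lt.1 h0]) (le_abs_self _)

theorem lintegral_enorm_fderiv_cutoff_le {L δ : ℝ} (hL : 0 < L) (hδ : 0 < δ) :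
    ∫⁻ y in cube L, ‖fderiv ℝ (cutoff L δ) y‖ₑ ^ 2 ≤ ENNReal.ofReal (L ^ 3 / δ ^ 2) := by
  calc _ ≤ ∫⁻ _ in cube L, ENNReal.ofReal δ⁻¹ ^ 2 := by
        refine lintegral_mono fun y => ?_
        gcongr
        rw [← ofReal_norm]
        refine ENNReal.ofReal_le_ofReal ?_
        have := norm_fderiv_le_of_lipschitz ℝ (x₀ := y) (lipschitzWith_cutoff L hδ)
        rwa [Real.coe_toNNReal _ (by positivity)] at this
    _ = _ := by
        rw [setLIntegral_const, volume_cube, ← ENNReal.ofReal_pow hL.le,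
          ← ENNReal.ofReal_pow (by positivity), ← ENNReal.ofReal_mul (by positivity)]
        congr 1
        field_simp

/-- The cutoff is 1 on a concentric cube of side `(1 - 2t) L`, and `(1 - 2t)³ ≥ 1 - 6t`. -/
theorem le_lintegral_cutoff_sq {L t : ℝ} (hL : 0 < L) (ht : 0 < t) (ht' : 2 * t ≤ 1) :
    ENNReal.ofReal (L ^ 3 * (1 - 6 * t)) ≤ ∫⁻ y in cube L, ‖cutoff L (t * L) y‖ₑ ^ 2 := by
  set s : Set Space := {y | ∀ k, y k ∈ Ioo (t * L) (L - t * L)} with hs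
  have hsL : s ⊆ cube L := fun y hy k => ⟨by linarith [(hy k).1, mul_pos ht hL], by
    linarith [(hy k).2, mul_pos ht hL]⟩
  have hsm : MeasurableSet s := by
    have : s = ⋂ k, (fun y : Space => y k) ⁻¹' Ioo (t * L) (L - t * L) := by ext; simp [hs]
    rw [this]
    exact MeasurableSet.iInter fun k => (show Measurable fun y : Space => y k by fun_prop)
      measurableSet_Ioo
  calc _ ≤ volume s := by
        have h2 : 0 ≤ L - t * L - t * L := by nlinarith
        rw [volume_setOf_mem_Ioo, ← ENNReal.ofReal_pow h2]
        refine ENNReal.ofReal_le_ofReal ?_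
        have : (L - t * L - t * L) ^ 3 = L ^ 3 * (1 - 2 * t) ^ 3 := by ring
        rw [this]
        gcongr
        nlinarith [sq_nonneg t, mul_nonneg (sq_nonneg t) (by linarith : 0 ≤ 1 - 2 * t)]
    _ = ∫⁻ _ in s, 1 := by simp
    _ ≤ ∫⁻ y in s, ‖cutoff L (t * L) y‖ₑ ^ 2 := by
        refine setLIntegral_mono' hsm fun y hy => ?_
        rw [cutoff_eq_one (by positivity) hy]
        simp
    _ ≤ _ := lintegral_mono_set hsL

namespace IsProfile

variable {μ : ℝ} {v : ℝ → ℝ≥0∞} {a b τ : ℝ} {f g : ℝ → ℝ}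

theorem isLipOne (hf : IsProfile μ v a b τ f g) : IsLipOne fun z : Space => f ‖z‖ := by
  obtain ⟨C, hC⟩ := hf.lipschitz
  refine ⟨⟨C * 1, hC.comp lipschitzWith_one_norm⟩, fun z => ?_⟩
  rw [abs_of_nonneg (hf.nonneg _)]
  exact hf.le_one _

theorem enorm_sq (_hf : IsProfile μ v a b τ f g) (r : ℝ) :
    ‖f r‖ₑ ^ 2 = ENNReal.ofReal (f r ^ 2) := by
  rw [enorm_sq_eq_ofReal, Real.norm_eq_abs, sq_abs]

theorem one_sub_enorm_sq (hf : IsProfile μ v a b τ f g) (r : ℝ) :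
    1 - ‖f r‖ₑ ^ 2 = ENNReal.ofReal (1 - f r ^ 2) := by
  rw [hf.enorm_sq, ENNReal.ofReal_sub _ (sq_nonneg _), ENNReal.ofReal_one]

theorem energy_add_le (hf : IsProfile μ v a b τ f g) (hμ : 0 < μ) (hv : Measurable v) :
    ENNReal.ofReal μ * (∫⁻ z : Space, ‖fderiv ℝ (fun z : Space => f ‖z‖) z‖ₑ ^ 2) +
      (∫⁻ z : Space, v ‖z‖ * ‖f ‖z‖‖ₑ ^ 2) / 2 ≤
    ENNReal.ofReal (4 * Real.pi * μ * (a / (1 - a / b)) / (1 - τ) ^ 2) := by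
  refine le_trans (le_of_eq ?_) (hf.lintegral_energy_le hμ hv)
  have m1 : Measurable fun z : Space => ‖fderiv ℝ (fun z : Space => f ‖z‖) z‖ₑ ^ 2 :=
    (measurable_fderiv ℝ _).enorm.pow_const 2
  have m2 : Measurable fun z : Space => v ‖z‖ * ‖f ‖z‖‖ₑ ^ 2 :=
    (hv.comp measurable_norm).mul
      ((hf.continuous.measurable.comp measurable_norm).enorm.pow_const 2)
  rw [lintegral_add_left (m1.const_mul _), lintegral_const_mul _ m1]
  simp only [← hf.enorm_sq, div_eq_mul_inv]
  rw [lintegral_mul_const _ m2]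

end IsProfile

theorem IsScatteringLength.nonneg {μ : ℝ} {v : ℝ → ℝ≥0∞} {a : ℝ} (h : IsScatteringLength μ v a)
    (hμ : 0 < μ) : 0 ≤ a := by
  obtain ⟨r₀, u, u', hu, ha⟩ := h
  exact hu.scatteringLength_nonneg ha hμ

theorem IsScatteringLength.exists_profile {μ : ℝ} {v : ℝ → ℝ≥0∞} {a : ℝ}
    (h : IsScatteringLength μ v a) (hμ : 0 < μ) (hv : Measurable v) {b τ : ℝ} (hab : a < b)
    (hτ : 0 < τ) (hτ1 : τ < 1) : ∃ f g, IsProfile μ v a b τ f g := by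
  obtain ⟨r₀, u, u', hu, ha⟩ := h
  exact hu.exists_profile hμ hv ha hab hτ hτ1

/-- The wall layer has width `tL`, proportional to the box; its gradient energy then scales as
`1/L²` with a coefficient depending only on `t` and `a/b`. -/
theorem groundStateEnergy_dirichlet_div_le {μ : ℝ} {v : ℝ → ℝ≥0∞} {N : ℕ} {L a b t : ℝ}
    (hμ : 0 < μ) (hv : Measurable v) (ha : IsScatteringLength μ v a) (hL : 0 < L) (hN : 1 ≤ N)
    (hab : a < b) (ht : 0 < t) (htq : 8 * t < 1 - a / b)
    (hnb : 4 * Real.pi / 3 * b ^ 3 * ((N - 1 : ℕ) : ℝ) ≤ L ^ 3) :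
    groundStateEnergy .dirichlet μ v N L / N ≤
      ENNReal.ofReal (3 * μ * a / b ^ 3 * jastrowFactor (a / b) t +
        μ * ((1 + 1 / t) / (t ^ 2 * (1 - a / b - 8 * t))) / L ^ 2) := by
  have ha0 := ha.nonneg hμ
  have hb := ha0.trans_lt hab
  have hx : 0 ≤ a / b := by positivity
  have hq : 1 - a / b - 8 * t ≠ 0 := by linarith
  have ht1 : t < 1 := by linarith
  obtain ⟨f, g, hf⟩ := ha.exists_profile hμ hv hab ht ht1
  have hδ : 0 < t * L := by positivity
  have hw := isLipOne_jastrow (N := N) (isLipOne_cutoff L hδ) hf.isLipOne Finset.univ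
  have key := groundStateEnergy_div_le_of_jastrow (bc := .dirichlet) (v := v) (h := fun z => f ‖z‖)
    hμ hL hN ha0 hab ht htq hnb (isLipOne_cutoff L hδ) hf.isLipOne (cutoff_nonneg L hδ)
    (fun y => hf.nonneg _) (fun y => by rw [norm_neg])
    (fun φ hφ i k => setIntegral_mul_fderiv_of_eq_zero hL hw
      (fun x => jastrow_nonneg (cutoff_nonneg L hδ) (fun _ _ => hf.nonneg _) _ x)
      (fun x hx => by
        obtain ⟨i, hi⟩ : ∃ i, x i ∉ cube L := by
          by_contra! h
          exact hx fun i k => h i k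
        rw [jastrow, Finset.prod_eq_zero (Finset.mem_univ i) (cutoff_eq_zero _ hi), zero_mul])
      hφ.1 _)
    (hv.comp (by fun_prop : Measurable fun p : Space × Space => ‖p.1 - p.2‖))
    (γ := L ^ 3 / (t * L) ^ 2) (by positivity)
    (fun z => (lintegral_comp_sub_le (F := fun z => 1 - ‖f ‖z‖‖ₑ ^ 2) _ z).trans (by
      simp only [hf.one_sub_enorm_sq]
      exact hf.lintegral_one_sub_sq_le ha0 hab ht))
    (fun z => lintegral_comp_sub_le
      (F := fun z => ‖fderiv ℝ (fun z : Space => f ‖z‖) z‖ₑ ^ 2) _ z)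
    (fun z => lintegral_comp_sub_le (F := fun z => v ‖z‖ * ‖f ‖z‖‖ₑ ^ 2) _ z)
    (hf.energy_add_le hμ hv)
    (fun z => (lintegral_comp_sub_le
      (F := fun z => ‖f ‖z‖‖ₑ * ‖fderiv ℝ (fun z : Space => f ‖z‖) z‖ₑ) _ z).trans (by
        simp only [Real.enorm_of_nonneg (hf.nonneg _)]
        exact hf.lintegral_mul_deriv_le ha0 hab ht1))
    (lintegral_enorm_fderiv_cutoff_le hL hδ) (le_lintegral_cutoff_sq hL ht (by linarith))
  refine key.trans_eq ?_
  congr 2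
  field_simp

/-- The Neumann condition tests against fewer functions, so every Dirichlet state is a Neumann state
with the same energy. -/
theorem groundStateEnergy_neumann_le (μ : ℝ) (v : ℝ → ℝ≥0∞) (N : ℕ) (L : ℝ) :
    groundStateEnergy .neumann μ v N L ≤ groundStateEnergy .dirichlet μ v N L :=
  le_iInf fun Ψ => le_iInf fun G => le_iInf fun h => (iInf_le_of_le Ψ <| iInf_le_of_le G <|
    iInf_le_of_le ⟨h.memLp, h.memLp_gradient, fun φ hφ => h.isWeakGradient φ ⟨hφ.1, trivial⟩,
      h.symmetric, h.normalised⟩ le_rfl)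

/-! ### Periodic boundary conditions -/

section Torus

variable {L : ℝ}

theorem latticeVec_apply (L : ℝ) (n : Fin 3 → ℤ) (k : Fin 3) : latticeVec L n k = L * n k := rfl

theorem latticeVec_zero (L : ℝ) : latticeVec L 0 = 0 := by
  ext k; simp [latticeVec_apply]

theorem latticeVec_neg (L : ℝ) (n : Fin 3 → ℤ) : latticeVec L (-n) = -latticeVec L n := by
  ext k; simp [latticeVec_apply]

theorem latticeVec_add (L : ℝ) (m n : Fin 3 → ℤ) :
    latticeVec L (m + n) = latticeVec L m + latticeVec L n := by
  ext k; simp [latticeVec_apply, mul_add]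

theorem latticeVec_single (L : ℝ) (k : Fin 3) :
    latticeVec L (Pi.single k 1) = L • EuclideanSpace.single k 1 := by
  ext j
  by_cases hj : j = k
  · subst hj; simp [latticeVec_apply]
  · simp [latticeVec_apply, hj]

theorem finite_setOf_norm_add_latticeVec_le (hL : 0 < L) (z : Space) (R : ℝ) :
    {n : Fin 3 → ℤ | ‖z + latticeVec L n‖ ≤ R}.Finite := by
  refine (Set.Finite.pi' fun _ : Fin 3 =>
    Set.finite_Icc ⌊-((R + ‖z‖) / L)⌋ ⌈(R + ‖z‖) / L⌉).subset fun n hn k => ?_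
  have h1 : ‖latticeVec L n‖ ≤ R + ‖z‖ := by
    have := norm_sub_le (z + latticeVec L n) z
    rw [add_sub_cancel_left] at this
    exact this.trans (by gcongr; exact hn)
  have h2 : |L * n k| ≤ R + ‖z‖ := by
    rw [← latticeVec_apply, ← Real.norm_eq_abs]
    exact (PiLp.norm_apply_le _ k).trans h1
  rw [abs_mul, abs_of_pos hL, mul_comm, ← le_div_iff₀ hL, abs_le] at h2
  exact ⟨by exact_mod_cast (Int.floor_le _).trans h2.1, by
    exact_mod_cast h2.2.trans (Int.le_ceil _)⟩

theorem torusDist_le (L : ℝ) (x y : Space) (n : Fin 3 → ℤ) :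
    torusDist L x y ≤ ‖x - y + latticeVec L n‖ :=
  ciInf_le ⟨0, by rintro _ ⟨n, rfl⟩; exact norm_nonneg _⟩ n

theorem exists_torusDist_eq (hL : 0 < L) (x y : Space) :
    ∃ n, torusDist L x y = ‖x - y + latticeVec L n‖ := by
  obtain ⟨n, hn, hmin⟩ := Set.exists_min_image _ (fun n => ‖x - y + latticeVec L n‖)
    (finite_setOf_norm_add_latticeVec_le hL (x - y) ‖x - y‖)
    ⟨0, by simp [latticeVec_zero]⟩
  refine ⟨n, le_antisymm (torusDist_le L x y n) (le_ciInf fun m => ?_)⟩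
  by_cases hm : ‖x - y + latticeVec L m‖ ≤ ‖x - y‖
  · exact hmin m hm
  · exact (show ‖x - y + latticeVec L n‖ ≤ ‖x - y‖ from hn).trans (not_le.1 hm).le

theorem lipschitzWith_torusDist (hL : 0 < L) : LipschitzWith 1 fun z => torusDist L z 0 := by
  refine LipschitzWith.of_le_add fun z w => ?_
  obtain ⟨n, hn⟩ := exists_torusDist_eq hL w 0
  refine (torusDist_le L z 0 n).trans ?_
  rw [hn, dist_eq_norm, sub_zero, sub_zero]
  calc _ = ‖(w + latticeVec L n) + (z - w)‖ := by congr 1; abel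
    _ ≤ _ := norm_add_le _ _

theorem torusDist_neg (L : ℝ) (z : Space) : torusDist L (-z) 0 = torusDist L z 0 := by
  refine (Equiv.neg (Fin 3 → ℤ)).iInf_congr fun n => ?_
  rw [Equiv.neg_apply, latticeVec_neg, ← norm_neg, sub_zero, sub_zero]
  congr 1
  abel

theorem torusDist_add_latticeVec (L : ℝ) (z : Space) (m : Fin 3 → ℤ) :
    torusDist L (z + latticeVec L m) 0 = torusDist L z 0 := by
  refine (Equiv.addLeft m).iInf_congr fun n => ?_
  rw [Equiv.coe_addLeft, latticeVec_add, sub_zero, sub_zero, add_assoc]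

/-- Lattice translates of the open cube are disjoint, so the sum over images unfolds into an
integral over part of `ℝ³`. -/
theorem lintegral_tsum_add_latticeVec_le (hL : 0 < L) {F : Space → ℝ≥0∞} (hF : Measurable F)
    (z : Space) : ∫⁻ y in cube L, ∑' n, F (y - z + latticeVec L n) ≤ ∫⁻ y, F y := by
  set s : (Fin 3 → ℤ) → Set Space := fun n => (fun y => y - latticeVec L n) ⁻¹' cube L with hs
  have hsm : ∀ n, MeasurableSet (s n) := fun n =>
    (isOpen_cube L).measurableSet.preimage (by fun_prop)
  have hsd : Pairwise (Function.onFun Disjoint s) := by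
    have h1 : ∀ m n y, y ∈ s m → y ∈ s n → ∀ k, m k ≤ n k := fun m n y hm hn k => by
      have h2 : 0 < y k - L * m k := (hm k).1
      have h3 : y k - L * n k < L := (hn k).2
      have h4 : L * m k < L * (n k + 1) := by linarith
      have h5 : (m k : ℝ) < n k + 1 := lt_of_mul_lt_mul_left h4 hL.le
      exact Int.lt_add_one_iff.1 (by exact_mod_cast h5)
    intro m n hmn
    refine Set.disjoint_left.2 fun y hm hn => hmn (funext fun k => ?_)
    exact le_antisymm (h1 m n y hm hn k) (h1 n m y hn hm k)
  have e : ∀ n, ∫⁻ y in cube L, F (y - z + latticeVec L n) = ∫⁻ y in s n, F (y - z) := fun n => by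
    have h1 := (measurePreserving_sub_right (volume : Measure Space) (latticeVec L n)).setLIntegral_comp_preimage
      (isOpen_cube L).measurableSet (f := fun y => F (y - z + latticeVec L n))
      (hF.comp (by fun_prop))
    rw [← h1]
    refine lintegral_congr fun y => ?_
    congr 1
    abel
  have hFm : ∀ n, Measurable fun y => F (y - z + latticeVec L n) := fun n =>
    hF.comp (by fun_prop : Measurable fun y : Space => y - z + latticeVec L n)
  rw [lintegral_tsum fun n => (hFm n).aemeasurable]
  simp only [e]
  rw [← lintegral_iUnion hsm hsd]
  exact lintegral_comp_sub_le _ z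

end Torus

/-- The direct and nearest-image interactions are single terms of the sum over images, so the summed
interaction dominates both. -/
theorem groundStateEnergy_periodic_le {μ : ℝ} {v : ℝ → ℝ≥0∞} {N : ℕ} {L : ℝ} (hL : 0 < L)
    (c : ImageConvention) :
    groundStateEnergy (.periodic c) μ v N L ≤ groundStateEnergy (.periodic .sum) μ v N L := by
  have h1 : ∀ x y, pairPotential (.periodic c) v L x y ≤ pairPotential (.periodic .sum) v L x y := by
    intro x y
    cases c with
    | direct =>
      refine le_trans (le_of_eq ?_) (ENNReal.le_tsum (0 : Fin 3 → ℤ))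
      rw [latticeVec_zero, add_zero]
      rfl
    | nearest =>
      obtain ⟨n, hn⟩ := exists_torusDist_eq hL x y
      refine le_trans (le_of_eq ?_) (ENNReal.le_tsum n)
      rw [← hn]
      rfl
    | sum => exact le_rfl
  refine le_iInf fun Ψ => le_iInf fun G => le_iInf fun h => iInf_le_of_le Ψ <| iInf_le_of_le G <|
    iInf_le_of_le ⟨h.memLp, h.memLp_gradient, fun φ hφ => h.isWeakGradient φ ⟨hφ.1, hφ.2⟩,
      h.symmetric, h.normalised⟩ ?_
  refine add_le_add_right (lintegral_mono fun x => ?_) _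
  gcongr
  exact h1 _ _

namespace IsProfile

variable {μ : ℝ} {v : ℝ → ℝ≥0∞} {a b τ L : ℝ} {f g : ℝ → ℝ}

theorem isLipOne_torus (hf : IsProfile μ v a b τ f g) (hL : 0 < L) :
    IsLipOne fun z => f (torusDist L z 0) := by
  obtain ⟨C, hC⟩ := hf.lipschitz
  refine ⟨⟨C * 1, hC.comp (lipschitzWith_torusDist hL)⟩, fun z => ?_⟩
  rw [abs_of_nonneg (hf.nonneg _)]
  exact hf.le_one _

theorem le_norm_add_latticeVec (hf : IsProfile μ v a b τ f g) (z : Space) (n : Fin 3 → ℤ) :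
    f (torusDist L z 0) ≤ f ‖z + latticeVec L n‖ := by
  refine hf.mono ?_
  have := torusDist_le L z 0 n
  rwa [sub_zero] at this

/-- As `f` is increasing, `f` of the torus distance lies below every image `f ‖z + L n‖` and equals
the one with the nearest image. The difference has a minimum at `z`, so the gradients agree wherever
both exist. Periodic pair integrals then reduce to integrals over `ℝ³`, with no condition relating
`b` to `L`. -/
theorem exists_torus_eq (hf : IsProfile μ v a b τ f g) (hL : 0 < L) :
    ∀ᵐ z : Space, ∃ n, f (torusDist L z 0) = f ‖z + latticeVec L n‖ ∧
      ‖fderiv ℝ (fun z => f (torusDist L z 0)) z‖ₑ =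
        ‖fderiv ℝ (fun z : Space => f ‖z‖) (z + latticeVec L n)‖ₑ := by
  obtain ⟨⟨C, hC⟩, -⟩ := hf.isLipOne_torus hL
  obtain ⟨⟨C', hC'⟩, -⟩ := hf.isLipOne
  have h1 : ∀ᵐ z : Space, ∀ n, DifferentiableAt ℝ (fun z : Space => f ‖z‖) (z + latticeVec L n) :=
    ae_all_iff.2 fun n => (measurePreserving_add_right (volume : Measure Space)
      (latticeVec L n)).quasiMeasurePreserving.ae hC'.ae_differentiableAt
  filter_upwards [h1, hC.ae_differentiableAt] with z hz hz'
  obtain ⟨n, hn⟩ := exists_torusDist_eq hL z 0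
  rw [sub_zero] at hn
  refine ⟨n, by rw [hn], ?_⟩
  have h2 : DifferentiableAt ℝ (fun z : Space => f ‖z + latticeVec L n‖) z :=
    (differentiableAt_comp_add_right (f := fun z : Space => f ‖z‖) (latticeVec L n)).2 (hz n)
  have h3 : IsLocalMin (fun z => f ‖z + latticeVec L n‖ - f (torusDist L z 0)) z :=
    Eventually.of_forall fun w => by
      simp only [hn, sub_self]
      exact sub_nonneg.2 (hf.le_norm_add_latticeVec w n)
  have h4 := h3.fderiv_eq_zero
  rw [fderiv_fun_sub h2 hz', sub_eq_zero] at h4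
  rw [← h4, ← fderiv_comp_add_right]

theorem lintegral_torus_le (hf : IsProfile μ v a b τ f g) (hL : 0 < L) {F G : Space → ℝ≥0∞}
    (hG : Measurable G) (hFG : ∀ z, (∃ n, f (torusDist L z 0) = f ‖z + latticeVec L n‖ ∧
      ‖fderiv ℝ (fun z => f (torusDist L z 0)) z‖ₑ =
        ‖fderiv ℝ (fun z : Space => f ‖z‖) (z + latticeVec L n)‖ₑ) →
      F z ≤ ∑' n, G (z + latticeVec L n)) (z : Space) :
    ∫⁻ y in cube L, F (y - z) ≤ ∫⁻ y, G y := by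
  refine le_trans (lintegral_mono_ae (ae_restrict_of_ae ?_))
    (lintegral_tsum_add_latticeVec_le hL hG z)
  filter_upwards [(measurePreserving_sub_right (volume : Measure Space)
    z).quasiMeasurePreserving.ae (hf.exists_torus_eq hL)] with y hy
  exact hFG _ hy

end IsProfile

theorem jastrow_add_unitVec {N : ℕ} {L : ℝ} {h : Space → ℝ}
    (hper : ∀ z k, h (z + L • EuclideanSpace.single k 1) = h z) (S : Finset (Fin N)) (i : Fin N)
    (k : Fin 3) (x : Config N) :
    jastrow (fun _ => 1) (fun y z => h (y - z)) S (x + L • unitVec i k) =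
      jastrow (fun _ => 1) (fun y z => h (y - z)) S x := by
  have hper' : ∀ z k, h (z - L • EuclideanSpace.single k 1) = h z := fun z k => by
    rw [← hper, sub_add_cancel]
  have h1 : ∀ j l, h ((x + L • unitVec i k) j - (x + L • unitVec i k) l) = h (x j - x l) := by
    intro j l
    simp only [unitVec, Pi.add_apply, Pi.smul_apply]
    by_cases hj : j = i <;> by_cases hl : l = i
    · rw [hj, hl, sub_self, sub_self]
    · subst hj
      rw [Pi.single_eq_same, Pi.single_eq_of_ne hl, smul_zero, add_zero, add_sub_right_comm, hper]
    · subst hl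
      rw [Pi.single_eq_same, Pi.single_eq_of_ne hj, smul_zero, add_zero, ← sub_sub, hper']
    · rw [Pi.single_eq_of_ne hj, Pi.single_eq_of_ne hl, smul_zero, add_zero, add_zero]
  simp only [jastrow, h1]

theorem groundStateEnergy_periodic_div_le {μ : ℝ} {v : ℝ → ℝ≥0∞} {N : ℕ} {L a b t : ℝ}
    (hμ : 0 < μ) (hv : Measurable v) (ha : IsScatteringLength μ v a) (hL : 0 < L) (hN : 1 ≤ N)
    (hab : a < b) (ht : 0 < t) (htq : 8 * t < 1 - a / b)
    (hnb : 4 * Real.pi / 3 * b ^ 3 * ((N - 1 : ℕ) : ℝ) ≤ L ^ 3) (c : ImageConvention) :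
    groundStateEnergy (.periodic c) μ v N L / N ≤
      ENNReal.ofReal (3 * μ * a / b ^ 3 * jastrowFactor (a / b) t) := by
  refine le_trans (ENNReal.div_le_div_right (groundStateEnergy_periodic_le hL c) _) ?_
  have ha0 := ha.nonneg hμ
  have hb := ha0.trans_lt hab
  have hx : 0 ≤ a / b := by positivity
  have ht1 : t < 1 := by linarith
  obtain ⟨f, g, hf⟩ := ha.exists_profile hμ hv hab ht ht1
  have hh := hf.isLipOne_torus hL
  have hw := isLipOne_jastrow (N := N) IsLipOne.one hh Finset.univ
  have hfm : Measurable fun z : Space => ‖f ‖z‖‖ₑ :=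
    (hf.continuous.measurable.comp measurable_norm).enorm
  have hdm : Measurable fun z : Space => ‖fderiv ℝ (fun z : Space => f ‖z‖) z‖ₑ :=
    (measurable_fderiv ℝ _).enorm
  have hvm : Measurable fun z : Space => v ‖z‖ := hv.comp measurable_norm
  set h : Space → ℝ := fun z => f (torusDist L z 0) with hh_def
  have hweak : ∀ φ : Config N → ℝ, IsTestFunction (.periodic .sum) L φ → ∀ i k,
      ∫ x in box N L, jastrow (fun _ => 1) (fun y z => h (y - z)) Finset.univ x *
          fderiv ℝ φ x (unitVec i k) =
        -∫ x in box N L, fderiv ℝ (jastrow (fun _ => 1) (fun y z => h (y - z)) Finset.univ) x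
          (unitVec i k) * φ x := fun φ hφ i k =>
    setIntegral_mul_fderiv_of_periodic hL hw
      (jastrow_add_unitVec (fun z k => by
        rw [hh_def, ← latticeVec_single]; exact congrArg f (torusDist_add_latticeVec L z _)) _ i k)
      hφ.1 (hφ.2 i k)
  have hpair : Measurable (Function.uncurry (pairPotential (.periodic .sum) v L)) :=
    Measurable.tsum fun n => hv.comp
      (by fun_prop : Measurable fun p : Space × Space => ‖p.1 - p.2 + latticeVec L n‖)
  have hI : ∀ z, ∫⁻ y in cube L, (1 - ‖h (y - z)‖ₑ ^ 2) ≤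
      ENNReal.ofReal (4 * Real.pi / 3 * b ^ 3 * (a / b + 2 * t)) := fun z => by
    refine (hf.lintegral_torus_le hL (F := fun z => 1 - ‖h z‖ₑ ^ 2)
      (G := fun z => 1 - ‖f ‖z‖‖ₑ ^ 2) (measurable_const.sub (hfm.pow_const 2)) ?_ z).trans ?_
    · rintro z ⟨n, h1, -⟩
      simp only [hh_def]
      rw [h1]
      exact ENNReal.le_tsum (f := fun n => 1 - ‖f ‖z + latticeVec L n‖‖ₑ ^ 2) n
    · simp only [hf.one_sub_enorm_sq]
      exact hf.lintegral_one_sub_sq_le ha0 hab ht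
  have hD : ∀ z, ∫⁻ y in cube L, ‖fderiv ℝ h (y - z)‖ₑ ^ 2 ≤
      ∫⁻ z : Space, ‖fderiv ℝ (fun z : Space => f ‖z‖) z‖ₑ ^ 2 := fun z => by
    refine hf.lintegral_torus_le hL (F := fun z => ‖fderiv ℝ h z‖ₑ ^ 2) (hdm.pow_const 2) ?_ z
    rintro z ⟨n, -, h1⟩
    simp only [hh_def]
    rw [h1]
    exact ENNReal.le_tsum
      (f := fun n => ‖fderiv ℝ (fun z : Space => f ‖z‖) (z + latticeVec L n)‖ₑ ^ 2) n
  have hU : ∀ z, ∫⁻ y in cube L, pairPotential (.periodic .sum) v L y z * ‖h (y - z)‖ₑ ^ 2 ≤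
      ∫⁻ z : Space, v ‖z‖ * ‖f ‖z‖‖ₑ ^ 2 := fun z => by
    refine hf.lintegral_torus_le hL (F := fun z => (∑' n, v ‖z + latticeVec L n‖) * ‖h z‖ₑ ^ 2)
      (G := fun z : Space => v ‖z‖ * ‖f ‖z‖‖ₑ ^ 2) (hvm.mul (hfm.pow_const 2)) ?_ z
    -- Each image is bounded separately: the torus distance is the smallest image distance and `f`
    -- is increasing.
    rintro z -
    rw [← ENNReal.tsum_mul_right]
    refine ENNReal.tsum_le_tsum fun n => ?_
    rw [Real.enorm_of_nonneg (hf.nonneg _), Real.enorm_of_nonneg (hf.nonneg _)]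
    gcongr
    exact hf.le_norm_add_latticeVec z n
  have hK : ∀ z, ∫⁻ y in cube L, ‖h (y - z)‖ₑ * ‖fderiv ℝ h (y - z)‖ₑ ≤
      ENNReal.ofReal (4 * Real.pi * (a / (1 - a / b)) * b / (1 - t)) := fun z => by
    refine (hf.lintegral_torus_le hL (F := fun z => ‖h z‖ₑ * ‖fderiv ℝ h z‖ₑ)
      (G := fun z => ‖f ‖z‖‖ₑ * ‖fderiv ℝ (fun z : Space => f ‖z‖) z‖ₑ) (hfm.mul hdm) ?_ z).trans ?_
    · rintro z ⟨n, h1, h2⟩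
      simp only [hh_def]
      rw [h1, h2]
      exact ENNReal.le_tsum (f := fun n => ‖f ‖z + latticeVec L n‖‖ₑ *
          ‖fderiv ℝ (fun z : Space => f ‖z‖) (z + latticeVec L n)‖ₑ) n
    · simp only [Real.enorm_of_nonneg (hf.nonneg _)]
      exact hf.lintegral_mul_deriv_le ha0 hab ht1
  have hg2 : ENNReal.ofReal (L ^ 3 * (1 - 6 * t)) ≤
      ∫⁻ y in cube L, ‖(fun _ : Space => (1 : ℝ)) y‖ₑ ^ 2 := by
    simp only [enorm_one, one_pow, setLIntegral_const, volume_cube, one_mul]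
    rw [← ENNReal.ofReal_pow hL.le]
    exact ENNReal.ofReal_le_ofReal (mul_le_of_le_one_right (by positivity) (by linarith))
  have key := groundStateEnergy_div_le_of_jastrow (γ := 0) hμ hL hN ha0 hab ht htq hnb IsLipOne.one
    hh (fun _ => zero_le_one) (fun y => hf.nonneg _)
    (fun y => congrArg f (torusDist_neg L y)) hweak hpair le_rfl hI hD hU
    (hf.energy_add_le hμ hv) hK (by simp [enorm_zero (E := Space →L[ℝ] ℝ)]) hg2
  refine key.trans_eq ?_
  congr 1
  ring

/-! ### The upper bounds -/

/-- At `t = 0` the factor has numerator `(1 - x)⁶ + 3x(1 - x)³` over `(1 - x)⁸`, strictly below the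
target for `0 < x < 1`; continuity supplies a positive `t`. At `x = 0` the gap closes, which is why
both sides carry a factor `x`. -/
theorem exists_mul_jastrowFactor_le {x : ℝ} (hx : 0 ≤ x) (hx1 : x < 1) :
    ∃ t, 0 < t ∧ 8 * t < 1 - x ∧
      x * jastrowFactor x t ≤ x * ((1 - x + x ^ 2 - x ^ 3 / 2) / (1 - x) ^ 8) := by
  rcases hx.eq_or_lt with rfl | hx0
  · exact ⟨1 / 16, by norm_num, by norm_num, by simp⟩
  have h1 : 0 < 1 - x := by linarith
  have hlt : jastrowFactor x 0 < (1 - x + x ^ 2 - x ^ 3 / 2) / (1 - x) ^ 8 := by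
    have e : jastrowFactor x 0 = ((1 - x) ^ 6 + 3 * x * (1 - x) ^ 3) / (1 - x) ^ 8 := by
      simp only [jastrowFactor, mul_zero, sub_zero, add_zero, one_pow, div_one, one_mul]
      field_simp
    rw [e]
    gcongr
    have h2 : 0 < 2 - 5 * x + 21 / 2 * x ^ 2 - 12 * x ^ 3 + 6 * x ^ 4 - x ^ 5 := by
      have e2 : 2 - 5 * x + 21 / 2 * x ^ 2 - 12 * x ^ 3 + 6 * x ^ 4 - x ^ 5 =
        5 * (x ^ 2 - 6 / 5 * x + 1 / 5) ^ 2 + 13 / 10 * (x - 1) ^ 2 + 1 / 2 + x ^ 4 * (1 - x) := by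
        ring
      rw [e2]
      positivity
    nlinarith [mul_pos hx0 h2]
  have hc : ContinuousAt (jastrowFactor x) 0 := by
    have h2 : (1 - (0 : ℝ)) ^ 2 ≠ 0 := by norm_num
    have h3 : (1 - x) * (1 - x - 8 * 0) ≠ 0 := by
      rw [mul_zero, sub_zero]; positivity
    have h4 : (1 - x) ^ 2 * (1 - x - 8 * 0) ^ 3 ≠ 0 := by
      rw [mul_zero, sub_zero]; positivity
    unfold jastrowFactor
    fun_prop (disch := assumption)
  have h2 : ∀ᶠ t in 𝓝[>] (0 : ℝ), jastrowFactor x t < (1 - x + x ^ 2 - x ^ 3 / 2) / (1 - x) ^ 8 :=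
    nhdsWithin_le_nhds (hc.eventually_lt_const hlt)
  have h3 : ∀ᶠ t in 𝓝[>] (0 : ℝ), t < (1 - x) / 8 :=
    nhdsWithin_le_nhds (eventually_lt_nhds (by positivity))
  obtain ⟨t, h2, h3, ht⟩ := (h2.and (h3.and self_mem_nhdsWithin)).exists
  exact ⟨t, ht, by linarith, by gcongr⟩

/-- The coefficient of `μ / L²` in the Jastrow bound with Dirichlet boundary conditions. -/
noncomputable def boundaryCoeff (x t : ℝ) : ℝ := (1 + 1 / t) / (t ^ 2 * (1 - x - 8 * t))

theorem boundaryCoeff_nonneg {x t : ℝ} (ht : 0 < t) (htq : 8 * t < 1 - x) :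
    0 ≤ boundaryCoeff x t := by
  have : 0 < 1 - x - 8 * t := by linarith
  unfold boundaryCoeff
  positivity

theorem groundStateEnergy_div_le {μ : ℝ} {v : ℝ → ℝ≥0∞} {N : ℕ} {L a b t : ℝ}
    (hμ : 0 < μ) (hv : Measurable v) (ha : IsScatteringLength μ v a) (hL : 0 < L) (hN : 1 ≤ N)
    (hab : a < b) (ht : 0 < t) (htq : 8 * t < 1 - a / b)
    (hnb : 4 * Real.pi / 3 * b ^ 3 * ((N - 1 : ℕ) : ℝ) ≤ L ^ 3) (bc : BoundaryCondition) :
    groundStateEnergy bc μ v N L / N ≤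
      ENNReal.ofReal (3 * μ * a / b ^ 3 * jastrowFactor (a / b) t +
        μ * boundaryCoeff (a / b) t / L ^ 2) := by
  have hd := groundStateEnergy_dirichlet_div_le hμ hv ha hL hN hab ht htq hnb
  cases bc with
  | dirichlet => exact hd
  | neumann => exact (ENNReal.div_le_div_right (groundStateEnergy_neumann_le μ v N L) _).trans hd
  | periodic c =>
    refine (groundStateEnergy_periodic_div_le hμ hv ha hL hN hab ht htq hnb c).trans
      (ENNReal.ofReal_le_ofReal ?_)
    have := boundaryCoeff_nonneg ht htq
    exact le_add_of_nonneg_right (by positivity)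

theorem mul_jastrowFactor_le {μ a b t T : ℝ} (hμ : 0 < μ) (hb : 0 < b)
    (h : a / b * jastrowFactor (a / b) t ≤ a / b * T) :
    3 * μ * a / b ^ 3 * jastrowFactor (a / b) t ≤ 3 * μ * a / b ^ 3 * T := by
  have e : ∀ s, 3 * μ * a / b ^ 3 * s = 3 * μ / b ^ 2 * (a / b * s) := fun s => by
    field_simp
  rw [e, e]
  gcongr

theorem rpow_neg_third_pow {c : ℝ} (hc : 0 < c) : (c ^ (-(1 / 3) : ℝ)) ^ 3 = c⁻¹ := by
  rw [← Real.rpow_natCast, ← Real.rpow_mul hc.le]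
  norm_num
  exact Real.rpow_neg_one c

theorem rhoOne_pos {N : ℕ} {L : ℝ} (hN : 2 ≤ N) (hL : 0 < L) : 0 < rhoOne N L := by
  have : (2 : ℝ) ≤ N := by exact_mod_cast hN
  exact div_pos (by linarith) (by positivity)

theorem bLength_pos {N : ℕ} {L : ℝ} (hN : 2 ≤ N) (hL : 0 < L) : 0 < bLength N L := by
  have := rhoOne_pos hN hL
  have := Real.pi_pos
  exact Real.rpow_pos_of_pos (by positivity) _

theorem bLength_pow {N : ℕ} {L : ℝ} (hN : 2 ≤ N) (hL : 0 < L) :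
    bLength N L ^ 3 = (4 * Real.pi * rhoOne N L / 3)⁻¹ := by
  have := rhoOne_pos hN hL
  have := Real.pi_pos
  exact rpow_neg_third_pow (by positivity)

theorem bLength_pow_mul {N : ℕ} {L : ℝ} (hN : 2 ≤ N) (hL : 0 < L) :
    4 * Real.pi / 3 * bLength N L ^ 3 * ((N - 1 : ℕ) : ℝ) = L ^ 3 := by
  have h1 : (2 : ℝ) ≤ N := by exact_mod_cast hN
  have h2 : (N : ℝ) - 1 ≠ 0 := by linarith
  have hpi := Real.pi_pos
  rw [bLength_pow hN hL, rhoOne, Nat.cast_sub (by omega), Nat.cast_one]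
  field_simp

/-- `3 / b³ = 4πρ₁`, and replacing `-x³/2` by `+x³/2` only increases the bound. -/
theorem jastrow_le_dysonBound {μ a t L : ℝ} {N : ℕ} (hμ : 0 < μ) (ha : 0 ≤ a) (hN : 2 ≤ N)
    (hL : 0 < L) (hab : a < bLength N L)
    (h : a / bLength N L * jastrowFactor (a / bLength N L) t ≤ a / bLength N L *
      ((1 - a / bLength N L + (a / bLength N L) ^ 2 - (a / bLength N L) ^ 3 / 2) /
        (1 - a / bLength N L) ^ 8)) :
    3 * μ * a / bLength N L ^ 3 * jastrowFactor (a / bLength N L) t ≤ dysonBound μ a N L := by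
  have hb := bLength_pos hN hL
  have hρ := rhoOne_pos hN hL
  have hpi := Real.pi_pos
  refine (mul_jastrowFactor_le hμ hb h).trans ?_
  have e : 3 * μ * a / bLength N L ^ 3 = 4 * Real.pi * μ * rhoOne N L * a := by
    rw [bLength_pow hN hL]
    field_simp
  have hx1 : 0 < 1 - a / bLength N L := sub_pos.2 ((div_lt_one hb).2 hab)
  have hx0 : 0 ≤ a / bLength N L := by positivity
  rw [e, dysonBound]
  gcongr
  have : 0 ≤ (a / bLength N L) ^ 3 := by positivity
  linarith

/-- Here `b` is fixed by `ρ` rather than `ρ₁`, so `N - 1` balls of radius `b` occupy slightly less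
than the box, and neither `b` nor `t` varies with `N`. The wall term tends to zero. -/
theorem energyPerParticle_le {μ : ℝ} {v : ℝ → ℝ≥0∞} {a ρ b t : ℝ} (hμ : 0 < μ) (hv : Measurable v)
    (ha : IsScatteringLength μ v a) (hρ : 0 < ρ) (hb : b ^ 3 = (4 * Real.pi * ρ / 3)⁻¹)
    (hab : a < b) (ht : 0 < t) (htq : 8 * t < 1 - a / b) (bc : BoundaryCondition) :
    energyPerParticle bc μ v ρ ≤ ENNReal.ofReal (3 * μ * a / b ^ 3 * jastrowFactor (a / b) t) := by
  have hpi := Real.pi_pos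
  set ℓ : ℕ → ℝ := fun N => (N / ρ) ^ (1 / 3 : ℝ) with hℓ
  have hℓt : Tendsto ℓ atTop atTop := (tendsto_rpow_atTop (by norm_num)).comp
    (tendsto_natCast_atTop_atTop.atTop_div_const hρ)
  have h1 : ∀ᶠ N : ℕ in atTop, groundStateEnergy bc μ v N (ℓ N) / N ≤
      ENNReal.ofReal (3 * μ * a / b ^ 3 * jastrowFactor (a / b) t +
        μ * boundaryCoeff (a / b) t / ℓ N ^ 2) := by
    filter_upwards [eventually_ge_atTop 1] with N hN
    have hN' : (1 : ℝ) ≤ N := by exact_mod_cast hN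
    have hNρ : 0 < N / ρ := by positivity
    refine groundStateEnergy_div_le hμ hv ha (Real.rpow_pos_of_pos hNρ _) hN hab ht htq ?_ bc
    have e : ℓ N ^ 3 = N / ρ := by
      rw [hℓ, ← Real.rpow_natCast, ← Real.rpow_mul hNρ.le]
      norm_num
    rw [e, hb, Nat.cast_sub hN, Nat.cast_one]
    have : 4 * Real.pi / 3 * (4 * Real.pi * ρ / 3)⁻¹ * ((N : ℝ) - 1) = ((N : ℝ) - 1) / ρ := by
      field_simp
    rw [this]
    gcongr
    linarith
  refine (limsup_le_limsup h1).trans (Tendsto.limsup_eq ?_).le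
  refine ENNReal.tendsto_ofReal ?_
  have h2 : Tendsto (fun N => μ * boundaryCoeff (a / b) t / ℓ N ^ 2) atTop (𝓝 0) :=
    ((tendsto_pow_atTop two_ne_zero).comp hℓt).const_div_atTop _
  simpa using h2.const_add (3 * μ * a / b ^ 3 * jastrowFactor (a / b) t)

end DiluteBose

theorem mainTheorem4 :
    -- periodic boundary conditions
    (∀ (μ : ℝ) (v : ℝ → ℝ≥0∞) (a : ℝ) (N : ℕ) (L : ℝ),
      0 < μ → Measurable v → IsScatteringLength μ v a → 2 ≤ N → 0 < L → a < bLength N L →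
      ∀ c : ImageConvention,
        groundStateEnergy (.periodic c) μ v N L / N ≤ ENNReal.ofReal (dysonBound μ a N L)) ∧
    -- Dirichlet boundary conditions
    (∃ C : ℝ → ℝ, ∀ (μ : ℝ) (v : ℝ → ℝ≥0∞) (a : ℝ) (N : ℕ) (L : ℝ),
      0 < μ → Measurable v → IsScatteringLength μ v a → 2 ≤ N → 0 < L → a < bLength N L →
        groundStateEnergy .dirichlet μ v N L / N ≤
          ENNReal.ofReal (dysonBound μ a N L + μ * C (a / bLength N L) / L ^ 2)) ∧
    -- thermodynamic limit, all boundary conditions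
    (∀ (μ : ℝ) (v : ℝ → ℝ≥0∞) (a ρ Y : ℝ),
      0 < μ → Measurable v → IsScatteringLength μ v a → 0 < ρ →
      Y = 4 * Real.pi * ρ * a ^ 3 / 3 → Y < 1 →
      ∀ bc : BoundaryCondition,
        energyPerParticle bc μ v ρ ≤
          ENNReal.ofReal (4 * Real.pi * μ * ρ * a *
            ((1 - Y ^ (1 / 3 : ℝ) + Y ^ (2 / 3 : ℝ) - Y / 2) / (1 - Y ^ (1 / 3 : ℝ)) ^ 8))) := by
  have hpi := Real.pi_pos
  refine ⟨?_, ?_, ?_⟩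
  · intro μ v a N L hμ hv ha hN hL hab c
    have ha0 := ha.nonneg hμ
    have hb := bLength_pos hN hL
    obtain ⟨t, ht, htq, hle⟩ := exists_mul_jastrowFactor_le (div_nonneg ha0 hb.le)
      ((div_lt_one hb).2 hab)
    exact (groundStateEnergy_periodic_div_le hμ hv ha hL (by omega) hab ht htq
      (bLength_pow_mul hN hL).le c).trans
      (ENNReal.ofReal_le_ofReal (jastrow_le_dysonBound hμ ha0 hN hL hab hle))
  -- The parameter is selected as a function of `x` alone, before `μ`, `v`, `N` and `L` enter, so
  -- that the wall coefficient depends only on the ratio; its value outside `[0, 1)` plays no role.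
  · have h : ∀ x : ℝ, ∃ t, 0 ≤ x → x < 1 → 0 < t ∧ 8 * t < 1 - x ∧
        x * jastrowFactor x t ≤ x * ((1 - x + x ^ 2 - x ^ 3 / 2) / (1 - x) ^ 8) := fun x => by
      by_cases hx : 0 ≤ x ∧ x < 1
      · obtain ⟨t, ht⟩ := exists_mul_jastrowFactor_le hx.1 hx.2
        exact ⟨t, fun _ _ => ht⟩
      · exact ⟨0, fun h0 h1 => (hx ⟨h0, h1⟩).elim⟩
    choose t ht using h
    refine ⟨fun x => boundaryCoeff x (t x), fun μ v a N L hμ hv ha hN hL hab => ?_⟩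
    have ha0 := ha.nonneg hμ
    have hb := bLength_pos hN hL
    obtain ⟨ht0, htq, hle⟩ := ht _ (div_nonneg ha0 hb.le) ((div_lt_one hb).2 hab)
    refine (groundStateEnergy_div_le hμ hv ha hL (by omega) hab ht0 htq
      (bLength_pow_mul hN hL).le _).trans (ENNReal.ofReal_le_ofReal ?_)
    gcongr
    exact jastrow_le_dysonBound hμ ha0 hN hL hab hle
  · intro μ v a ρ Y hμ hv ha hρ hY hY1 bc
    have ha0 := ha.nonneg hμ
    have hc : 0 < 4 * Real.pi * ρ / 3 := by positivity
    set b := (4 * Real.pi * ρ / 3) ^ (-(1 / 3) : ℝ) with hb_def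
    have hb : 0 < b := Real.rpow_pos_of_pos hc _
    have hb3 : b ^ 3 = (4 * Real.pi * ρ / 3)⁻¹ := rpow_neg_third_pow hc
    have hx0 : 0 ≤ a / b := by positivity
    have hYx : Y = (a / b) ^ 3 := by
      rw [hY, div_pow, hb3]
      field_simp
    have hx1 : a / b < 1 := by
      by_contra! h
      exact hY1.not_ge (hYx ▸ one_le_pow₀ h)
    obtain ⟨t, ht, htq, hle⟩ := exists_mul_jastrowFactor_le hx0 hx1
    refine (energyPerParticle_le hμ hv ha hρ hb3 ((div_lt_one hb).1 hx1) ht htq bc).trans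
      (ENNReal.ofReal_le_ofReal ?_)
    have e1 : Y ^ (1 / 3 : ℝ) = a / b := by
      rw [hYx, ← Real.rpow_natCast, ← Real.rpow_mul hx0]
      norm_num
    have e2 : Y ^ (2 / 3 : ℝ) = (a / b) ^ 2 := by
      rw [hYx, ← Real.rpow_natCast, ← Real.rpow_mul hx0]
      norm_num
    have e3 : 3 * μ * a / b ^ 3 = 4 * Real.pi * μ * ρ * a := by
      rw [hb3]
      field_simp
    rw [e1, e2, hYx, ← e3]
    exact mul_jastrowFactor_le hμ hb hle
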